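/- All vector spaces are over $\mathbb C$. For a vertex algebra $V$ write $Y(u,x)=\sum_{n\in\mathbb Z}u_nx^{-n-1}$, and let $V\otimes\mathbb C((z))$ be the tensor product vertex algebra with $Y_{ten}(u\otimes a,x)(v\otimes b)=Y(u,x)v\otimes(e^{x\,d/dz}a)b$ and vacuum $\mathbf 1\otimes 1$. A ($\mathbb C((z))$-valued) pseudo-endomorphism of $V$ is a linear map $\Delta:V\to V\otimes\mathbb C((z))$ with $\Delta(\mathbf 1)=\mathbf 1\otimes 1$ and $\Delta(Y(u,x)v)=Y_{ten}(\Delta(u),x)\Delta(v)$ for $u,v\in V$; it is a pseudo-automorphism if its $\mathbb C((z))$-linear extension is an automorphism of the vertex algebra $V\otimes\mathbb C((z))$. For $v\in V$ and $f\in\mathbb C((z))$ put $X_{v,f}=\sum_{n\ge 0}\frac1{n!}f^{(n)}(z)\,v_n:V\to V\otimes\mathbb C((z))$; powers and the exponential of $X_{v,f}$ are formed with its $\mathbb C((z))$-linear extension. For a $V$-module $(W,Y_W)$ put $Y_W^{\Delta}(v,x)=Y_W(\Delta(x)v,x)$. Let $M(1)=\mathbb C[h_{-1},h_{-2},\dots]\mathbf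 1$ be the Heisenberg vertex algebra with one generator $h=h_{-1}\mathbf 1$. Here $h_{-n}$ acts by multiplication and $h_n$ by $n\,\partial/\partial h_{-n}$ for $n\ge 1$, $h_0=0$, and the vertex operator of $h_{-n_1-1}\cdots h_{-n_r-1}\mathbf 1$ is the normally ordered product of the fields $\frac1{n_i!}\left(\frac{d}{dx}\right)^{n_i}Y(h,x)$. An $M(1)$-module is called a highest weight module if it is generated by a nonzero vector $w$ with $h_0w\in\mathbb Cw$ and $h_nw=0$ for all $n\ge 1$. 1. $M(1)$ is a vertex algebra, the modes of $Y(h,x)$ are the operators $h_n$ above, $[h_m,h_n]=m\,\delta_{m+n,0}$ for $m,n\in\mathbb Z$, and $h_0=0$ on $M(1)$. For every $w\in M(1)$ there is a positive integer $K$ such that $h_{n_1}\cdots h_{n_r}w=0$ for all nonnegative integers $n_1,\dots,n_r$ with $n_1+\cdots+n_r\ge K$. 2. For every $f\in\mathbb C((z))$ the map $X_{h,f}$ is locally nilpotent, so that $\exp X_{h,f}=\sum_{n\ge0}\frac1{n!}X_{h,f}^n$ is a finite sum on each vector, and $\exp X_{h,f}:M(1)\to M(1)\otimes\mathbb C((z))$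 is a pseudo-automorphism of $M(1)$. 3. Let $k\ge1$ and $\Phi_k(z)=\exp(X_{h,z^{-k}})$. Then $\Phi_k(z)$ is a pseudo-automorphism of $M(1)$, $X_{h,z^{-k}}=\sum_{n\ge1}\binom{-k}{n}h_nz^{-n-k}$, $X_{h,z^{-k}}(h)=-kz^{-k-1}\mathbf 1$ and $\Phi_k(z)(h)=h-kz^{-k-1}\mathbf 1$. 4. For every module $(W,Y_W)$ of the vertex algebra $M(1)$, $(W,Y_W^{\Phi_k})$ is again an $M(1)$-module, and the modes $h_n^{\Phi_k}$ of $Y_W^{\Phi_k}(h,x)$ are $h_n^{\Phi_k}=h_n-k\,\delta_{n,k}$ for $n\in\mathbb Z$. 5. In particular $(M(1),Y^{\Phi_k})$ is an $M(1)$-module. On $M(1)$ the operator $h_k$ is locally nilpotent, and $h_k^{\Phi_k}=h_k-k$ is locally finite but not nilpotent, and not even locally nilpotent. The $M(1)$-module $(M(1),Y^{\Phi_k})$ is not a highest weight module. -/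

import Mathlib

open scoped TensorProduct

noncomputable section

namespace TwistedHeisenberg

/-! ### Formal preliminaries -/

/-- `ℂ((z))`, the field of formal Laurent series. -/
def Laur : Type := LaurentSeries ℂ

instance : CommRing Laur := inferInstanceAs (CommRing (LaurentSeries ℂ))

/-- The `ℂ`-algebra structure of `ℂ((z))` given by constant series. -/
instance : Algebra ℂ Laur := (HahnSeries.instAlgebra : Algebra ℂ (HahnSeries ℤ ℂ))

/-- The action of `ℂ((x))` on `W((x))` by multiplication of series. -/
instance {W : Type*} [AddCommGroup W] [Module ℂ W] : Module Laur (HahnModule ℤ ℂ W) :=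
  inferInstanceAs (Module (HahnSeries ℤ ℂ) (HahnModule ℤ ℂ W))

instance {W : Type*} [AddCommGroup W] [Module ℂ W] :
    IsScalarTower ℂ Laur (HahnModule ℤ ℂ W) :=
  inferInstanceAs (IsScalarTower ℂ (HahnSeries ℤ ℂ) (HahnModule ℤ ℂ W))

instance {W : Type*} [AddCommGroup W] [Module ℂ W] :
    SMulCommClass ℂ Laur (HahnModule ℤ ℂ W) :=
  inferInstanceAs (SMulCommClass ℂ (HahnSeries ℤ ℂ) (HahnModule ℤ ℂ W))

/-- The monomial `z ^ n` in `ℂ((z))`. -/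
def zMonomial (n : ℤ) : Laur := (HahnSeries.single n (1 : ℂ) : LaurentSeries ℂ)

/-- The derivation `d/dz` of `ℂ((z))`. -/
def ddz : Laur →ₗ[ℂ] Laur :=
  (LaurentSeries.derivative ℂ : LaurentSeries ℂ →ₗ[ℂ] LaurentSeries ℂ)

/-- The divided power `(1 / i!) (d/dz) ^ i`. -/
def divDeriv (i : ℕ) : Laur →ₗ[ℂ] Laur := ((i.factorial : ℂ)⁻¹) • ddz ^ i

section General

variable {V W : Type*} [AddCommGroup V] [Module ℂ V] [AddCommGroup W] [Module ℂ W]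

/-- The pointwise finite sum of a sequence of linear maps, `v ↦ ∑ i, T i v`. -/
def sumMap (T : ℕ → V →ₗ[ℂ] W) (hT : ∀ v, (Function.support fun i => T i v).Finite) :
    V →ₗ[ℂ] W where
  toFun v := ∑ᶠ i, T i v
  map_add' u v := by
    simp only [map_add]
    exact finsum_add_distrib (hT u) (hT v)
  map_smul' c v := by
    simp only [map_smul, RingHom.id_apply]
    exact (smul_finsum c _).symm

theorem finite_support_of_bound {M : Type*} [Zero M] {f : ℕ → M} (h : ∃ N : ℕ, ∀ i, N ≤ i → f i = 0) :
    (Function.support f).Finite := by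
  obtain ⟨N, hN⟩ := h
  refine (Set.finite_lt_nat N).subset fun i hi => ?_
  by_contra hlt
  exact hi (hN i (not_lt.mp hlt))

/-- The vertex operator `∑ n, F n z ^ (-n-1)`, from modes that annihilate each vector for `n`
large. -/
def vertexOfModes (F : ℤ → Module.End ℂ W) (hF : ∀ w, ∃ N : ℤ, ∀ n, N ≤ n → F n w = 0) :
    VertexOperator ℂ W :=
  VertexOperator.of_coeff (fun y => F (-y - 1)) (by
    intro w
    obtain ⟨N, hN⟩ := hF w
    refine ⟨-N, fun y hy => ?_⟩
    by_contra hlt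
    exact hy (hN _ (by omega)))

theorem ncoeff_vertexOfModes (F : ℤ → Module.End ℂ W)
    (hF : ∀ w, ∃ N : ℤ, ∀ n, N ≤ n → F n w = 0) (n : ℤ) :
    VertexOperator.ncoeff (vertexOfModes F hF) n = F n := by
  simp [vertexOfModes]

theorem vertexOperator_truncation (B : VertexOperator ℂ W) (w : W) :
    ∃ N : ℤ, ∀ n, N ≤ n → VertexOperator.ncoeff B n w = 0 :=
  ⟨-((HahnModule.of ℂ).symm (B w)).order, fun n hn =>
    VertexOperator.ncoeff_eq_zero_of_lt_order B n w (by omega)⟩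

theorem vertexOperator_ext {A B : VertexOperator ℂ W}
    (h : ∀ n w, VertexOperator.ncoeff A n w = VertexOperator.ncoeff B n w) : A = B := by
  apply HVertexOperator.coeff_inj
  funext n
  ext w
  have h1 := h (-n - 1) w
  rw [VertexOperator.ncoeff_apply, VertexOperator.ncoeff_apply] at h1
  have h2 : -(-n - 1) - 1 = n := by ring
  rwa [h2] at h1

/-- The mode `u_n`, where `Y(u, z) = ∑ n, u_n z ^ (-n-1)`. -/
abbrev mode (Y : V →ₗ[ℂ] VertexOperator ℂ W) (u : V) (n : ℤ) : Module.End ℂ W :=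
  VertexOperator.ncoeff (Y u) n

end General

/-! ### Vertex algebras, modules and automorphisms -/

/-- The data of a vertex algebra: a vacuum vector and a vertex operator map
`Y : V → Hom(V, V((x)))`. -/
structure VertexData (V : Type*) [AddCommGroup V] [Module ℂ V] where
  vac : V
  Y : V →ₗ[ℂ] VertexOperator ℂ V

section VertexAlgebra

variable {V W : Type*} [AddCommGroup V] [Module ℂ V] [AddCommGroup W] [Module ℂ W]

/-- `(W, YW)` is a module for the vertex algebra `A`: the vacuum acts as the identity and the Jacobi
identity holds. The latter is written as the equality of the coefficients of
`x₀ ^ (-l-1) x₁ ^ (-m-1) x₂ ^ (-n-1)`; all sums that occur are finite. -/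
structure IsModule (A : VertexData V) (YW : V →ₗ[ℂ] VertexOperator ℂ W) : Prop where
  vac_mode : ∀ n : ℤ, mode YW A.vac n = if n = -1 then 1 else 0
  jacobi : ∀ (u v : V) (w : W) (l m n : ℤ),
    (∑ᶠ i : ℕ, ((-1 : ℂ) ^ i * ((Ring.choose l i : ℤ) : ℂ)) •
        (mode YW u (m + l - i) (mode YW v (n + i) w)
          - (-1 : ℂ) ^ l • mode YW v (n + l - i) (mode YW u (m + i) w)))
      = ∑ᶠ i : ℕ, ((Ring.choose m i : ℤ) : ℂ) • mode YW (mode A.Y u (l + i) v) (m + n - i) w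

/-- The vertex algebra axioms: vacuum property and Jacobi identity (that is, the adjoint module is a
module), together with the creation property. -/
structure IsVertexAlgebra (A : VertexData V) : Prop where
  adjoint : IsModule A A.Y
  creation_nonneg : ∀ (u : V) (n : ℤ), 0 ≤ n → mode A.Y u n A.vac = 0
  creation : ∀ u : V, mode A.Y u (-1) A.vac = u

/-- Automorphisms of a vertex algebra: bijective linear endomorphisms that fix the vacuum and satisfy
`σ (Y(u, x) v) = Y(σ u, x) (σ v)`. -/
structure IsAutomorphism (A : VertexData V) (σ : V →ₗ[ℂ] V) : Prop where
  bijective : Function.Bijective σ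
  map_vac : σ A.vac = A.vac
  map_mode : ∀ (u v : V) (n : ℤ), σ (mode A.Y u n v) = mode A.Y (σ u) n (σ v)

/-! ### The tensor product with `(ℂ((z)), d/dz)` -/

/-- The bilinear map `(a ⊗ u, b ⊗ v) ↦ ((1 / i!) a⁽ⁱ⁾ b) ⊗ u_{n+i} v` on `ℂ((z)) ⊗ V`. -/
def tensorTerm (A : VertexData V) (n : ℤ) (i : ℕ) :
    (Laur ⊗[ℂ] V) →ₗ[ℂ] (Laur ⊗[ℂ] V) →ₗ[ℂ] (Laur ⊗[ℂ] V) :=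
  TensorProduct.map₂ ((LinearMap.mul ℂ Laur) ∘ₗ divDeriv i)
    { toFun := fun u => mode A.Y u (n + i)
      map_add' := fun u v => by simp only [mode, map_add, Pi.add_apply]
      map_smul' := fun c v => by simp only [mode, map_smul, Pi.smul_apply, RingHom.id_apply] }

theorem tensorTerm_tmul (A : VertexData V) (n : ℤ) (i : ℕ) (a b : Laur) (u v : V) :
    tensorTerm A n i (a ⊗ₜ u) (b ⊗ₜ v) = (divDeriv i a * b) ⊗ₜ[ℂ] mode A.Y u (n + i) v := rfl

theorem tensorTerm_truncation (A : VertexData V) (x y : Laur ⊗[ℂ] V) :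
    ∃ N : ℤ, ∀ (n : ℤ) (i : ℕ), N ≤ n + i → tensorTerm A n i x y = 0 := by
  induction x using TensorProduct.induction_on with
  | zero => exact ⟨0, fun n i _ => by simp⟩
  | add x₁ x₂ h₁ h₂ =>
    obtain ⟨N₁, h₁⟩ := h₁
    obtain ⟨N₂, h₂⟩ := h₂
    refine ⟨max N₁ N₂, fun n i h => ?_⟩
    rw [map_add, LinearMap.add_apply, h₁ n i (le_trans (le_max_left _ _) h),
      h₂ n i (le_trans (le_max_right _ _) h), add_zero]
  | tmul a u =>
    induction y using TensorProduct.induction_on with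
    | zero => exact ⟨0, fun n i _ => by simp⟩
    | add y₁ y₂ h₁ h₂ =>
      obtain ⟨N₁, h₁⟩ := h₁
      obtain ⟨N₂, h₂⟩ := h₂
      refine ⟨max N₁ N₂, fun n i h => ?_⟩
      rw [map_add, h₁ n i (le_trans (le_max_left _ _) h),
        h₂ n i (le_trans (le_max_right _ _) h), add_zero]
    | tmul b v =>
      obtain ⟨N, hN⟩ := vertexOperator_truncation (A.Y u) v
      refine ⟨N, fun n i h => ?_⟩
      rw [tensorTerm_tmul, mode, hN _ h, TensorProduct.tmul_zero]

theorem tensorTerm_finite (A : VertexData V) (n : ℤ) (x y : Laur ⊗[ℂ] V) :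
    (Function.support fun i => tensorTerm A n i x y).Finite := by
  obtain ⟨N, hN⟩ := tensorTerm_truncation A x y
  exact finite_support_of_bound ⟨(N - n).toNat, fun i hi => hN n i (by omega)⟩

/-- The `n`-th mode of `x`, for the tensor product vertex algebra:
`(a ⊗ u)_n (b ⊗ v) = ∑ i, ((1 / i!) a⁽ⁱ⁾ b) ⊗ u_{n+i} v`. -/
def tensorMode (A : VertexData V) (n : ℤ) (x : Laur ⊗[ℂ] V) : Module.End ℂ (Laur ⊗[ℂ] V) :=
  sumMap (fun i => tensorTerm A n i x) (tensorTerm_finite A n x)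

theorem tensorMode_truncation (A : VertexData V) (x y : Laur ⊗[ℂ] V) :
    ∃ N : ℤ, ∀ n, N ≤ n → tensorMode A n x y = 0 := by
  obtain ⟨N, hN⟩ := tensorTerm_truncation A x y
  refine ⟨N, fun n hn => ?_⟩
  have : ∀ i : ℕ, tensorTerm A n i x y = 0 := fun i => hN n i (by omega)
  simp [tensorMode, sumMap, this]

/-- The tensor product vertex algebra of `V` and `(ℂ((z)), d/dz)`, with vacuum `1 ⊗ 𝟏` and
`Y_ten(a ⊗ u, x) (b ⊗ v) = (e^{x d/dz} a) b ⊗ Y(u, x) v`. The factor `ℂ((z))` is written on the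
left. -/
def tensorLaur (A : VertexData V) : VertexData (Laur ⊗[ℂ] V) where
  vac := 1 ⊗ₜ A.vac
  Y :=
    { toFun := fun x => vertexOfModes (fun n => tensorMode A n x) (tensorMode_truncation A x)
      map_add' := fun x y => by
        refine vertexOperator_ext fun n w => ?_
        simp only [map_add, Pi.add_apply, LinearMap.add_apply, ncoeff_vertexOfModes]
        simp only [tensorMode, sumMap, LinearMap.coe_mk, AddHom.coe_mk, map_add,
          LinearMap.add_apply]
        exact finsum_add_distrib (tensorTerm_finite A n x w) (tensorTerm_finite A n y w)
      map_smul' := fun c x => by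
        refine vertexOperator_ext fun n w => ?_
        simp only [map_smul, Pi.smul_apply, LinearMap.smul_apply, ncoeff_vertexOfModes,
          RingHom.id_apply]
        simp only [tensorMode, sumMap, LinearMap.coe_mk, AddHom.coe_mk, map_smul,
          LinearMap.smul_apply]
        exact (smul_finsum c _).symm }

/-! ### Pseudo-endomorphisms and pseudo-automorphisms -/

/-- The `ℂ((z))`-linear extension `ℂ((z)) ⊗ V → ℂ((z)) ⊗ V` of `Δ : V → ℂ((z)) ⊗ V`. -/
def extendLaur (Δ : V →ₗ[ℂ] Laur ⊗[ℂ] V) : (Laur ⊗[ℂ] V) →ₗ[Laur] (Laur ⊗[ℂ] V) :=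
  LinearMap.liftBaseChange Laur Δ

/-- `ℂ((z))`-valued pseudo-endomorphisms: `Δ 𝟏 = 1 ⊗ 𝟏` and
`Δ Y(u, x) v = Y(e^{x (d/dz ⊗ 1)} Δ u, x) Δ v`. -/
structure IsPseudoEndomorphism (A : VertexData V) (Δ : V →ₗ[ℂ] Laur ⊗[ℂ] V) : Prop where
  map_vac : Δ A.vac = 1 ⊗ₜ A.vac
  map_mode : ∀ (u v : V) (n : ℤ), Δ (mode A.Y u n v) = tensorMode A n (Δ u) (Δ v)

/-- A pseudo-automorphism is a pseudo-endomorphism whose `ℂ((z))`-linear extension is an automorphism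
of the tensor product vertex algebra. -/
structure IsPseudoAutomorphism (A : VertexData V) (Δ : V →ₗ[ℂ] Laur ⊗[ℂ] V) : Prop where
  isPseudoEndomorphism : IsPseudoEndomorphism A Δ
  isAutomorphism : IsAutomorphism (tensorLaur A) ((extendLaur Δ).restrictScalars ℂ)

/-- `X_{v,f} = ∑ n ≥ 0, (1 / n!) f⁽ⁿ⁾ v_n`, as a map `V → ℂ((z)) ⊗ V`. -/
def pseudoX (A : VertexData V) (v : V) (f : Laur) : V →ₗ[ℂ] Laur ⊗[ℂ] V :=
  sumMap (fun n : ℕ => TensorProduct.mk ℂ Laur V (divDeriv n f) ∘ₗ mode A.Y v n) (by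
    intro w
    obtain ⟨N, hN⟩ := vertexOperator_truncation (A.Y v) w
    refine finite_support_of_bound ⟨N.toNat, fun i hi => ?_⟩
    have h0 : mode A.Y v (i : ℤ) w = 0 := hN _ (by omega)
    rw [LinearMap.comp_apply, h0, map_zero])

/-- For each `v`, some power of (the `ℂ((z))`-linear extension of) `X` annihilates `1 ⊗ v`, so that
the series `∑ n, X ^ n v / n!` is a finite sum in `ℂ((z)) ⊗ V`. -/
def IsLocNilpotent (X : V →ₗ[ℂ] Laur ⊗[ℂ] V) : Prop :=
  ∀ v : V, ∃ N : ℕ, (extendLaur X ^ N) (1 ⊗ₜ v) = 0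

/-- `exp X = ∑ n, X ^ n / n!` as a map `V → ℂ((z)) ⊗ V`, where the powers are those of the
`ℂ((z))`-linear extension of `X`. -/
def pseudoExp (X : V →ₗ[ℂ] Laur ⊗[ℂ] V) (hX : IsLocNilpotent X) : V →ₗ[ℂ] Laur ⊗[ℂ] V :=
  sumMap (fun n : ℕ => ((n.factorial : ℂ)⁻¹) •
      (((extendLaur X ^ n).restrictScalars ℂ) ∘ₗ TensorProduct.mk ℂ Laur V 1)) (by
    intro v
    obtain ⟨N, hN⟩ := hX v
    refine finite_support_of_bound ⟨N, fun i hi => ?_⟩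
    obtain ⟨j, rfl⟩ := Nat.exists_eq_add_of_le' hi
    simp [pow_add, hN])

/-- The twist `Y_W^Δ(v, x) = Y_W(Δ(x) v, x)`: if `Δ(x) v = ∑ f_j(x) ⊗ v_j` then
`Y_W^Δ(v, x) = ∑ f_j(x) Y_W(v_j, x)`. -/
def twist (YW : V →ₗ[ℂ] VertexOperator ℂ W) (Δ : V →ₗ[ℂ] Laur ⊗[ℂ] V) :
    V →ₗ[ℂ] VertexOperator ℂ W :=
  ((LinearMap.liftBaseChange Laur YW).restrictScalars ℂ) ∘ₗ Δ

end VertexAlgebra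

/-! ### Local properties of endomorphisms -/

section Local

variable {W : Type*} [AddCommGroup W] [Module ℂ W]

/-- Every vector is killed by some power of `T`. -/
def IsLocallyNilpotentEnd (T : Module.End ℂ W) : Prop :=
  ∀ w : W, ∃ N : ℕ, (T ^ N) w = 0

/-- Every vector lies in a finite-dimensional `T`-stable subspace. -/
def IsLocallyFiniteEnd (T : Module.End ℂ W) : Prop :=
  ∀ w : W, ∃ U : Submodule ℂ W, w ∈ U ∧ FiniteDimensional ℂ U ∧ ∀ x ∈ U, T x ∈ U

end Local

/-! ### The Heisenberg vertex algebra `M(1)` -/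

/-- The Fock space, the polynomial algebra on the commuting creation operators; the variable `X n`
stands for `h_{-n-1}`. -/
abbrev Fock : Type := MvPolynomial ℕ ℂ

/-- The action of the Heisenberg algebra on the Fock space: `h_{-n-1}` is multiplication by the
variable `X n`, `h_0 = 0`, and `h_{n+1} = (n + 1) ∂ / ∂ X n`. -/
def heis : ℤ → Module.End ℂ Fock
  | Int.ofNat 0 => 0
  | Int.ofNat (n + 1) => ((n + 1 : ℕ) : ℂ) • (MvPolynomial.pderiv n).toLinearMap
  | Int.negSucc n => LinearMap.mulLeft ℂ (MvPolynomial.X n)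

theorem heis_truncation (w : Fock) : ∃ N : ℕ, ∀ j : ℕ, N ≤ j → heis (j : ℤ) w = 0 := by
  refine ⟨w.vars.sup id + 2, fun j hj => ?_⟩
  obtain ⟨n, rfl⟩ : ∃ n, j = n + 1 := ⟨j - 1, by omega⟩
  have hn : n ∉ w.vars := fun h => by
    have := Finset.le_sup (f := id) h
    simp only [id] at this
    omega
  change (((n + 1 : ℕ) : ℂ) • (MvPolynomial.pderiv n).toLinearMap) w = 0
  have h0 : MvPolynomial.pderiv n w = 0 := MvPolynomial.pderiv_eq_zero_of_notMem_vars hn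
  simp [h0]

/-- The `j`-th summand of the `m`-th mode of the normally ordered product
`:(1 / n!) h⁽ⁿ⁾(z) B(z):`. -/
def normalTerm (n : ℕ) (B : VertexOperator ℂ Fock) (m : ℤ) (j : ℕ) : Module.End ℂ Fock :=
  (((n + j).choose j : ℕ) : ℂ) •
    (heis (-n - 1 - j) * VertexOperator.ncoeff B (m + j)
      + (-1 : ℂ) ^ n • (VertexOperator.ncoeff B (m - n - 1 - j) * heis j))

theorem normalTerm_finite (n : ℕ) (B : VertexOperator ℂ Fock) (m : ℤ) (w : Fock) :
    (Function.support fun j => normalTerm n B m j w).Finite := by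
  obtain ⟨N, hN⟩ := vertexOperator_truncation B w
  obtain ⟨J, hJ⟩ := heis_truncation w
  refine finite_support_of_bound ⟨max J (N - m).toNat, fun j hj => ?_⟩
  have h1 := hN (m + j) (by have := le_trans (le_max_right _ _) hj; omega)
  have h2 := hJ j (le_trans (le_max_left _ _) hj)
  simp [normalTerm, h1, h2]

/-- The `m`-th mode of `:(1 / n!) h⁽ⁿ⁾(z) B(z):`, where `h(z) = ∑ j, h_j z ^ (-j-1)`; the regular
part of `h⁽ⁿ⁾(z)` stands to the left of `B(z)` and the singular part to the right. -/
def normalMode (n : ℕ) (B : VertexOperator ℂ Fock) (m : ℤ) : Module.End ℂ Fock :=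
  sumMap (normalTerm n B m) (normalTerm_finite n B m)

theorem normalMode_truncation (n : ℕ) (B : VertexOperator ℂ Fock) (w : Fock) :
    ∃ N : ℤ, ∀ m, N ≤ m → normalMode n B m w = 0 := by
  obtain ⟨N, hN⟩ := vertexOperator_truncation B w
  obtain ⟨J, hJ⟩ := heis_truncation w
  choose M hM using fun j : ℕ => vertexOperator_truncation B (heis j w)
  obtain ⟨K, hK⟩ := ((Finset.range J).image M).bddAbove
  refine ⟨max N (K + n + 1 + J), fun m hm => ?_⟩
  have hz : ∀ j : ℕ, normalTerm n B m j w = 0 := by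
    intro j
    have h1 := hN (m + j) (by have := le_trans (le_max_left _ _) hm; omega)
    have h2 : VertexOperator.ncoeff B (m - n - 1 - j) (heis j w) = 0 := by
      by_cases hj : J ≤ j
      · rw [hJ j hj, map_zero]
      · refine hM j _ ?_
        have hKj : M j ≤ K := hK (by simpa using ⟨j, by omega, rfl⟩)
        have := le_trans (le_max_right _ _) hm
        omega
    simp [normalTerm, h1, h2]
  simp [normalMode, sumMap, hz]

/-- The normally ordered product `:(1 / n!) h⁽ⁿ⁾(z) B(z):`. -/
def normalProd (n : ℕ) (B : VertexOperator ℂ Fock) : VertexOperator ℂ Fock :=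
  vertexOfModes (normalMode n B) (normalMode_truncation n B)

/-- The identity operator as a vertex operator, `Y(𝟏, z) = 1`. -/
def idField : VertexOperator ℂ Fock :=
  vertexOfModes (fun n => if n = -1 then 1 else 0)
    (fun w => ⟨0, fun n hn => by rw [if_neg (by omega)]; rfl⟩)

/-- The Heisenberg vertex algebra `M(1)`: the vacuum is `1`, and the vertex operator of a monomial
`h_{-n₁-1} ⋯ h_{-n_r-1} 𝟏` is the nested normally ordered product of the fields
`(1 / n_i!) h^{(n_i)}(z)`, with the factors taken in increasing order. -/
def heisenberg : VertexData Fock where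
  vac := 1
  Y := (MvPolynomial.basisMonomials ℕ ℂ).constr ℂ fun s =>
    ((Finsupp.toMultiset s).sort (· ≤ ·)).foldr normalProd idField

/-- The generator `h = h_{-1} 𝟏` of `M(1)`. -/
def hvec : Fock := MvPolynomial.X 0

/-- A highest weight `M(1)`-module: one that is generated by a nonzero vector `w` with
`h_0 w = c w` for a scalar `c` and `h_n w = 0` for `n ≥ 1`. -/
def IsHighestWeightModule {W : Type*} [AddCommGroup W] [Module ℂ W]
    (YW : Fock →ₗ[ℂ] VertexOperator ℂ W) : Prop :=
  ∃ (c : ℂ) (w : W), w ≠ 0 ∧ mode YW hvec 0 w = c • w ∧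
    (∀ n : ℤ, 1 ≤ n → mode YW hvec n w = 0) ∧
    ∀ U : Submodule ℂ W, w ∈ U →
      (∀ (v : Fock) (n : ℤ), ∀ x ∈ U, mode YW v n x ∈ U) → U = ⊤

end TwistedHeisenberg

end

open TwistedHeisenberg

/-! Everything about `M(1)` is controlled by brackets with the operators h_k. The recursion
`heisenberg_Y_X_mul` (multiplying u by a variable means one more normally ordered factor) gives, by
induction on u, `heis_commutatorFormula`: the bracket of h_k with u_m is the sum over i ≥ 0 of
binom(k,i) (h_i u)_{m+k-i}.

For the Jacobi identity, let D(u,v) be the difference of its two sides, an operator bilinear in u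
and v. Bracketing with h_k turns D(u,v) into a combination of D(h_i u, v) and D(u, h_i v) with i ≥ 0
(`CommutatorFormula.jacDefect_comm`). These h_i lower the degree or vanish, so by induction on the
total degree D(u,v) commutes with the whole Heisenberg algebra. Such an operator is determined by
the constant term of its value on the vacuum (`eq_zero_of_heis_comm`). That constant term is
computed from two-point functions (`vacCoeff_mode_mode_one`), skew-symmetry (`vacCoeff_skew`) and a
three-term binomial identity, and it is zero.

The commutator formula for k ≥ 0 also says that the extension of X_{h,f} is a derivation of all
products of the tensor product algebra (`extendLaur_pseudoX_tensorMode`). It lowers the degree,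
hence is locally nilpotent, and it kills the vacuum. The exponential of such a derivation is an
automorphism with inverse exp(-X).

For twists, Y_W is extended to f ⊗ v by f(x) Y_W(v,x). The extension satisfies the Jacobi identity
over the tensor product: for monomials z^s, z^t it is the identity of W with m and n shifted by s
and t, and on a fixed vector a Laurent series differs from a finite sum of monomials by a tail that
contributes nothing. Restricting along a pseudo-endomorphism gives `IsModule.twist`.

Finally, X_{h,z^{-k}} squares to zero on h, so the twist changes only h_k, by the scalar -k. As h_k
is locally nilpotent for weight reasons, it has no nonzero eigenvalue; this excludes both local
nilpotency of h_k - k and a highest weight vector. -/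

noncomputable section

namespace TwistedHeisenberg

/-! ### Sums of eventually vanishing sequences -/

section FiniteSums

variable {M N : Type*} [AddCommGroup M] [AddCommGroup N]

/-- The sequence `f` vanishes from some index on. -/
abbrev EvZero (f : ℕ → M) : Prop := ∀ᶠ i in Filter.atTop, f i = 0

theorem EvZero.finite {f : ℕ → M} (hf : EvZero f) : (Function.support f).Finite :=
  finite_support_of_bound (Filter.eventually_atTop.1 hf)

theorem finsum_eq_sum_range {f : ℕ → M} {n : ℕ} (h : ∀ i, n ≤ i → f i = 0) :
    ∑ᶠ i, f i = ∑ i ∈ Finset.range n, f i := by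
  refine finsum_eq_sum_of_support_subset f fun i hi => ?_
  by_contra hn
  exact hi (h i (by simpa using hn))

theorem EvZero.finsum_add {f g : ℕ → M} (hf : EvZero f) (hg : EvZero g) :
    ∑ᶠ i, (f i + g i) = ∑ᶠ i, f i + ∑ᶠ i, g i :=
  finsum_add_distrib hf.finite hg.finite

theorem EvZero.finsum_sub {f g : ℕ → M} (hf : EvZero f) (hg : EvZero g) :
    ∑ᶠ i, (f i - g i) = ∑ᶠ i, f i - ∑ᶠ i, g i :=
  finsum_sub_distrib hf.finite hg.finite

theorem EvZero.map_finsum {F : Type*} [FunLike F M N] [AddMonoidHomClass F M N] (T : F)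
    {f : ℕ → M} (hf : EvZero f) : T (∑ᶠ i, f i) = ∑ᶠ i, T (f i) :=
  (AddMonoidHomClass.toAddMonoidHom T).map_finsum hf.finite

theorem EvZero.finsum_smul [Module ℂ M] (c : ℂ) (f : ℕ → M) :
    ∑ᶠ i, c • f i = c • ∑ᶠ i, f i := (smul_finsum c f).symm

theorem EvZero.add {f g : ℕ → M} (hf : EvZero f) (hg : EvZero g) : EvZero fun i => f i + g i := by
  filter_upwards [hf, hg] with i h₁ h₂
  rw [h₁, h₂, add_zero]

theorem EvZero.map {F : Type*} [FunLike F M N] [AddMonoidHomClass F M N] (T : ℕ → F)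
    {f : ℕ → M} (hf : EvZero f) : EvZero fun i => T i (f i) := by
  filter_upwards [hf] with i h
  rw [h, map_zero]

theorem EvZero.smul {R : Type*} [Semiring R] [Module R M] (c : ℕ → R) {f : ℕ → M} (hf : EvZero f) :
    EvZero fun i => c i • f i := by
  filter_upwards [hf] with i h
  rw [h, smul_zero]

theorem EvZero.finsum_sum_comm {ι : Type*} {s : Finset ι} {f : ι → ℕ → M}
    (h : ∀ a ∈ s, EvZero (f a)) : ∑ᶠ i, ∑ a ∈ s, f a i = ∑ a ∈ s, ∑ᶠ i, f a i :=
  _root_.finsum_sum_comm s (fun i a => f a i) fun a ha => (h a ha).finite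

/-- Uniform vanishing is needed in one index only: it turns that sum into one over a fixed range,
which commutes with the other sum. -/
theorem EvZero.finsum_comm {G : ℕ → ℕ → M} (h₁ : ∀ᶠ i in Filter.atTop, ∀ j, G j i = 0)
    (h₂ : ∀ i, EvZero fun j => G j i) : ∑ᶠ j, ∑ᶠ i, G j i = ∑ᶠ i, ∑ᶠ j, G j i := by
  obtain ⟨n, hn⟩ := Filter.eventually_atTop.1 h₁
  calc ∑ᶠ j, ∑ᶠ i, G j i = ∑ᶠ j, ∑ i ∈ Finset.range n, G j i :=
        finsum_congr fun j => finsum_eq_sum_range fun i hi => hn i hi j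
    _ = ∑ i ∈ Finset.range n, ∑ᶠ j, G j i :=
        EvZero.finsum_sum_comm (f := fun i j => G j i) fun i _ => h₂ i
    _ = _ := (finsum_eq_sum_range fun i hi => by simp [hn i hi]).symm

/-- The support lies in a finite triangle, so this is a regrouping along antidiagonals. It is the
Cauchy product behind every Vandermonde, Leibniz and exponential argument below. -/
theorem finsum_triangle {G : ℕ → ℕ → M} {n : ℕ} (h : ∀ j i, n ≤ j + i → G j i = 0) :
    ∑ᶠ j, ∑ᶠ i, G j i = ∑ᶠ t, ∑ p ∈ Finset.HasAntidiagonal.antidiagonal t, G p.1 p.2 := by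
  have h₁ : ∀ j, ∑ᶠ i, G j i = ∑ i ∈ Finset.range n, G j i := fun j =>
    finsum_eq_sum_range fun i hi => h j i (by omega)
  have h₂ : ∑ᶠ t, ∑ p ∈ Finset.HasAntidiagonal.antidiagonal t, G p.1 p.2
      = ∑ t ∈ Finset.range n, ∑ p ∈ Finset.HasAntidiagonal.antidiagonal t, G p.1 p.2 :=
    finsum_eq_sum_range fun t ht => Finset.sum_eq_zero fun p hp =>
      h _ _ (by rw [Finset.HasAntidiagonal.mem_antidiagonal.1 hp]; exact ht)
  rw [finsum_congr h₁, h₂, finsum_eq_sum_range (n := n) fun j hj => Finset.sum_eq_zero fun i _ =>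
    h j i (by omega)]
  rw [← Finset.sum_product', Finset.sum_sigma']
  refine (Finset.sum_of_injOn (fun x : (_ : ℕ) × ℕ × ℕ => x.2) ?_ ?_ ?_ ?_).symm
  · rintro ⟨a, p⟩ ha ⟨b, q⟩ hb hab
    simp only [Finset.coe_sigma, Set.mem_sigma_iff, Finset.mem_coe, Finset.HasAntidiagonal.mem_antidiagonal] at *
    obtain ⟨-, rfl⟩ := ha
    obtain ⟨-, rfl⟩ := hb
    subst hab
    rfl
  · rintro ⟨a, p⟩ ha
    simp only [Finset.coe_sigma, Set.mem_sigma_iff, Finset.mem_coe, Finset.HasAntidiagonal.mem_antidiagonal,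
      Finset.mem_range, Finset.coe_product, Set.mem_prod] at *
    omega
  · rintro ⟨j, i⟩ _ hji
    by_contra hne
    refine hji ⟨⟨j + i, j, i⟩, ?_, rfl⟩
    simp only [Finset.coe_sigma, Set.mem_sigma_iff, Finset.mem_coe, Finset.HasAntidiagonal.mem_antidiagonal,
      Finset.mem_range, and_true]
    by_contra hle
    exact hne (h j i (by omega))
  · intro x _
    rfl

theorem finsum_shift {f : ℕ → M} (hf : EvZero f) (s : ℕ) (h : ∀ i < s, f i = 0) :
    ∑ᶠ i, f i = ∑ᶠ i, f (s + i) := by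
  obtain ⟨n, hn⟩ := Filter.eventually_atTop.1 hf
  rw [finsum_eq_sum_range (n := s + n) fun i hi => hn i (by omega),
    finsum_eq_sum_range (n := n) fun i hi => hn (s + i) (by omega), Finset.sum_range_add,
    Finset.sum_eq_zero (s := Finset.range s) fun i hi => h i (Finset.mem_range.1 hi), zero_add]

end FiniteSums

/-! ### Binomial coefficients -/

/-- The binomial coefficient of an integer, as a complex number. -/
def binom (a : ℤ) (i : ℕ) : ℂ := ((Ring.choose a i : ℤ) : ℂ)

theorem binom_zero_right (a : ℤ) : binom a 0 = 1 := by simp [binom]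

theorem binom_one_right (a : ℤ) : binom a 1 = a := by simp [binom]

theorem binom_natCast (n i : ℕ) : binom n i = (n.choose i : ℂ) := by
  simp [binom, Ring.choose_natCast]

theorem binom_zero_left (i : ℕ) : binom 0 i = if i = 0 then 1 else 0 := by
  rw [binom, Ring.choose_zero_ite]
  split_ifs <;> simp

theorem binom_neg (a : ℤ) (i : ℕ) : binom (-a) i = (-1) ^ i * binom (a + i - 1) i := by
  simp only [binom, Ring.choose_neg]
  rw [Units.smul_def, Int.negOnePow_def]
  simp

theorem binom_add (a b : ℤ) (t : ℕ) :
    binom (a + b) t = ∑ p ∈ Finset.HasAntidiagonal.antidiagonal t, binom a p.1 * binom b p.2 := by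
  simp only [binom, Ring.add_choose_eq t (Commute.all a b)]
  push_cast
  rfl

theorem binom_mul_binom (k : ℤ) (s i : ℕ) :
    binom k (s + i) * ((s + i).choose s : ℂ) = binom k s * binom (k - s) i := by
  have h := Ring.choose_smul_choose k (Nat.le_add_right s i)
  rw [Nat.add_sub_cancel_left, nsmul_eq_mul] at h
  simp only [binom]
  rw [mul_comm]
  exact_mod_cast congrArg (Int.cast : ℤ → ℂ) h

theorem succ_mul_binom_succ (k : ℤ) (n : ℕ) :
    ((n : ℂ) + 1) * binom k (n + 1) = k * binom (k - 1) n := by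
  have h := binom_mul_binom k 1 n
  rw [binom_one_right, Nat.choose_one_right, add_comm 1 n] at h
  push_cast at h
  rw [mul_comm, h]

/-- Rewrites the coefficients of the normally ordered product as binomials with negative upper
entry, so that they fit the Vandermonde identities. -/
theorem choose_eq_binom_neg (n j : ℕ) :
    (((n + j).choose j : ℕ) : ℂ) = (-1) ^ j * binom (-n - 1) j := by
  rw [show (-n - 1 : ℤ) = -(n + 1) by ring, binom_neg, ← mul_assoc, ← mul_pow, neg_one_mul,
    neg_neg, one_pow, one_mul, ← binom_natCast]
  congr 1
  push_cast
  ring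

/-- On the antidiagonal, reflecting the second factor makes its upper entry q - 1 - m - l,
independent of p. Vandermonde then cancels l, and a second reflection returns to m. -/
theorem sum_binom_mul_binom_sub (l m : ℤ) (q : ℕ) :
    ∑ p ∈ Finset.HasAntidiagonal.antidiagonal q, (-1) ^ p.1 * binom l p.1 * binom (m + l - p.1) p.2
      = binom m q := by
  have h : ∀ p ∈ Finset.HasAntidiagonal.antidiagonal q, (-1) ^ p.1 * binom l p.1 * binom (m + l - p.1) p.2
      = (-1) ^ q * (binom l p.1 * binom (q - 1 - m - l) p.2) := by
    intro p hp
    have hq : (q : ℤ) = p.1 + p.2 := by exact_mod_cast (Finset.HasAntidiagonal.mem_antidiagonal.1 hp).symm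
    have hq' : q = p.1 + p.2 := (Finset.HasAntidiagonal.mem_antidiagonal.1 hp).symm
    rw [show m + l - p.1 = -(p.1 - m - l) by ring, binom_neg,
      show (p.1 - m - l + p.2 - 1 : ℤ) = q - 1 - m - l by rw [hq]; ring, hq', pow_add]
    ring
  rw [Finset.sum_congr rfl h, ← Finset.mul_sum, ← binom_add,
    show (l + (q - 1 - m - l) : ℤ) = -m + q - 1 by ring, ← binom_neg, neg_neg]

/-- `binom a k` for an integer `k`, zero for `k < 0`. -/
def binomInt (a k : ℤ) : ℂ := if k < 0 then 0 else binom a k.toNat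

theorem binomInt_of_neg {a k : ℤ} (h : k < 0) : binomInt a k = 0 := if_pos h

theorem binomInt_natCast (a : ℤ) (k : ℕ) : binomInt a k = binom a k := by
  rw [binomInt, if_neg (by omega), Int.toNat_natCast]

theorem binomInt_symm {a b : ℤ} (ha : 0 ≤ a) : binomInt a b = binomInt a (a - b) := by
  lift a to ℕ using ha
  rcases lt_or_ge b 0 with hb | hb
  · rw [binomInt_of_neg hb, show (a - b : ℤ) = ((a - b).toNat : ℤ) by omega, binomInt_natCast,
      binom_natCast, Nat.choose_eq_zero_of_lt (by omega), Nat.cast_zero]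
  · lift b to ℕ using hb
    rcases lt_or_ge a b with h | h
    · rw [binomInt_of_neg (k := a - b) (by omega), binomInt_natCast, binom_natCast,
        Nat.choose_eq_zero_of_lt h, Nat.cast_zero]
    · rw [show (a - b : ℤ) = ((a - b : ℕ) : ℤ) by omega, binomInt_natCast, binomInt_natCast,
        binom_natCast, binom_natCast, Nat.choose_symm h]

theorem binomInt_neg (a k : ℤ) : binomInt (-a) k = (-1) ^ k * binomInt (a + k - 1) k := by
  rcases lt_or_ge k 0 with hk | hk
  · rw [binomInt_of_neg hk, binomInt_of_neg hk, mul_zero]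
  · lift k to ℕ using hk
    rw [binomInt_natCast, binomInt_natCast, binom_neg, zpow_natCast]

/-- If m ≥ 0 or n ≥ 0, one term on the left has negative lower entry and vanishes; the other matches
the right-hand side by symmetry, after a reflection when m < 0. If both are negative, the right-hand
side vanishes and the two terms on the left agree. -/
theorem binomInt_three_term (m n : ℤ) :
    binomInt m (-n - 1) - (-1) ^ (m + n) * binomInt n (-m - 1) = binomInt m (m + n + 1) := by
  have e : ((-1 : ℂ)) ≠ 0 := by norm_num
  have sq : ∀ a : ℤ, ((-1 : ℂ)) ^ a * (-1) ^ a = 1 := fun a => by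
    rw [← mul_zpow]; norm_num
  rcases le_or_gt 0 m with hm | hm
  · rw [binomInt_of_neg (show -m - 1 < 0 by omega), binomInt_symm hm, mul_zero, sub_zero]
    congr 1
    ring
  rcases le_or_gt 0 n with hn | hn
  · rw [binomInt_of_neg (show -n - 1 < 0 by omega), binomInt_symm hn, zero_sub,
      show binomInt m (m + n + 1) = binomInt (-(-m)) (m + n + 1) by rw [neg_neg],
      binomInt_neg, zpow_add₀ e _ 1]
    rw [show n - (-m - 1) = m + n + 1 by ring, show -m + (m + n + 1) - 1 = n by ring]
    ring
  · rw [binomInt_of_neg (show m + n + 1 < 0 by omega)]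
    rw [show binomInt m (-n - 1) = binomInt (-(-m)) (-n - 1) by rw [neg_neg],
      show binomInt n (-m - 1) = binomInt (-(-n)) (-m - 1) by rw [neg_neg],
      binomInt_neg, binomInt_neg (-n), binomInt_symm (a := -n + (-m - 1) - 1) (by omega),
      show -n + (-m - 1) - 1 - (-m - 1) = -n - 1 by ring,
      show -n + (-m - 1) - 1 = -m + (-n - 1) - 1 by ring, ← mul_assoc, ← zpow_add₀ e,
      show m + n + (-m - 1) = (-n - 1) + 2 * n by ring, zpow_add₀ e, zpow_mul]
    norm_num

/-! ### Vandermonde rearrangements -/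

section Vandermonde

variable {M : Type*} [AddCommGroup M] [Module ℂ M]

theorem finsum_binom_binom {F : ℕ → M} (hF : EvZero F) (a b : ℤ) :
    ∑ᶠ j : ℕ, binom a j • ∑ᶠ i : ℕ, binom b i • F (j + i) = ∑ᶠ t : ℕ, binom (a + b) t • F t := by
  obtain ⟨n, hn⟩ := Filter.eventually_atTop.1 hF
  simp only [smul_finsum, smul_smul]
  rw [finsum_triangle (n := n) fun j i h => by rw [hn _ h, smul_zero]]
  refine finsum_congr fun t => ?_
  rw [binom_add, Finset.sum_smul]
  refine Finset.sum_congr rfl fun p hp => ?_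
  rw [Finset.HasAntidiagonal.mem_antidiagonal.1 hp]

/-- The terms with i < s vanish; after shifting by s, `binom_mul_binom` pulls out the factor `binom
k s`. -/
theorem finsum_binom_choose {G : ℤ → M} (hG : ∃ n : ℤ, ∀ t, n ≤ t → G t = 0) (k : ℤ) (s : ℕ) :
    ∑ᶠ i : ℕ, binom k i • ((i.choose s : ℕ) : ℂ) • G (i - s)
      = binom k s • ∑ᶠ i : ℕ, binom (k - s) i • G i := by
  obtain ⟨n, hn⟩ := hG
  rw [finsum_shift _ s]
  · rw [smul_finsum]
    refine finsum_congr fun i => ?_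
    rw [smul_smul, smul_smul, binom_mul_binom]
    congr 2
    push_cast
    ring
  · intro i hi
    rw [Nat.choose_eq_zero_of_lt hi, Nat.cast_zero, zero_smul, smul_zero]
  · filter_upwards [Filter.eventually_ge_atTop ((n + s).toNat)] with i hi
    rw [hn _ (by omega), smul_zero, smul_zero]

end Vandermonde

/-! ### The two sides of the Jacobi identity -/

section JacobiSides

variable {V W : Type*} [AddCommGroup V] [Module ℂ V] [AddCommGroup W] [Module ℂ W]

theorem mode_add (Y : V →ₗ[ℂ] VertexOperator ℂ W) (u v : V) (n : ℤ) :
    mode Y (u + v) n = mode Y u n + mode Y v n := by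
  simp only [mode, map_add, Pi.add_apply]

theorem mode_smul (Y : V →ₗ[ℂ] VertexOperator ℂ W) (c : ℂ) (u : V) (n : ℤ) :
    mode Y (c • u) n = c • mode Y u n := by
  simp only [mode, map_smul, Pi.smul_apply]

/-- The `n`-th mode as a bilinear map. -/
def modeBilin (Y : V →ₗ[ℂ] VertexOperator ℂ W) (n : ℤ) : V →ₗ[ℂ] W →ₗ[ℂ] W where
  toFun u := mode Y u n
  map_add' u v := mode_add Y u v n
  map_smul' c u := mode_smul Y c u n

theorem mode_zero (Y : V →ₗ[ℂ] VertexOperator ℂ W) (n : ℤ) : mode Y 0 n = 0 :=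
  map_zero (modeBilin Y n)

theorem mode_sum (Y : V →ₗ[ℂ] VertexOperator ℂ W) {ι : Type*} (s : Finset ι) (f : ι → V) (n : ℤ) :
    mode Y (∑ i ∈ s, f i) n = ∑ i ∈ s, mode Y (f i) n :=
  map_sum (modeBilin Y n) f s

theorem mode_finsum_apply (Y : V →ₗ[ℂ] VertexOperator ℂ W) {f : ℕ → V} (hf : EvZero f) (n : ℤ)
    (w : W) : mode Y (∑ᶠ i, f i) n w = ∑ᶠ i, mode Y (f i) n w :=
  hf.map_finsum ((modeBilin Y n).flip w)

theorem evZero_mode_add (Y : V →ₗ[ℂ] VertexOperator ℂ W) (u : V) (w : W) (n : ℤ) :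
    EvZero fun i : ℕ => mode Y u (n + i) w := by
  obtain ⟨N, hN⟩ := vertexOperator_truncation (Y u) w
  filter_upwards [Filter.eventually_ge_atTop (N - n).toNat] with i hi
  exact hN _ (by omega)

theorem evZero_mode_natCast (Y : V →ₗ[ℂ] VertexOperator ℂ W) (u : V) (w : W) :
    EvZero fun i : ℕ => mode Y u i w := by
  simpa only [zero_add] using evZero_mode_add Y u w 0

/-- The `i`-th summand on the left-hand side of the Jacobi identity. -/
def jacLeftTerm (YW : V →ₗ[ℂ] VertexOperator ℂ W) (l m n : ℤ) (u v : V) (i : ℕ) :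
    W →ₗ[ℂ] W :=
  ((-1 : ℂ) ^ i * binom l i) • (mode YW u (m + l - i) * mode YW v (n + i)
    - (-1 : ℂ) ^ l • (mode YW v (n + l - i) * mode YW u (m + i)))

/-- The `i`-th summand on the right-hand side of the Jacobi identity. -/
def jacRightTerm (A : VertexData V) (YW : V →ₗ[ℂ] VertexOperator ℂ W) (l m n : ℤ) (u v : V)
    (i : ℕ) : W →ₗ[ℂ] W :=
  binom m i • mode YW (mode A.Y u (l + i) v) (m + n - i)

theorem jacLeftTerm_apply (YW : V →ₗ[ℂ] VertexOperator ℂ W) (l m n : ℤ) (u v : V) (i : ℕ) (w : W) :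
    jacLeftTerm YW l m n u v i w = ((-1 : ℂ) ^ i * binom l i) •
      (mode YW u (m + l - i) (mode YW v (n + i) w)
        - (-1 : ℂ) ^ l • mode YW v (n + l - i) (mode YW u (m + i) w)) := rfl

theorem evZero_jacLeftTerm (YW : V →ₗ[ℂ] VertexOperator ℂ W) (l m n : ℤ) (u v : V) (w : W) :
    EvZero fun i => jacLeftTerm YW l m n u v i w := by
  filter_upwards [evZero_mode_add YW v w n, evZero_mode_add YW u w m] with i h₁ h₂
  simp [jacLeftTerm_apply, h₁, h₂]

theorem evZero_jacRightTerm (A : VertexData V) (YW : V →ₗ[ℂ] VertexOperator ℂ W) (l m n : ℤ)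
    (u v : V) (w : W) : EvZero fun i => jacRightTerm A YW l m n u v i w := by
  filter_upwards [evZero_mode_add A.Y u v l] with i h
  simp [jacRightTerm, h, mode_zero]

/-- The difference of the two sides of the Jacobi identity. -/
def jacDefect (A : VertexData V) (YW : V →ₗ[ℂ] VertexOperator ℂ W) (l m n : ℤ) (u v : V) :
    W →ₗ[ℂ] W :=
  sumMap (jacLeftTerm YW l m n u v) (fun w => (evZero_jacLeftTerm YW l m n u v w).finite)
    - sumMap (jacRightTerm A YW l m n u v) (fun w => (evZero_jacRightTerm A YW l m n u v w).finite)

theorem jacDefect_apply (A : VertexData V) (YW : V →ₗ[ℂ] VertexOperator ℂ W) (l m n : ℤ)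
    (u v : V) (w : W) :
    jacDefect A YW l m n u v w
      = ∑ᶠ i, jacLeftTerm YW l m n u v i w - ∑ᶠ i, jacRightTerm A YW l m n u v i w := rfl

theorem isModule_iff (A : VertexData V) (YW : V →ₗ[ℂ] VertexOperator ℂ W) :
    IsModule A YW ↔ (∀ n : ℤ, mode YW A.vac n = if n = -1 then 1 else 0) ∧
      ∀ (u v : V) (l m n : ℤ), jacDefect A YW l m n u v = 0 := by
  constructor
  · rintro ⟨h₁, h₂⟩
    exact ⟨h₁, fun u v l m n => LinearMap.ext fun w => sub_eq_zero.2 (h₂ u v w l m n)⟩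
  · rintro ⟨h₁, h₂⟩
    exact ⟨h₁, fun u v w l m n => sub_eq_zero.1 (LinearMap.congr_fun (h₂ u v l m n) w)⟩

theorem jacDefect_add_left (A : VertexData V) (YW : V →ₗ[ℂ] VertexOperator ℂ W) (l m n : ℤ)
    (u u' v : V) :
    jacDefect A YW l m n (u + u') v = jacDefect A YW l m n u v + jacDefect A YW l m n u' v := by
  ext w
  rw [LinearMap.add_apply, jacDefect_apply, jacDefect_apply, jacDefect_apply, sub_add_sub_comm,
    ← (evZero_jacLeftTerm YW l m n u v w).finsum_add (evZero_jacLeftTerm YW l m n u' v w),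
    ← (evZero_jacRightTerm A YW l m n u v w).finsum_add (evZero_jacRightTerm A YW l m n u' v w)]
  congr 1 <;> refine finsum_congr fun i => ?_
  · simp only [jacLeftTerm_apply, mode_add, LinearMap.add_apply, map_add, smul_add, smul_sub]
    abel
  · simp only [jacRightTerm, mode_add, LinearMap.add_apply, LinearMap.smul_apply, smul_add]

theorem jacDefect_add_right (A : VertexData V) (YW : V →ₗ[ℂ] VertexOperator ℂ W) (l m n : ℤ)
    (u v v' : V) :
    jacDefect A YW l m n u (v + v') = jacDefect A YW l m n u v + jacDefect A YW l m n u v' := by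
  ext w
  rw [LinearMap.add_apply, jacDefect_apply, jacDefect_apply, jacDefect_apply, sub_add_sub_comm,
    ← (evZero_jacLeftTerm YW l m n u v w).finsum_add (evZero_jacLeftTerm YW l m n u v' w),
    ← (evZero_jacRightTerm A YW l m n u v w).finsum_add (evZero_jacRightTerm A YW l m n u v' w)]
  congr 1 <;> refine finsum_congr fun i => ?_
  · simp only [jacLeftTerm_apply, mode_add, LinearMap.add_apply, map_add, smul_add, smul_sub]
    abel
  · simp only [jacRightTerm, mode_add, map_add, LinearMap.add_apply, LinearMap.smul_apply,
      smul_add]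

theorem jacDefect_smul_left (A : VertexData V) (YW : V →ₗ[ℂ] VertexOperator ℂ W) (l m n : ℤ)
    (c : ℂ) (u v : V) :
    jacDefect A YW l m n (c • u) v = c • jacDefect A YW l m n u v := by
  ext w
  rw [LinearMap.smul_apply, jacDefect_apply, jacDefect_apply, smul_sub, smul_finsum, smul_finsum]
  congr 1 <;> refine finsum_congr fun i => ?_
  · simp only [jacLeftTerm_apply, mode_smul, LinearMap.smul_apply, map_smul, smul_sub]
    simp only [smul_comm c]
  · simp only [jacRightTerm, mode_smul, LinearMap.smul_apply, smul_comm c]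

theorem jacDefect_smul_right (A : VertexData V) (YW : V →ₗ[ℂ] VertexOperator ℂ W) (l m n : ℤ)
    (c : ℂ) (u v : V) :
    jacDefect A YW l m n u (c • v) = c • jacDefect A YW l m n u v := by
  ext w
  rw [LinearMap.smul_apply, jacDefect_apply, jacDefect_apply, smul_sub, smul_finsum, smul_finsum]
  congr 1 <;> refine finsum_congr fun i => ?_
  · simp only [jacLeftTerm_apply, mode_smul, LinearMap.smul_apply, map_smul, smul_sub]
    simp only [smul_comm c]
  · simp only [jacRightTerm, mode_smul, map_smul, LinearMap.smul_apply, smul_comm c]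

/-- The difference of the two sides of the Jacobi identity as a bilinear map. -/
def jacDefectBilin (A : VertexData V) (YW : V →ₗ[ℂ] VertexOperator ℂ W) (l m n : ℤ) :
    V →ₗ[ℂ] V →ₗ[ℂ] W →ₗ[ℂ] W :=
  LinearMap.mk₂ ℂ (jacDefect A YW l m n) (jacDefect_add_left A YW l m n)
    (jacDefect_smul_left A YW l m n) (jacDefect_add_right A YW l m n)
    (jacDefect_smul_right A YW l m n)

/-! ### Commutators with the Jacobi identity -/

/-- The operators `a i` on `V` and `b k` on `W` satisfy the commutator formula
`[b k, u_m] = ∑ i, binom k i (a i u)_{m+k-i}`. -/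
def CommutatorFormula (YW : V →ₗ[ℂ] VertexOperator ℂ W) (a : ℕ → Module.End ℂ V)
    (k : ℤ) (b : Module.End ℂ W) : Prop :=
  ∀ (u : V) (m : ℤ) (w : W), b (mode YW u m w) - mode YW u m (b w)
    = ∑ᶠ i : ℕ, binom k i • mode YW (a i u) (m + k - i) w

theorem evZero_commutator (YW : V →ₗ[ℂ] VertexOperator ℂ W) {a : ℕ → Module.End ℂ V} {u : V}
    (ha : EvZero fun i => a i u) (k m : ℤ) (w : W) :
    EvZero fun i : ℕ => binom k i • mode YW (a i u) (m + k - i) w := by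
  filter_upwards [ha] with i hi
  rw [hi, mode_zero, LinearMap.zero_apply, smul_zero]

/-- The Leibniz rule for the bracket with b on products of two modes: the index shift k - i falls on
m when u is hit and on n when v is hit, while l and the signs are untouched. -/
theorem CommutatorFormula.jacLeft {YW : V →ₗ[ℂ] VertexOperator ℂ W} {a : ℕ → Module.End ℂ V}
    {k : ℤ} {b : Module.End ℂ W} (hb : CommutatorFormula YW a k b)
    (ha : ∀ u, EvZero fun i => a i u) (l m n : ℤ) (u v : V) (w : W) :
    b (∑ᶠ j, jacLeftTerm YW l m n u v j w) - ∑ᶠ j, jacLeftTerm YW l m n u v j (b w)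
      = ∑ᶠ i : ℕ, binom k i • ∑ᶠ j, jacLeftTerm YW l (m + k - i) n (a i u) v j w
        + ∑ᶠ i : ℕ, binom k i • ∑ᶠ j, jacLeftTerm YW l m (n + k - i) u (a i v) j w := by
  obtain ⟨N, hN⟩ : ∃ N, ∀ i, N ≤ i → a i u = 0 ∧ a i v = 0 :=
    Filter.eventually_atTop.1 ((ha u).and (ha v))
  have comm : ∀ x, (∀ i, N ≤ i → a i x = 0) → ∀ (p : ℤ) (y : W), b (mode YW x p y)
      = mode YW x p (b y)
        + ∑ i ∈ Finset.range N, binom k i • mode YW (a i x) (p + k - i) y := by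
    intro x hx p y
    rw [← finsum_eq_sum_range (fun i hi => by
      rw [hx i hi, mode_zero, LinearMap.zero_apply, smul_zero]), ← hb x p y]
    abel
  have hu := comm u fun i hi => (hN i hi).1
  have hv := comm v fun i hi => (hN i hi).2
  rw [(evZero_jacLeftTerm YW l m n u v w).map_finsum b,
    ← ((evZero_jacLeftTerm YW l m n u v w).map fun _ => b).finsum_sub
      (evZero_jacLeftTerm YW l m n u v (b w)),
    finsum_eq_sum_range (n := N) (f := fun i : ℕ => binom k i •
      ∑ᶠ j, jacLeftTerm YW l (m + k - i) n (a i u) v j w),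
    finsum_eq_sum_range (n := N) (f := fun i : ℕ => binom k i •
      ∑ᶠ j, jacLeftTerm YW l m (n + k - i) u (a i v) j w), ← Finset.sum_add_distrib]
  · simp only [smul_finsum]
    have e₁ : ∀ i : ℕ, EvZero fun j => binom k i •
        jacLeftTerm YW l (m + k - i) n (a i u) v j w := fun i =>
      (evZero_jacLeftTerm YW l (m + k - i) n (a i u) v w).smul fun _ => binom k i
    have e₂ : ∀ i : ℕ, EvZero fun j => binom k i •
        jacLeftTerm YW l m (n + k - i) u (a i v) j w := fun i =>
      (evZero_jacLeftTerm YW l m (n + k - i) u (a i v) w).smul fun _ => binom k i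
    rw [Finset.sum_congr rfl fun i _ => ((e₁ i).finsum_add (e₂ i)).symm,
      ← EvZero.finsum_sum_comm fun i _ => (e₁ i).add (e₂ i)]
    refine finsum_congr fun j => ?_
    simp only [jacLeftTerm_apply]
    -- The scalars common to all terms are made opaque, so that only the mode indices remain to be
    -- matched.
    generalize (-1 : ℂ) ^ j * binom l j = c
    generalize (-1 : ℂ) ^ l = d
    simp only [map_smul, map_sub, hu, hv, map_add, map_sum, smul_add,
      Finset.smul_sum, smul_sub, Finset.sum_add_distrib, Finset.sum_sub_distrib]
    have r₁ : ∀ i : ℕ, m + l - j + k - i = m + k - i + l - j := fun i => by ring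
    have r₂ : ∀ i : ℕ, n + l - j + k - i = n + k - i + l - j := fun i => by ring
    have r₃ : ∀ i : ℕ, m + j + k - i = m + k - i + j := fun i => by ring
    have r₄ : ∀ i : ℕ, n + j + k - i = n + k - i + j := fun i => by ring
    simp only [r₁, r₂, r₃, r₄, smul_smul, mul_assoc, mul_comm]
    abel
  · intro i hi
    rw [(hN i hi).2]
    simp [jacLeftTerm_apply, mode_zero]
  · intro i hi
    rw [(hN i hi).1]
    simp [jacLeftTerm_apply, mode_zero]

/-- The commutator formula is applied twice: to b on W, and then to each a_i on V, acting on the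
product u_{l+j} v. The resulting double binomials collapse, first by `finsum_binom_choose` and then
by Vandermonde, to the coefficients binom(m+k-s, ·) that belong to the shifted index. -/
theorem CommutatorFormula.jacRight {A : VertexData V} {YW : V →ₗ[ℂ] VertexOperator ℂ W}
    {a : ℕ → Module.End ℂ V} {k : ℤ} {b : Module.End ℂ W} (hb : CommutatorFormula YW a k b)
    (hV : ∀ i : ℕ, CommutatorFormula A.Y a i (a i))
    (ha : ∀ u, EvZero fun i => a i u) (l m n : ℤ) (u v : V) (w : W) :
    b (∑ᶠ j, jacRightTerm A YW l m n u v j w) - ∑ᶠ j, jacRightTerm A YW l m n u v j (b w)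
      = ∑ᶠ i : ℕ, binom k i • ∑ᶠ j, jacRightTerm A YW l (m + k - i) n (a i u) v j w
        + ∑ᶠ i : ℕ, binom k i • ∑ᶠ j, jacRightTerm A YW l m (n + k - i) u (a i v) j w := by
  obtain ⟨N, hN⟩ : ∃ N, ∀ i, N ≤ i → a i u = 0 ∧ a i v = 0 :=
    Filter.eventually_atTop.1 ((ha u).and (ha v))
  have hGN : ∀ s : ℕ, ∃ T : ℤ, ∀ t, T ≤ t →
      mode YW (mode A.Y (a s u) (l + t) v) (m + n + k - s - t) w = 0 := by
    intro s
    obtain ⟨T, hT⟩ := vertexOperator_truncation (A.Y (a s u)) v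
    exact ⟨T - l, fun t ht => by
      rw [mode, mode, hT _ (by omega), map_zero]
      rfl⟩
  -- One summand of the right-hand side. The index s records which a_s lands on u or on v.
  have key : ∀ j : ℕ, b (mode YW (mode A.Y u (l + j) v) (m + n - j) w)
      - mode YW (mode A.Y u (l + j) v) (m + n - j) (b w)
      = ∑ s ∈ Finset.range N, (binom k s • ∑ᶠ i : ℕ, binom (k - s) i •
          mode YW (mode A.Y (a s u) (l + (j + i : ℕ)) v) (m + n + k - s - (j + i : ℕ)) w
        + binom k s • mode YW (mode A.Y u (l + j) (a s v)) (m + (n + k - s) - j) w) := by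
    intro j
    rw [hb]
    have h₁ : ∀ i : ℕ, binom k i • mode YW (a i (mode A.Y u (l + j) v)) (m + n - j + k - i) w
        = (∑ s ∈ Finset.range N, binom k i • ((i.choose s : ℕ) : ℂ) •
            mode YW (mode A.Y (a s u) (l + (j + (i - s : ℤ))) v)
              (m + n + k - s - (j + (i - s : ℤ))) w)
          + binom k i • mode YW (mode A.Y u (l + j) (a i v)) (m + n - j + k - i) w := by
      intro i
      have h := hV i u (l + j) v
      rw [finsum_eq_sum_range (n := N) fun s hs => by
        rw [(hN s hs).1, mode_zero, LinearMap.zero_apply, smul_zero]] at h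
      rw [sub_eq_iff_eq_add.1 h, mode_add, mode_sum, LinearMap.add_apply, LinearMap.sum_apply,
        smul_add, Finset.smul_sum]
      congr 1
      refine Finset.sum_congr rfl fun s _ => ?_
      rw [mode_smul, LinearMap.smul_apply, binom_natCast]
      congr 4
      · congr 2
        ring
      · ring
    have z₁ : ∀ s : ℕ, EvZero fun i : ℕ => binom k i • ((i.choose s : ℕ) : ℂ) •
            mode YW (mode A.Y (a s u) (l + (j + (i - s : ℤ))) v)
              (m + n + k - s - (j + (i - s : ℤ))) w := by
      intro s
      obtain ⟨T, hT⟩ := hGN s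
      filter_upwards [Filter.eventually_ge_atTop (T - j + s).toNat] with i hi
      rw [hT _ (by omega), smul_zero, smul_zero]
    have z₂ : EvZero fun i : ℕ =>
        binom k i • mode YW (mode A.Y u (l + j) (a i v)) (m + n - j + k - i) w := by
      filter_upwards [ha v] with i hi
      simp [hi, mode_zero]
    have z₃ : EvZero fun i : ℕ => ∑ s ∈ Finset.range N, binom k i • ((i.choose s : ℕ) : ℂ) •
            mode YW (mode A.Y (a s u) (l + (j + (i - s : ℤ))) v)
              (m + n + k - s - (j + (i - s : ℤ))) w := by
      filter_upwards [(Filter.eventually_all_finset (Finset.range N)).2 fun s _ => z₁ s] with i hi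
      exact Finset.sum_eq_zero hi
    rw [finsum_congr h₁, z₃.finsum_add z₂, EvZero.finsum_sum_comm fun s _ => z₁ s,
      finsum_eq_sum_range (n := N) (f := fun i : ℕ =>
        binom k i • mode YW (mode A.Y u (l + j) (a i v)) (m + n - j + k - i) w) fun i hi => by
          simp [(hN i hi).2, mode_zero], ← Finset.sum_add_distrib]
    refine Finset.sum_congr rfl fun s _ => ?_
    congr 1
    · obtain ⟨T, hT⟩ := hGN s
      have := finsum_binom_choose (G := fun t : ℤ =>
        mode YW (mode A.Y (a s u) (l + (j + t)) v) (m + n + k - s - (j + t)) w)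
        ⟨T - j, fun t ht => hT _ (by omega)⟩ k s
      rw [this]
      simp only [Nat.cast_add]
    · congr 3
      ring
  rw [(evZero_jacRightTerm A YW l m n u v w).map_finsum b,
    ← ((evZero_jacRightTerm A YW l m n u v w).map fun _ => b).finsum_sub
      (evZero_jacRightTerm A YW l m n u v (b w)),
    finsum_eq_sum_range (n := N) (f := fun i : ℕ => binom k i •
      ∑ᶠ j, jacRightTerm A YW l (m + k - i) n (a i u) v j w),
    finsum_eq_sum_range (n := N) (f := fun i : ℕ => binom k i •
      ∑ᶠ j, jacRightTerm A YW l m (n + k - i) u (a i v) j w), ← Finset.sum_add_distrib]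
  · have h₂ : ∀ j, b (jacRightTerm A YW l m n u v j w) - jacRightTerm A YW l m n u v j (b w)
        = ∑ s ∈ Finset.range N, (binom m j • binom k s • ∑ᶠ i : ℕ, binom (k - s) i •
          mode YW (mode A.Y (a s u) (l + (j + i : ℕ)) v) (m + n + k - s - (j + i : ℕ)) w
        + binom k s • jacRightTerm A YW l m (n + k - s) u (a s v) j w) := by
      intro j
      rw [jacRightTerm, LinearMap.smul_apply, LinearMap.smul_apply, map_smul, ← smul_sub, key,
        Finset.smul_sum]
      refine Finset.sum_congr rfl fun s _ => ?_
      rw [smul_add]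
      congr 1
      rw [jacRightTerm, LinearMap.smul_apply, smul_comm]
    have z₁ : ∀ s : ℕ, EvZero fun j : ℕ => binom m j • binom k s • ∑ᶠ i : ℕ, binom (k - s) i •
          mode YW (mode A.Y (a s u) (l + (j + i : ℕ)) v) (m + n + k - s - (j + i : ℕ)) w := by
      intro s
      obtain ⟨T, hT⟩ := hGN s
      filter_upwards [Filter.eventually_ge_atTop T.toNat] with j hj
      rw [finsum_congr fun i => by rw [hT _ (by push_cast; omega), smul_zero], finsum_zero,
        smul_zero, smul_zero]
    have z₂ : ∀ s : ℕ, EvZero fun j : ℕ =>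
        binom k s • jacRightTerm A YW l m (n + k - s) u (a s v) j w := fun s =>
      (evZero_jacRightTerm A YW l m (n + k - s) u (a s v) w).smul fun _ => binom k s
    rw [finsum_congr h₂, EvZero.finsum_sum_comm fun s _ => (z₁ s).add (z₂ s)]
    refine Finset.sum_congr rfl fun s _ => ?_
    rw [(z₁ s).finsum_add (z₂ s), EvZero.finsum_smul]
    congr 1
    obtain ⟨T, hT⟩ := hGN s
    -- The coefficients binom(m, j) of the Jacobi identity and binom(k-s, i) of the commutator
    -- combine into binom(m+k-s, j+i).
    have h₃ := finsum_binom_binom (F := fun t : ℕ =>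
      mode YW (mode A.Y (a s u) (l + t) v) (m + n + k - s - t) w)
      (Filter.eventually_atTop.2 ⟨T.toNat, fun t ht => hT _ (by omega)⟩) m (k - s)
    simp only [smul_comm _ (binom k s)]
    rw [EvZero.finsum_smul, h₃]
    congr 1
    refine finsum_congr fun j => ?_
    rw [jacRightTerm, LinearMap.smul_apply]
    congr 2
    · ring
    · congr 1
      ring
  · intro i hi
    rw [(hN i hi).2]
    simp [jacRightTerm, mode_zero]
  · intro i hi
    rw [(hN i hi).1]
    simp [jacRightTerm, mode_zero]

/-- If the Jacobi identity holds for `(a i u, v)` and `(u, a i v)`, then its defect for `(u, v)`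
commutes with `b`. -/
theorem CommutatorFormula.jacDefect_comm {A : VertexData V} {YW : V →ₗ[ℂ] VertexOperator ℂ W}
    {a : ℕ → Module.End ℂ V} {k : ℤ} {b : Module.End ℂ W} (hb : CommutatorFormula YW a k b)
    (hV : ∀ i : ℕ, CommutatorFormula A.Y a i (a i))
    (ha : ∀ u, EvZero fun i => a i u) {u v : V}
    (hu : ∀ i l m n, jacDefect A YW l m n (a i u) v = 0)
    (hv : ∀ i l m n, jacDefect A YW l m n u (a i v) = 0) (l m n : ℤ) (w : W) :
    b (jacDefect A YW l m n u v w) = jacDefect A YW l m n u v (b w) := by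
  have h₁ := hb.jacLeft ha l m n u v w
  have h₂ := hb.jacRight hV ha l m n u v w
  have h₃ : ∀ i : ℕ, ∑ᶠ j, jacLeftTerm YW l (m + k - i) n (a i u) v j w
      = ∑ᶠ j, jacRightTerm A YW l (m + k - i) n (a i u) v j w := fun i =>
    sub_eq_zero.1 (LinearMap.congr_fun (hu i l (m + k - i) n) w)
  have h₄ : ∀ i : ℕ, ∑ᶠ j, jacLeftTerm YW l m (n + k - i) u (a i v) j w
      = ∑ᶠ j, jacRightTerm A YW l m (n + k - i) u (a i v) j w := fun i =>
    sub_eq_zero.1 (LinearMap.congr_fun (hv i l m (n + k - i)) w)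
  -- The brackets of b with the two sides of the identity now have the same expansion.
  simp only [h₃, h₄] at h₁
  rw [← h₂] at h₁
  rw [jacDefect_apply, jacDefect_apply, map_sub, ← sub_eq_zero]
  rw [← sub_eq_zero] at h₁
  rw [← h₁]
  abel

end JacobiSides

/-! ### The Heisenberg operators on the Fock space -/

theorem heis_zero : heis 0 = 0 := rfl

theorem heis_natCast_succ_apply (n : ℕ) (w : Fock) :
    heis ((n + 1 : ℕ) : ℤ) w = ((n : ℂ) + 1) • MvPolynomial.pderiv n w := by
  change (((n + 1 : ℕ) : ℂ) • (MvPolynomial.pderiv n).toLinearMap) w = _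
  push_cast
  rfl

theorem heis_neg_apply (n : ℕ) (w : Fock) : heis (-n - 1) w = MvPolynomial.X n * w := by
  rw [show (-n - 1 : ℤ) = Int.negSucc n by rw [Int.negSucc_eq]; ring]
  rfl

theorem mul_finsum_of_evZero {f : ℕ → Fock} (hf : EvZero f) (a : Fock) :
    a * ∑ᶠ i, f i = ∑ᶠ i, a * f i :=
  hf.map_finsum (LinearMap.mulLeft ℂ a)

/-- The commutator of two derivations is a derivation, and this one kills every variable. -/
theorem pderiv_comm (i j : ℕ) (w : Fock) :
    MvPolynomial.pderiv i (MvPolynomial.pderiv j w)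
      = MvPolynomial.pderiv j (MvPolynomial.pderiv i w) := by
  have h : ⁅(MvPolynomial.pderiv i : Derivation ℂ Fock Fock),
      (MvPolynomial.pderiv j : Derivation ℂ Fock Fock)⁆ = 0 := by
    refine MvPolynomial.derivation_ext fun k => ?_
    rw [Derivation.commutator_apply, MvPolynomial.pderiv_X, MvPolynomial.pderiv_X, Pi.single_apply,
      Pi.single_apply]
    split_ifs <;> simp
  have h' := DFunLike.congr_fun h w
  rw [Derivation.commutator_apply] at h'
  exact sub_eq_zero.1 h'

theorem heis_natCast_comm (i j : ℕ) (w : Fock) :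
    heis i (heis j w) = heis j (heis i w) := by
  cases i with
  | zero => simp [heis_zero]
  | succ i =>
    cases j with
    | zero => simp [heis_zero]
    | succ j =>
      simp only [heis_natCast_succ_apply, map_smul, pderiv_comm i j, smul_comm ((i : ℂ) + 1)]

theorem heis_succ_X_mul (i n : ℕ) (w : Fock) :
    heis ((i + 1 : ℕ) : ℤ) (MvPolynomial.X n * w)
      = MvPolynomial.X n * heis ((i + 1 : ℕ) : ℤ) w + if i = n then ((n : ℂ) + 1) • w else 0 := by
  rw [heis_natCast_succ_apply, heis_natCast_succ_apply, Derivation.leibniz, MvPolynomial.pderiv_X,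
    Pi.single_apply, smul_add, smul_eq_mul, smul_eq_mul, mul_smul_comm]
  congr 1
  by_cases h : i = n
  · subst h
    simp
  · simp [h, Ne.symm h]

theorem heis_commutator (m n : ℤ) (w : Fock) :
    heis m (heis n w) - heis n (heis m w) = if m + n = 0 then (m : ℂ) • w else 0 := by
  have key : ∀ a b : ℕ, heis (a : ℤ) (heis (-b - 1) w) - heis (-b - 1) (heis (a : ℤ) w)
      = if (a : ℤ) + (-b - 1) = 0 then ((a : ℤ) : ℂ) • w else 0 := by
    intro a b
    rw [heis_neg_apply, heis_neg_apply]
    cases a with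
    | zero => simp [heis_zero]
    | succ a =>
      rw [heis_succ_X_mul, add_sub_cancel_left]
      by_cases h : a = b
      · subst h
        simp
      · rw [if_neg h, if_neg (by omega)]
  rcases lt_or_ge m 0 with hm | hm <;> rcases lt_or_ge n 0 with hn | hn
  · obtain ⟨a, rfl⟩ : ∃ a : ℕ, m = -a - 1 := ⟨(-m - 1).toNat, by omega⟩
    obtain ⟨b, rfl⟩ : ∃ b : ℕ, n = -b - 1 := ⟨(-n - 1).toNat, by omega⟩
    simp only [heis_neg_apply]
    rw [if_neg (by omega), mul_left_comm, sub_self]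
  · obtain ⟨a, rfl⟩ : ∃ a : ℕ, m = -a - 1 := ⟨(-m - 1).toNat, by omega⟩
    lift n to ℕ using hn
    rw [← neg_sub, key, add_comm]
    split_ifs with h
    · rw [← neg_smul]
      congr 1
      have : (-a - 1 : ℤ) = -n := by omega
      rw [this]
      push_cast
      rfl
    · exact neg_zero
  · obtain ⟨b, rfl⟩ : ∃ b : ℕ, n = -b - 1 := ⟨(-n - 1).toNat, by omega⟩
    lift m to ℕ using hm
    exact key m b
  · lift m to ℕ using hm
    lift n to ℕ using hn
    rw [heis_natCast_comm, sub_self]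
    by_cases h : (m : ℤ) + n = 0
    · have : m = 0 := by omega
      simp [this]
    · rw [if_neg h]

theorem evZero_heis (w : Fock) : EvZero fun i : ℕ => heis i w :=
  Filter.eventually_atTop.2 (heis_truncation w)

/-! ### Normally ordered products -/

theorem normalTerm_apply (n : ℕ) (B : VertexOperator ℂ Fock) (m : ℤ) (j : ℕ) (w : Fock) :
    normalTerm n B m j w = (((n + j).choose j : ℕ) : ℂ) •
      (MvPolynomial.X (n + j) * VertexOperator.ncoeff B (m + j) w
        + (-1 : ℂ) ^ n • VertexOperator.ncoeff B (m - n - 1 - j) (heis j w)) := by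
  rw [normalTerm, LinearMap.smul_apply, LinearMap.add_apply, LinearMap.smul_apply,
    Module.End.mul_apply, Module.End.mul_apply,
    show (-n - 1 - j : ℤ) = -((n + j : ℕ) : ℤ) - 1 by push_cast; ring, heis_neg_apply]

theorem evZero_ncoeff_add (B : VertexOperator ℂ Fock) (w : Fock) (n : ℤ) :
    EvZero fun i : ℕ => VertexOperator.ncoeff B (n + i) w := by
  obtain ⟨N, hN⟩ := vertexOperator_truncation B w
  filter_upwards [Filter.eventually_ge_atTop (N - n).toNat] with i hi
  exact hN _ (by omega)

theorem evZero_normalTerm (n : ℕ) (B : VertexOperator ℂ Fock) (m : ℤ) (w : Fock) :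
    EvZero fun j => normalTerm n B m j w := by
  filter_upwards [evZero_ncoeff_add B w m, evZero_heis w] with j h₁ h₂
  rw [normalTerm_apply, h₁, h₂]
  simp

theorem ncoeff_normalProd (n : ℕ) (B : VertexOperator ℂ Fock) (m : ℤ) (w : Fock) :
    VertexOperator.ncoeff (normalProd n B) m w = ∑ᶠ j, normalTerm n B m j w := by
  rw [normalProd, ncoeff_vertexOfModes]
  rfl

theorem ncoeff_normalProd_add (n : ℕ) (B : VertexOperator ℂ Fock) (m : ℤ) (w : Fock) :
    VertexOperator.ncoeff (normalProd n B) m w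
      = ∑ᶠ j : ℕ, (((n + j).choose j : ℕ) : ℂ) •
          (MvPolynomial.X (n + j) * VertexOperator.ncoeff B (m + j) w)
        + ∑ᶠ j : ℕ, (((n + j).choose j : ℕ) : ℂ) •
          ((-1 : ℂ) ^ n • VertexOperator.ncoeff B (m - n - 1 - j) (heis j w)) := by
  rw [ncoeff_normalProd, ← EvZero.finsum_add]
  · refine finsum_congr fun j => ?_
    rw [normalTerm_apply, smul_add]
  · filter_upwards [evZero_ncoeff_add B w m] with j h₁
    rw [h₁, mul_zero, smul_zero]
  · filter_upwards [evZero_heis w] with j h₁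
    rw [h₁, map_zero, smul_zero, smul_zero]

theorem normalProd_add (n : ℕ) (B C : VertexOperator ℂ Fock) :
    normalProd n (B + C) = normalProd n B + normalProd n C := by
  refine vertexOperator_ext fun m w => ?_
  rw [map_add, Pi.add_apply, LinearMap.add_apply]
  simp only [ncoeff_normalProd]
  rw [← (evZero_normalTerm n B m w).finsum_add (evZero_normalTerm n C m w)]
  refine finsum_congr fun j => ?_
  simp only [normalTerm_apply, map_add, Pi.add_apply, LinearMap.add_apply, mul_add, smul_add]
  abel

theorem normalProd_smul (n : ℕ) (c : ℂ) (B : VertexOperator ℂ Fock) :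
    normalProd n (c • B) = c • normalProd n B := by
  refine vertexOperator_ext fun m w => ?_
  rw [map_smul, Pi.smul_apply, LinearMap.smul_apply]
  simp only [ncoeff_normalProd]
  rw [smul_finsum]
  refine finsum_congr fun j => ?_
  simp only [normalTerm_apply, map_smul, Pi.smul_apply, LinearMap.smul_apply, mul_smul_comm,
    smul_add, smul_comm c]

/-- Each of the two factors contributes a creation half and an annihilation half, which gives four
double sums. Exchanging the factors exchanges the two mixed sums. -/
theorem ncoeff_normalProd_normalProd (n m : ℕ) (B : VertexOperator ℂ Fock) (p : ℤ) (w : Fock) :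
    VertexOperator.ncoeff (normalProd n (normalProd m B)) p w
      = (∑ᶠ (j : ℕ) (i : ℕ), ((((n + j).choose j : ℕ) : ℂ) * (((m + i).choose i : ℕ) : ℂ)) •
          (MvPolynomial.X (n + j) * (MvPolynomial.X (m + i)
            * VertexOperator.ncoeff B (p + j + i) w))
        + ∑ᶠ (j : ℕ) (i : ℕ), ((((n + j).choose j : ℕ) : ℂ) * (((m + i).choose i : ℕ) : ℂ)) •
          (-1 : ℂ) ^ m • (MvPolynomial.X (n + j)
            * VertexOperator.ncoeff B (p - m - 1 + j - i) (heis i w)))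
        + (∑ᶠ (j : ℕ) (i : ℕ), ((((n + j).choose j : ℕ) : ℂ) * (((m + i).choose i : ℕ) : ℂ)) •
          (-1 : ℂ) ^ n • (MvPolynomial.X (m + i)
            * VertexOperator.ncoeff B (p - n - 1 + i - j) (heis j w))
        + ∑ᶠ (j : ℕ) (i : ℕ), ((((n + j).choose j : ℕ) : ℂ) * (((m + i).choose i : ℕ) : ℂ)) •
          ((-1 : ℂ) ^ n * (-1 : ℂ) ^ m) •
            VertexOperator.ncoeff B (p - n - 1 - m - 1 - j - i) (heis i (heis j w))) := by
  have x₁ : ∀ (q : ℤ) (y : Fock), EvZero fun i : ℕ => (((m + i).choose i : ℕ) : ℂ) •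
      (MvPolynomial.X (m + i) * VertexOperator.ncoeff B (q + i) y) := fun q y => by
    filter_upwards [evZero_ncoeff_add B y q] with i h
    rw [h, mul_zero, smul_zero]
  have x₂ : ∀ (q : ℤ) (y : Fock), EvZero fun i : ℕ => (((m + i).choose i : ℕ) : ℂ) •
      ((-1 : ℂ) ^ m • VertexOperator.ncoeff B (q - m - 1 - i) (heis i y)) := fun q y => by
    filter_upwards [evZero_heis y] with i h
    rw [h, map_zero, smul_zero, smul_zero]
  rw [ncoeff_normalProd_add n]
  congr 1
  · rw [← EvZero.finsum_add]
    · refine finsum_congr fun j => ?_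
      rw [ncoeff_normalProd_add m, mul_add, smul_add]
      congr 1
      · rw [mul_finsum_of_evZero (x₁ (p + j) w), smul_finsum]
        refine finsum_congr fun i => ?_
        rw [mul_smul_comm, smul_smul]
      · rw [mul_finsum_of_evZero (x₂ (p + j) w), smul_finsum]
        refine finsum_congr fun i => ?_
        rw [mul_smul_comm, mul_smul_comm, smul_smul,
          show p + j - m - 1 - i = p - m - 1 + j - i by ring]
    · obtain ⟨N, hN⟩ := vertexOperator_truncation B w
      filter_upwards [Filter.eventually_ge_atTop (N - p).toNat] with j hj
      rw [finsum_congr fun i => by rw [hN _ (by omega), mul_zero, mul_zero, smul_zero],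
        finsum_zero]
    · obtain ⟨I, hI⟩ := heis_truncation w
      have : ∀ᶠ j : ℕ in Filter.atTop, ∀ i ∈ Finset.range I,
          VertexOperator.ncoeff B (p - m - 1 + j - i) (heis i w) = 0 := by
        refine (Filter.eventually_all_finset _).2 fun i _ => ?_
        filter_upwards [evZero_ncoeff_add B (heis i w) (p - m - 1 - i)] with j hj
        rw [← hj, show p - m - 1 + j - i = p - m - 1 - i + j by ring]
      filter_upwards [this] with j hj
      rw [← finsum_zero (α := ℕ)]
      refine finsum_congr fun i => ?_
      by_cases hi : I ≤ i
      · rw [hI i hi, map_zero, mul_zero, smul_zero, smul_zero]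
      · rw [hj i (by simpa using hi), mul_zero, smul_zero, smul_zero]
  · rw [← EvZero.finsum_add]
    · refine finsum_congr fun j => ?_
      rw [ncoeff_normalProd_add m, smul_add, smul_add]
      congr 1
      · rw [smul_finsum, smul_finsum]
        refine finsum_congr fun i => ?_
        rw [smul_comm ((-1 : ℂ) ^ n), smul_smul, show p - n - 1 - j + i = p - n - 1 + i - j by ring]
      · rw [smul_finsum, smul_finsum]
        refine finsum_congr fun i => ?_
        rw [smul_comm ((-1 : ℂ) ^ n), smul_smul, smul_smul,
          show p - n - 1 - j - m - 1 - i = p - n - 1 - m - 1 - j - i by ring, mul_smul,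
          mul_smul ((-1 : ℂ) ^ n)]
    · filter_upwards [evZero_heis w] with j hj
      simp [hj]
    · filter_upwards [evZero_heis w] with j hj
      simp [hj]

/-- Creation operators commute among themselves, and so do annihilation operators; in the mixed
terms creation already stands left of annihilation, so no contraction arises. Hence the nested
product depends only on the multiset of factors, and the sorting in `heisenberg` is immaterial. -/
instance : LeftCommutative normalProd where
  left_comm n m B := by
    refine vertexOperator_ext fun p w => ?_
    rw [ncoeff_normalProd_normalProd, ncoeff_normalProd_normalProd]
    have sw : ∀ q : ℤ, ∀ i : ℕ,
        EvZero fun j : ℕ => VertexOperator.ncoeff B (q + j - i) (heis i w) := by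
      intro q i
      filter_upwards [evZero_ncoeff_add B (heis i w) (q - i)] with j hj
      rw [← hj, show q + j - i = q - i + j by ring]
    -- The three identities treat creation-creation, mixed and annihilation-annihilation terms; each
    -- needs its own reason why the sums may be exchanged.
    have left : ∑ᶠ (j : ℕ) (i : ℕ), ((((n + j).choose j : ℕ) : ℂ) * (((m + i).choose i : ℕ) : ℂ)) •
          (MvPolynomial.X (n + j) * (MvPolynomial.X (m + i)
            * VertexOperator.ncoeff B (p + j + i) w))
        = ∑ᶠ (j : ℕ) (i : ℕ), ((((m + j).choose j : ℕ) : ℂ) * (((n + i).choose i : ℕ) : ℂ)) •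
          (MvPolynomial.X (m + j) * (MvPolynomial.X (n + i)
            * VertexOperator.ncoeff B (p + j + i) w)) := by
      rw [EvZero.finsum_comm]
      · refine finsum_congr fun i => finsum_congr fun j => ?_
        rw [mul_comm (((n + j).choose j : ℕ) : ℂ), mul_left_comm (MvPolynomial.X (n + j)),
          add_right_comm]
      · obtain ⟨N, hN⟩ := vertexOperator_truncation B w
        filter_upwards [Filter.eventually_ge_atTop (N - p).toNat] with i hi j
        rw [hN _ (by omega), mul_zero, mul_zero, smul_zero]
      · intro i
        filter_upwards [evZero_ncoeff_add B w (p + i)] with j hj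
        rw [add_right_comm, hj, mul_zero, mul_zero, smul_zero]
    have mid : ∀ n m : ℕ, ∑ᶠ (j : ℕ) (i : ℕ),
          ((((n + j).choose j : ℕ) : ℂ) * (((m + i).choose i : ℕ) : ℂ)) •
          (-1 : ℂ) ^ m • (MvPolynomial.X (n + j)
            * VertexOperator.ncoeff B (p - m - 1 + j - i) (heis i w))
        = ∑ᶠ (j : ℕ) (i : ℕ), ((((m + j).choose j : ℕ) : ℂ) * (((n + i).choose i : ℕ) : ℂ)) •
          (-1 : ℂ) ^ m • (MvPolynomial.X (n + i)
            * VertexOperator.ncoeff B (p - m - 1 + i - j) (heis j w)) := by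
      intro n m
      rw [EvZero.finsum_comm]
      · refine finsum_congr fun i => finsum_congr fun j => ?_
        rw [mul_comm (((n + j).choose j : ℕ) : ℂ)]
      · filter_upwards [evZero_heis w] with i hi j
        rw [hi, map_zero, mul_zero, smul_zero, smul_zero]
      · intro i
        filter_upwards [sw (p - m - 1) i] with j hj
        rw [hj, mul_zero, smul_zero, smul_zero]
    have right : ∑ᶠ (j : ℕ) (i : ℕ),
          ((((n + j).choose j : ℕ) : ℂ) * (((m + i).choose i : ℕ) : ℂ)) •
          ((-1 : ℂ) ^ n * (-1 : ℂ) ^ m) •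
            VertexOperator.ncoeff B (p - n - 1 - m - 1 - j - i) (heis i (heis j w))
        = ∑ᶠ (j : ℕ) (i : ℕ), ((((m + j).choose j : ℕ) : ℂ) * (((n + i).choose i : ℕ) : ℂ)) •
          ((-1 : ℂ) ^ m * (-1 : ℂ) ^ n) •
            VertexOperator.ncoeff B (p - m - 1 - n - 1 - j - i) (heis i (heis j w)) := by
      rw [EvZero.finsum_comm]
      · refine finsum_congr fun i => finsum_congr fun j => ?_
        rw [mul_comm (((n + j).choose j : ℕ) : ℂ), mul_comm ((-1 : ℂ) ^ n), heis_natCast_comm i j,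
          show p - n - 1 - m - 1 - j - i = p - m - 1 - n - 1 - i - j by ring]
      · filter_upwards [evZero_heis w] with i hi j
        rw [heis_natCast_comm, hi, map_zero, map_zero, smul_zero, smul_zero]
      · intro i
        filter_upwards [evZero_heis w] with j hj
        rw [hj, map_zero, map_zero, smul_zero, smul_zero]
    rw [left, right, mid n m, ← mid m n]
    abel

/-! ### The vertex operators of the Heisenberg vertex algebra -/

theorem heisenberg_Y_monomial (s : ℕ →₀ ℕ) :
    heisenberg.Y (MvPolynomial.monomial s 1)
      = Multiset.foldr normalProd idField (Finsupp.toMultiset s) := by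
  have h := (MvPolynomial.basisMonomials ℕ ℂ).constr_basis ℂ
    (fun s => ((Finsupp.toMultiset s).sort (· ≤ ·)).foldr normalProd idField) s
  rw [MvPolynomial.coe_basisMonomials] at h
  refine h.trans ?_
  conv_rhs => rw [← Multiset.sort_eq (Finsupp.toMultiset s) (· ≤ ·), Multiset.coe_foldr]

theorem heisenberg_Y_one : heisenberg.Y 1 = idField := by
  have h := heisenberg_Y_monomial 0
  rw [map_zero, Multiset.foldr_zero] at h
  exact h

/-- Since the order of factors is irrelevant, X n may be taken as the outermost one even when it is
not the smallest. Inductions on u rest on this recursion. -/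
theorem heisenberg_Y_X_mul (n : ℕ) (u : Fock) :
    heisenberg.Y (MvPolynomial.X n * u) = normalProd n (heisenberg.Y u) := by
  induction u using MvPolynomial.induction_on' with
  | monomial s c =>
    have h : ∀ t : ℕ →₀ ℕ, MvPolynomial.monomial t c = c • MvPolynomial.monomial t (1 : ℂ) := by
      intro t
      rw [MvPolynomial.smul_monomial, smul_eq_mul, mul_one]
    rw [MvPolynomial.X, MvPolynomial.monomial_mul, one_mul, h, h, map_smul, map_smul,
      normalProd_smul, heisenberg_Y_monomial, heisenberg_Y_monomial, map_add,
      Finsupp.toMultiset_single, one_smul, Multiset.singleton_add, Multiset.foldr_cons]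
  | add p q hp hq => rw [mul_add, map_add, map_add, hp, hq, normalProd_add]

/-! ### Modes of the vacuum and of `h`, and the creation property -/

theorem mode_one_apply (m : ℤ) (w : Fock) :
    mode heisenberg.Y 1 m w = if m = -1 then w else 0 := by
  rw [mode, heisenberg_Y_one, idField, ncoeff_vertexOfModes]
  split_ifs <;> rfl

theorem evZero_mode_X_mul (n : ℕ) (u : Fock) (m : ℤ) (w : Fock) :
    EvZero fun j : ℕ => (((n + j).choose j : ℕ) : ℂ) •
      (MvPolynomial.X (n + j) * mode heisenberg.Y u (m + j) w
        + (-1 : ℂ) ^ n • mode heisenberg.Y u (m - n - 1 - j) (heis j w)) := by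
  filter_upwards [evZero_normalTerm n (heisenberg.Y u) m w] with j hj
  rw [← hj, normalTerm_apply]

theorem mode_X_mul_apply (n : ℕ) (u : Fock) (m : ℤ) (w : Fock) :
    mode heisenberg.Y (MvPolynomial.X n * u) m w = ∑ᶠ j : ℕ, (((n + j).choose j : ℕ) : ℂ) •
      (MvPolynomial.X (n + j) * mode heisenberg.Y u (m + j) w
        + (-1 : ℂ) ^ n • mode heisenberg.Y u (m - n - 1 - j) (heis j w)) := by
  rw [mode, heisenberg_Y_X_mul, ncoeff_normalProd]
  exact finsum_congr fun j => normalTerm_apply _ _ _ _ _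

theorem mode_hvec (m : ℤ) : mode heisenberg.Y hvec m = heis m := by
  refine LinearMap.ext fun w => ?_
  rw [hvec, ← mul_one (MvPolynomial.X 0), mode_X_mul_apply]
  simp only [mode_one_apply, zero_add, Nat.choose_self, Nat.cast_one, one_smul, pow_zero,
    Nat.cast_zero, sub_zero]
  rcases lt_or_ge m 0 with hm | hm
  · obtain ⟨a, rfl⟩ : ∃ a : ℕ, m = -a - 1 := ⟨(-m - 1).toNat, by omega⟩
    rw [finsum_eq_single _ a, if_pos (by ring), if_neg (by omega), add_zero, heis_neg_apply]
    intro j hj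
    rw [if_neg (by omega), if_neg (by omega), mul_zero, add_zero]
  · lift m to ℕ using hm
    rw [finsum_eq_single _ m, if_neg (by omega), if_pos (by ring), mul_zero, zero_add]
    intro j hj
    rw [if_neg (by omega), if_neg (by omega), mul_zero, add_zero]

theorem mode_vac (n : ℤ) : mode heisenberg.Y heisenberg.vac n = if n = -1 then 1 else 0 := by
  refine LinearMap.ext fun w => ?_
  refine (mode_one_apply n w).trans ?_
  split_ifs <;> rfl

theorem heis_natCast_one (j : ℕ) : heis (j : ℤ) (1 : Fock) = 0 := by
  cases j with
  | zero => rfl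
  | succ j => rw [heis_natCast_succ_apply, MvPolynomial.pderiv_one, smul_zero]

/-- Annihilation operators kill the vacuum, so only the creation halves act; they raise the mode
index to n + j ≥ -1, and the value -1 requires j = 0 and n = -1. -/
theorem mode_apply_one (u : Fock) {n : ℤ} (hn : -1 ≤ n) :
    mode heisenberg.Y u n 1 = if n = -1 then u else 0 := by
  induction u using MvPolynomial.induction_on generalizing n with
  | C a =>
    rw [← mul_one (MvPolynomial.C a), ← MvPolynomial.smul_eq_C_mul, mode_smul,
      LinearMap.smul_apply, mode_one_apply]
    split_ifs <;> simp
  | add p q hp hq =>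
    rw [mode_add, LinearMap.add_apply, hp hn, hq hn]
    split_ifs <;> simp
  | mul_X p i hp =>
    rw [mul_comm p, mode_X_mul_apply, finsum_eq_single _ 0]
    · rw [heis_natCast_one, map_zero, smul_zero, add_zero, hp (by omega)]
      simp
    · intro j hj
      rw [heis_natCast_one, map_zero, smul_zero, add_zero, hp (by omega), if_neg (by omega),
        mul_zero, smul_zero]

/-! ### Commutators with the Heisenberg operators -/

theorem heis_natCast_X_mul (i n : ℕ) (u : Fock) :
    heis i (MvPolynomial.X n * u)
      = MvPolynomial.X n * heis i u + if i = n + 1 then ((n : ℂ) + 1) • u else 0 := by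
  cases i with
  | zero => simp [heis_zero]
  | succ i => simp only [heis_succ_X_mul, add_left_inj]

/-- The scalars produced when h_k passes the explicit factor h_{-n-1-j} or h_j of the normally
ordered product. At most one j gives a nonzero term: j = -k for k < 0, j = k - n - 1 for k > n. The
total equals the term i = n + 1 of the commutator formula, where h_{n+1} contracts with X n. -/
theorem sum_heis_contractions (k m : ℤ) (n : ℕ) (u w : Fock) :
    ∑ᶠ j : ℕ, (((n + j).choose j : ℕ) : ℂ) •
      ((if k + (-(n + j : ℕ) - 1) = 0 then (k : ℂ) • mode heisenberg.Y u (m + j) w else 0)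
        + (-1 : ℂ) ^ n • (if k + j = 0 then (k : ℂ) • mode heisenberg.Y u (m - n - 1 - j) w else 0))
      = (binom k (n + 1) * ((n : ℂ) + 1)) • mode heisenberg.Y u (m + k - (n + 1)) w := by
  rw [mul_comm, succ_mul_binom_succ]
  rcases le_or_gt k 0 with hk | hk
  · obtain ⟨a, rfl⟩ : ∃ a : ℕ, k = -a := ⟨(-k).toNat, by omega⟩
    rw [finsum_eq_single _ a]
    · rw [if_neg (by omega), if_pos (by ring), zero_add, smul_smul, smul_smul,
        show (-a - 1 : ℤ) = -(a + 1) by ring, binom_neg,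
        show (a + 1 + n - 1 : ℤ) = ((n + a : ℕ) : ℤ) by push_cast; ring, binom_natCast,
        Nat.choose_symm_add, show m - n - 1 - a = m + -a - (n + 1) by ring]
      congr 1
      ring
    · intro j hj
      rw [if_neg (by omega), if_neg (by omega), smul_zero, add_zero, smul_zero]
  · rcases lt_or_ge k (n + 1) with hk' | hk'
    · rw [finsum_congr fun j => by
        rw [if_neg (by omega), if_neg (by omega), smul_zero, add_zero, smul_zero], finsum_zero,
        show k - 1 = ((k - 1).toNat : ℤ) by omega, binom_natCast,
        Nat.choose_eq_zero_of_lt (by omega), Nat.cast_zero, mul_zero, zero_smul]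
    · obtain ⟨a, rfl⟩ : ∃ a : ℕ, k = n + 1 + a := ⟨(k - n - 1).toNat, by omega⟩
      rw [finsum_eq_single _ a]
      · rw [if_pos (by push_cast; ring), if_neg (by omega), smul_zero, add_zero, smul_smul,
          show (n + 1 + a - 1 : ℤ) = ((n + a : ℕ) : ℤ) by push_cast; ring, binom_natCast,
          Nat.choose_symm_add, show m + (n + 1 + a) - (n + 1) = m + a by ring]
        congr 1
        ring
      · intro j hj
        rw [if_neg (by omega), if_neg (by omega), smul_zero, add_zero, smul_zero]

/-- `[h_k, u_m] = ∑ i, binom k i (h_i u)_{m+k-i}`. -/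
theorem heis_commutatorFormula (k : ℤ) :
    CommutatorFormula heisenberg.Y (fun i : ℕ => heis i) k (heis k) := by
  intro u
  induction u using MvPolynomial.induction_on with
  | C a =>
    intro m w
    have h : ∀ i : ℕ, heis (i : ℤ) (MvPolynomial.C a : Fock) = 0 := fun i => by
      rw [← mul_one (MvPolynomial.C a), ← MvPolynomial.smul_eq_C_mul, map_smul, heis_natCast_one,
        smul_zero]
    simp only [h, mode_zero, LinearMap.zero_apply, smul_zero, finsum_zero]
    rw [← mul_one (MvPolynomial.C a), ← MvPolynomial.smul_eq_C_mul, mode_smul,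
      LinearMap.smul_apply, LinearMap.smul_apply, mode_one_apply, mode_one_apply]
    split_ifs <;> simp
  | add p q hp hq =>
    intro m w
    simp only [map_add, mode_add, LinearMap.add_apply, smul_add]
    rw [(evZero_commutator heisenberg.Y (evZero_heis p) k m w).finsum_add
      (evZero_commutator heisenberg.Y (evZero_heis q) k m w), ← hp, ← hq]
    abel
  | mul_X u n hu =>
    intro m w
    obtain ⟨N, hN⟩ := heis_truncation u
    have comm : ∀ (q : ℤ) (y : Fock), heis k (mode heisenberg.Y u q y)
        = mode heisenberg.Y u q (heis k y)
          + ∑ i ∈ Finset.range N, binom k i • mode heisenberg.Y (heis i u) (q + k - i) y := by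
      intro q y
      rw [← finsum_eq_sum_range (fun i hi => by
        rw [hN i hi, mode_zero, LinearMap.zero_apply, smul_zero]), ← hu q y]
      abel
    have hX : ∀ (a : ℕ) (y : Fock), heis k (MvPolynomial.X a * y)
        = MvPolynomial.X a * heis k y + if k + (-a - 1) = 0 then (k : ℂ) • y else 0 := by
      intro a y
      have := heis_commutator k (-a - 1) y
      rw [heis_neg_apply, heis_neg_apply] at this
      rw [← this]
      abel
    have hj : ∀ (j : ℕ) (y : Fock), heis j (heis k y)
        = heis k (heis j y) - if k + j = 0 then (k : ℂ) • y else 0 := by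
      intro j y
      rw [← heis_commutator k j y]
      abel
    rw [mul_comm u, mode_X_mul_apply, (evZero_mode_X_mul n u m w).map_finsum (heis k),
      mode_X_mul_apply, ← ((evZero_mode_X_mul n u m w).map fun _ => heis k).finsum_sub
      (evZero_mode_X_mul n u m (heis k w))]
    -- By the Leibniz rule h_i acts on u, and for i = n + 1 also on X n. The first part matches the
    -- induction hypothesis, the second the contractions.
    have rhs : ∀ i : ℕ, binom k i • mode heisenberg.Y (heis i (MvPolynomial.X n * u)) (m + k - i) w
        = binom k i • mode heisenberg.Y (MvPolynomial.X n * heis i u) (m + k - i) w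
          + if i = n + 1 then (binom k (n + 1) * ((n : ℂ) + 1)) •
              mode heisenberg.Y u (m + k - (n + 1)) w else 0 := by
      intro i
      rw [heis_natCast_X_mul, mode_add, LinearMap.add_apply, smul_add]
      congr 1
      split_ifs with h
      · subst h
        rw [mode_smul, LinearMap.smul_apply, smul_smul]
        push_cast
        rfl
      · rw [mode_zero, LinearMap.zero_apply, smul_zero]
    rw [finsum_congr rhs, EvZero.finsum_add]
    rotate_left
    · filter_upwards [evZero_heis u] with i hi
      rw [hi, mul_zero, mode_zero, LinearMap.zero_apply, smul_zero]
    · filter_upwards [Filter.eventually_gt_atTop (n + 1)] with i hi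
      rw [if_neg (by omega)]
    rw [finsum_eq_single (fun i => if i = n + 1 then _ else _) (n + 1)
      fun i hi => if_neg hi, if_pos rfl, ← sum_heis_contractions,
      finsum_eq_sum_range (n := N) (f := fun i : ℕ => binom k i •
        mode heisenberg.Y (MvPolynomial.X n * heis i u) (m + k - i) w) fun i hi => by
          rw [hN i hi, mul_zero, mode_zero, LinearMap.zero_apply, smul_zero]]
    simp only [mode_X_mul_apply n (heis _ u), smul_finsum]
    have e : ∀ i : ℕ, EvZero fun j : ℕ => binom k i • (((n + j).choose j : ℕ) : ℂ) •
        (MvPolynomial.X (n + j) * mode heisenberg.Y (heis i u) (m + k - i + j) w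
        + (-1 : ℂ) ^ n • mode heisenberg.Y (heis i u) (m + k - i - n - 1 - j) (heis j w)) :=
      fun i => (evZero_mode_X_mul n (heis i u) (m + k - i) w).smul fun _ => binom k i
    rw [← EvZero.finsum_sum_comm fun i _ => e i, ← EvZero.finsum_add]
    rotate_left
    · filter_upwards [(Filter.eventually_all_finset (Finset.range N)).2 fun i _ => e i] with j hj
      exact Finset.sum_eq_zero hj
    · filter_upwards [Filter.eventually_gt_atTop k.natAbs] with j hj
      rw [if_neg (by omega), if_neg (by omega), smul_zero, add_zero, smul_zero]
    refine finsum_congr fun j => ?_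
    simp only [map_smul, map_add, map_sub, hX, comm, hj, smul_add, smul_sub, mul_add,
      Finset.mul_sum, Finset.smul_sum, Finset.sum_add_distrib, mul_smul_comm]
    have r₁ : ∀ i : ℕ, m + j + k - i = m + k - i + j := fun i => by ring
    have r₂ : ∀ i : ℕ, m - n - 1 - j + k - i = m + k - i - n - 1 - j := fun i => by ring
    have r₃ : mode heisenberg.Y u (m - n - 1 - j) (if k + j = 0 then (k : ℂ) • w else 0)
        = if k + j = 0 then (k : ℂ) • mode heisenberg.Y u (m - n - 1 - j) w else 0 := by
      split_ifs <;> simp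
    simp only [r₁, r₂, r₃, smul_comm (binom k _)]
    abel

/-! ### Vacuum expectation values -/

/-- The form of `sum_binom_mul_binom_sub` in which the sum is unrestricted: terms with t > q vanish
by the convention for negative lower entries. -/
theorem finsum_binom_binomInt_sub (l m q : ℤ) :
    ∑ᶠ t : ℕ, (-1) ^ t * binom l t * binomInt (m + l - t) (q - t) = binomInt m q := by
  rcases lt_or_ge q 0 with hq | hq
  · rw [binomInt_of_neg hq, ← finsum_zero (α := ℕ)]
    exact finsum_congr fun t => by rw [binomInt_of_neg (by omega), mul_zero]
  · lift q to ℕ using hq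
    rw [binomInt_natCast, ← sum_binom_mul_binom_sub l m q,
      Finset.Nat.sum_antidiagonal_eq_sum_range_succ fun i j =>
        (-1) ^ i * binom l i * binom (m + l - i) j,
      finsum_eq_sum_range (n := q.succ) fun i hi => by rw [binomInt_of_neg (by omega), mul_zero]]
    refine Finset.sum_congr rfl fun i hi => ?_
    rw [← binomInt_natCast (m + l - i) (q - i), Nat.cast_sub (by simpa [Nat.lt_succ_iff] using hi)]

/-- The constant term of an element of the Fock space. -/
def vacCoeff : Fock →ₗ[ℂ] ℂ := (MvPolynomial.aeval (0 : ℕ → ℂ)).toLinearMap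

theorem vacCoeff_X_mul (n : ℕ) (w : Fock) : vacCoeff (MvPolynomial.X n * w) = 0 := by
  simp [vacCoeff]

theorem vacCoeff_C (a : ℂ) : vacCoeff (MvPolynomial.C a) = a := by
  simp [vacCoeff]

theorem vacCoeff_mode_X_mul (n : ℕ) (u : Fock) (a : ℤ) (w : Fock) :
    vacCoeff (mode heisenberg.Y (MvPolynomial.X n * u) a w)
      = ∑ᶠ j : ℕ, (((n + j).choose j : ℕ) : ℂ) *
          ((-1 : ℂ) ^ n * vacCoeff (mode heisenberg.Y u (a - n - 1 - j) (heis j w))) := by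
  rw [mode_X_mul_apply, (evZero_mode_X_mul n u a w).map_finsum vacCoeff]
  refine finsum_congr fun j => ?_
  rw [map_smul, map_add, vacCoeff_X_mul, zero_add, map_smul, smul_eq_mul, smul_eq_mul]

theorem C_eq_smul_one (a : ℂ) : (MvPolynomial.C a : Fock) = a • (1 : Fock) := by
  rw [MvPolynomial.smul_eq_C_mul, mul_one]

theorem vacCoeff_mode_one (u : Fock) (n : ℤ) :
    vacCoeff (mode heisenberg.Y u n 1) = if n = -1 then vacCoeff u else 0 := by
  induction u using MvPolynomial.induction_on with
  | C a =>
    rw [C_eq_smul_one, mode_smul, LinearMap.smul_apply, mode_one_apply]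
    split_ifs <;> simp
  | add p q hp hq =>
    rw [mode_add, LinearMap.add_apply, map_add, hp, hq]
    split_ifs <;> simp
  | mul_X p i _ =>
    rw [mul_comm p, vacCoeff_mode_X_mul, vacCoeff_X_mul, ite_self, ← finsum_zero (α := ℕ)]
    exact finsum_congr fun j => by rw [heis_natCast_one, map_zero, map_zero, mul_zero, mul_zero]

/-- After j = i + t, the two binomials become choose(n+i, i) times choose(n+i+t, t). The latter is,
up to sign, binom(-(n+i)-1, t), and `finsum_binom_binomInt_sub` applies. -/
theorem finsum_choose_binomInt (n i : ℕ) (a b : ℤ) :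
    ∑ᶠ j : ℕ, (((n + j).choose j : ℕ) : ℂ) * (((j.choose i : ℕ) : ℂ) *
        binomInt (a - n - 1 - j) (i - b - 1 - j))
      = (((n + i).choose i : ℕ) : ℂ) * binomInt a (-b - 1) := by
  rw [finsum_shift _ i, ← finsum_binom_binomInt_sub (-(n + i : ℕ) - 1), mul_finsum]
  · refine finsum_congr fun t => ?_
    have h : ((n + (i + t)).choose (i + t) : ℂ) * ((i + t).choose i : ℂ)
        = ((n + i).choose i : ℂ) * ((n + i + t).choose t : ℂ) := by
      have h₁ := Nat.choose_mul (n := n + (i + t)) (k := i + t) (s := i) (by omega)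
      have h₂ := Nat.choose_mul (n := n + (i + t)) (k := n + i) (s := i) (by omega)
      rw [show i + t - i = t by omega, show n + (i + t) - i = n + t by omega] at h₁
      rw [show n + i - i = n by omega, show n + (i + t) - i = n + t by omega] at h₂
      have h₃ : (n + i + t).choose t = (n + (i + t)).choose (n + i) := by
        rw [← add_assoc, Nat.choose_symm_add]
      rw [h₃]
      have h₄ : (n + t).choose n = (n + t).choose t := Nat.choose_symm_add
      rw [h₄] at h₂
      exact_mod_cast (h₁.trans h₂.symm).trans (mul_comm _ _)
    rw [← mul_assoc, h, choose_eq_binom_neg (n + i) t,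
      show i - b - 1 - ((i + t : ℕ) : ℤ) = -b - 1 - t by push_cast; ring,
      show a - n - 1 - ((i + t : ℕ) : ℤ) = a + (-(n + i : ℕ) - 1) - t by push_cast; ring]
    ring
  · intro j hj
    rw [Nat.choose_eq_zero_of_lt hj, Nat.cast_zero, zero_mul, mul_zero]
  · filter_upwards [Filter.eventually_ge_atTop (i - b).toNat] with j hj
    rw [binomInt_of_neg (by omega), mul_zero, mul_zero]

/-- The two-point function of Y(u,x) and Y(v,y) depends only on x - y: it is the sum of the constant
terms of u_p v times (x-y)^{-p-1}, expanded in nonnegative powers of y. This is its coefficient at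
x^{-a-1} y^{-b-1}. -/
theorem vacCoeff_mode_mode_one (u v : Fock) (a b : ℤ) :
    vacCoeff (mode heisenberg.Y u a (mode heisenberg.Y v b 1))
      = binomInt a (-b - 1) * vacCoeff (mode heisenberg.Y u (a + b + 1) v) := by
  induction u using MvPolynomial.induction_on generalizing v a b with
  | C c =>
    simp only [C_eq_smul_one, mode_smul, LinearMap.smul_apply, mode_one_apply, map_smul]
    by_cases ha : a = -1
    · subst ha
      rw [if_pos rfl, vacCoeff_mode_one]
      by_cases hb : b = -1
      · subst hb
        have h0 : binomInt (-1) (-(-1) - 1) = 1 :=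
          (binomInt_natCast (-1) 0).trans (binom_zero_right _)
        rw [h0]
        simp
      · rw [if_neg hb, if_neg (by omega), map_zero, smul_zero, mul_zero]
    · rw [if_neg ha]
      by_cases hb : a + b + 1 = -1
      · have h0 : binomInt a (-b - 1) = 0 := by
          rcases lt_or_ge a 0 with h | h
          · exact binomInt_of_neg (by omega)
          · rw [binomInt_symm h, binomInt_of_neg (by omega)]
        rw [h0, map_zero, zero_mul, smul_zero]
      · rw [if_neg hb, map_zero, smul_zero, mul_zero]
  | add p q hp hq =>
    simp only [mode_add, LinearMap.add_apply, map_add, hp, hq, mul_add]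
  | mul_X u n hu =>
    rw [mul_comm u, vacCoeff_mode_X_mul, vacCoeff_mode_X_mul, mul_finsum]
    have h₁ : ∀ j : ℕ, (((n + j).choose j : ℕ) : ℂ) * ((-1 : ℂ) ^ n *
        vacCoeff (mode heisenberg.Y u (a - n - 1 - j) (heis j (mode heisenberg.Y v b 1))))
        = ∑ᶠ i : ℕ, (((n + j).choose j : ℕ) : ℂ) * (((j.choose i : ℕ) : ℂ) *
        binomInt (a - n - 1 - j) (i - b - 1 - j)) * ((-1 : ℂ) ^ n *
          vacCoeff (mode heisenberg.Y u (a + b + 1 - n - 1 - i) (heis i v))) := by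
      intro j
      -- As h_j kills the vacuum, h_j v_b 1 is a pure commutator; this moves the annihilation
      -- operator onto v.
      have h := heis_commutatorFormula j v b 1
      rw [heis_natCast_one, map_zero, sub_zero] at h
      have e := evZero_commutator heisenberg.Y (evZero_heis v) j b 1
      rw [h, e.map_finsum (mode heisenberg.Y u (a - n - 1 - j)),
        (e.map fun _ => mode heisenberg.Y u (a - n - 1 - j)).map_finsum vacCoeff,
        mul_finsum, mul_finsum]
      · refine finsum_congr fun i => ?_
        rw [map_smul, map_smul, hu, smul_eq_mul, binom_natCast,
          show -(b + j - i) - 1 = i - b - 1 - j by ring,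
          show a - n - 1 - j + (b + j - i) + 1 = a + b + 1 - n - 1 - i by ring]
        ring
    rw [finsum_congr h₁, EvZero.finsum_comm]
    · refine finsum_congr fun i => ?_
      rw [← finsum_mul, finsum_choose_binomInt]
      ring
    · filter_upwards [evZero_heis v] with i hi j
      rw [hi, map_zero, map_zero, mul_zero, mul_zero]
    · intro i
      filter_upwards [Filter.eventually_ge_atTop (i - b).toNat] with j hj
      rw [binomInt_of_neg (by omega), mul_zero, mul_zero, zero_mul]

theorem neg_one_zpow_sub (a b : ℤ) : (-1 : ℂ) ^ (a - b) = (-1) ^ a * (-1) ^ b := by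
  rw [sub_eq_add_neg, zpow_add₀ (by norm_num), zpow_neg]
  congr 1
  rw [← inv_zpow]
  norm_num

/-- Skew-symmetry modulo translation terms, which have no constant term. In the induction, X n is
moved to the left of v_l, where it kills the constant term; the commutator left over is the
annihilation expansion of the other side. -/
theorem vacCoeff_skew (u v : Fock) (l : ℤ) :
    vacCoeff (mode heisenberg.Y u l v) = -((-1) ^ l * vacCoeff (mode heisenberg.Y v l u)) := by
  induction u using MvPolynomial.induction_on generalizing v l with
  | C c =>
    simp only [C_eq_smul_one, mode_smul, LinearMap.smul_apply, mode_one_apply, map_smul,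
      vacCoeff_mode_one]
    by_cases h : l = -1
    · subst h
      simp
    · simp [h]
  | add p q hp hq =>
    simp only [mode_add, LinearMap.add_apply, map_add, hp, hq]
    ring
  | mul_X u n hu =>
    have h := heis_commutatorFormula (-n - 1) v l u
    rw [heis_neg_apply, heis_neg_apply, sub_eq_iff_eq_add, ← sub_eq_iff_eq_add'] at h
    have e := evZero_commutator heisenberg.Y (evZero_heis v) (-n - 1) l u
    rw [mul_comm u, vacCoeff_mode_X_mul, ← h, map_sub, vacCoeff_X_mul, zero_sub,
      e.map_finsum vacCoeff, mul_neg, neg_neg, mul_finsum]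
    · refine finsum_congr fun j => ?_
      rw [hu, map_smul, smul_eq_mul, choose_eq_binom_neg, show l + (-n - 1) - j = l - n - 1 - j by ring,
        neg_one_zpow_sub, neg_one_zpow_sub, neg_one_zpow_sub, zpow_natCast, zpow_natCast, zpow_one]
      have hj : ((-1 : ℂ) ^ j) * (-1) ^ j = 1 := by rw [← mul_pow]; norm_num
      have hn : ((-1 : ℂ) ^ n) * (-1) ^ n = 1 := by rw [← mul_pow]; norm_num
      linear_combination ((-1 : ℂ) ^ l * binom (-n - 1) j *
        vacCoeff (mode heisenberg.Y (heis j v) (l - n - 1 - j) u)) * (((-1 : ℂ) ^ n * (-1) ^ n) * hj + hn)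

/-! ### The Jacobi identity -/

/-- Every term is a multiple of the constant term of u_p v or v_p u with p = l + m + n + 1. The
left-hand sums collapse by `finsum_binom_binomInt_sub`, on the right only i = m + n + 1 survives,
and skew-symmetry leaves `binomInt_three_term`. -/
theorem vacCoeff_jacDefect_one (l m n : ℤ) (u v : Fock) :
    vacCoeff (jacDefect heisenberg heisenberg.Y l m n u v 1) = 0 := by
  have hL : vacCoeff (∑ᶠ i, jacLeftTerm heisenberg.Y l m n u v i 1)
      = binomInt m (-n - 1) * vacCoeff (mode heisenberg.Y u (l + m + n + 1) v)
        - (-1) ^ l * (binomInt n (-m - 1) * vacCoeff (mode heisenberg.Y v (l + m + n + 1) u)) := by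
    have fin : ∀ a b : ℤ, (Function.support fun t : ℕ =>
        (-1) ^ t * binom l t * binomInt (a + l - t) (-b - 1 - t)).Finite := fun a b => by
      refine EvZero.finite ?_
      filter_upwards [Filter.eventually_ge_atTop (-b).toNat] with j hj
      rw [binomInt_of_neg (by omega), mul_zero]
    rw [(evZero_jacLeftTerm heisenberg.Y l m n u v 1).map_finsum vacCoeff,
      ← finsum_binom_binomInt_sub l m, ← finsum_binom_binomInt_sub l n, finsum_mul' _ _ (fin m n),
      finsum_mul' _ _ (fin n m), mul_finsum, ← finsum_sub_distrib]
    · refine finsum_congr fun i => ?_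
      rw [jacLeftTerm_apply, map_smul, map_sub, map_smul, vacCoeff_mode_mode_one,
        vacCoeff_mode_mode_one, smul_eq_mul, smul_eq_mul,
        show m + l - i + (n + i) + 1 = l + m + n + 1 by ring,
        show n + l - i + (m + i) + 1 = l + m + n + 1 by ring,
        show -(n + i) - 1 = -n - 1 - i by ring, show -(m + i) - 1 = -m - 1 - i by ring]
      ring
    · exact (fin m n).subset (Function.support_mul_subset_left _ _)
    · exact ((fin n m).subset (Function.support_mul_subset_left _ _)).subset
        (Function.support_mul_subset_right _ _)
  have hR : vacCoeff (∑ᶠ i, jacRightTerm heisenberg heisenberg.Y l m n u v i 1)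
      = binomInt m (m + n + 1) * vacCoeff (mode heisenberg.Y u (l + m + n + 1) v) := by
    rw [(evZero_jacRightTerm heisenberg heisenberg.Y l m n u v 1).map_finsum vacCoeff]
    have h : ∀ i : ℕ, vacCoeff (jacRightTerm heisenberg heisenberg.Y l m n u v i 1)
        = if (i : ℤ) = m + n + 1 then
          binom m i * vacCoeff (mode heisenberg.Y u (l + m + n + 1) v) else 0 := by
      intro i
      rw [jacRightTerm, LinearMap.smul_apply, map_smul, vacCoeff_mode_one, smul_eq_mul, mul_ite,
        mul_zero]
      by_cases hi : (i : ℤ) = m + n + 1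
      · rw [if_pos hi, if_pos (by omega), hi, show l + (m + n + 1) = l + m + n + 1 by ring]
      · rw [if_neg hi, if_neg (by omega)]
    rw [finsum_congr h]
    rcases lt_or_ge (m + n + 1) 0 with hmn | hmn
    · rw [binomInt_of_neg hmn, zero_mul]
      exact (finsum_congr fun i => if_neg (by omega)).trans finsum_zero
    · obtain ⟨q, hq⟩ := Int.eq_ofNat_of_zero_le hmn
      rw [hq, binomInt_natCast, finsum_eq_single _ q fun i hi => if_neg (by omega), if_pos rfl]
  rw [jacDefect_apply, map_sub, hL, hR, ← binomInt_three_term, vacCoeff_skew v u]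
  have e : (-1 : ℂ) ^ l * (-1) ^ l = 1 := by rw [← mul_zpow]; norm_num
  rw [show (-1 : ℂ) ^ (l + m + n + 1) = -((-1) ^ l * (-1) ^ (m + n)) by
    rw [add_assoc l, zpow_add₀ (by norm_num), zpow_add₀ (by norm_num) l, zpow_one]; ring]
  linear_combination (-(-1 : ℂ) ^ (m + n) * binomInt n (-m - 1) *
    vacCoeff (mode heisenberg.Y u (l + m + n + 1) v)) * e

/-! ### Operators commuting with the Heisenberg algebra -/

theorem eq_C_of_pderiv_eq_zero {p : Fock} (h : ∀ n, MvPolynomial.pderiv n p = 0) :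
    p = MvPolynomial.C (vacCoeff p) := by
  have hp : p = MvPolynomial.C (MvPolynomial.coeff 0 p) := by
    ext s
    rw [MvPolynomial.coeff_C]
    split_ifs with hs
    · rw [hs]
    · obtain ⟨n, hn⟩ := Finsupp.ne_iff.1 (Ne.symm hs)
      have hsn : s - Finsupp.single n 1 + Finsupp.single n 1 = s :=
        tsub_add_cancel_of_le (Finsupp.single_le_iff.2 (Nat.one_le_iff_ne_zero.2 hn))
      have hc := congrArg (MvPolynomial.coeff (s - Finsupp.single n 1)) (h n)
      rw [MvPolynomial.coeff_pderiv, hsn, MvPolynomial.coeff_zero] at hc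
      refine (mul_eq_zero.1 hc).resolve_right ?_
      exact Nat.cast_add_one_ne_zero _
  conv_rhs => rw [hp, vacCoeff_C]
  exact hp

theorem pderiv_eq_zero_of_heis {p : Fock} (n : ℕ) (h : heis ((n + 1 : ℕ) : ℤ) p = 0) :
    MvPolynomial.pderiv n p = 0 := by
  rw [heis_natCast_succ_apply] at h
  exact (smul_eq_zero.1 h).resolve_left (by exact_mod_cast Nat.succ_ne_zero n)

/-- An operator on the Fock space that commutes with the Heisenberg operators and has vanishing
vacuum expectation value is zero. -/
theorem eq_zero_of_heis_comm (T : Fock →ₗ[ℂ] Fock) (h : ∀ k w, heis k (T w) = T (heis k w))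
    (h₁ : vacCoeff (T 1) = 0) : T = 0 := by
  -- All annihilation operators kill T 1, so it is a constant, namely its vacuum expectation value.
  -- The creation operators then carry T 1 = 0 to all of the Fock space.
  have h0 : T 1 = 0 := by
    rw [eq_C_of_pderiv_eq_zero (p := T 1) fun n => pderiv_eq_zero_of_heis n (by
      rw [h, heis_natCast_one, map_zero]), h₁, map_zero]
  refine LinearMap.ext fun w => ?_
  induction w using MvPolynomial.induction_on with
  | C a => rw [C_eq_smul_one, map_smul, h0, smul_zero, LinearMap.zero_apply]
  | add p q hp hq => rw [map_add, hp, hq, map_add]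
  | mul_X p n hp =>
    rw [mul_comm, ← heis_neg_apply, ← h, hp, LinearMap.zero_apply, map_zero, LinearMap.zero_apply]

/-- The exact relation between t and s is kept because it serves both the degree and the weight. The
truncated i - 1 is harmless, since h_0 = 0 falls under the first alternative. -/
theorem heis_natCast_monomial (i : ℕ) (s : ℕ →₀ ℕ) :
    heis i (MvPolynomial.monomial s (1 : ℂ)) = 0 ∨
      ∃ (c : ℂ) (t : ℕ →₀ ℕ), heis i (MvPolynomial.monomial s (1 : ℂ))
        = c • MvPolynomial.monomial t 1 ∧ t + Finsupp.single (i - 1) 1 = s := by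
  cases i with
  | zero => exact Or.inl rfl
  | succ n =>
    by_cases hn : s n = 0
    · left
      rw [heis_natCast_succ_apply, MvPolynomial.pderiv_monomial, hn]
      simp
    · refine Or.inr ⟨((n : ℂ) + 1) * s n, s - Finsupp.single n 1, ?_,
        tsub_add_cancel_of_le (Finsupp.single_le_iff.2 (Nat.one_le_iff_ne_zero.2 hn))⟩
      rw [heis_natCast_succ_apply, MvPolynomial.pderiv_monomial, MvPolynomial.smul_monomial,
        MvPolynomial.smul_monomial]
      simp

theorem heis_natCast_monomial_degree (i : ℕ) (s : ℕ →₀ ℕ) :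
    heis i (MvPolynomial.monomial s (1 : ℂ)) = 0 ∨
      ∃ (c : ℂ) (t : ℕ →₀ ℕ), heis i (MvPolynomial.monomial s (1 : ℂ))
        = c • MvPolynomial.monomial t 1 ∧ t.degree + 1 = s.degree := by
  refine (heis_natCast_monomial i s).imp_right ?_
  rintro ⟨c, t, h, rfl⟩
  exact ⟨c, t, h, by rw [map_add, Finsupp.degree_single]⟩

/-- Induction on the total degree. A mode h_i with i ≥ 0 lowers the degree of the argument it hits
or kills it, so the defect commutes with all h_k, and its vacuum expectation value vanishes. -/
theorem jacDefect_monomial (l m n : ℤ) (s t : ℕ →₀ ℕ) :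
    jacDefect heisenberg heisenberg.Y l m n (MvPolynomial.monomial s 1)
      (MvPolynomial.monomial t 1) = 0 := by
  induction hd : s.degree + t.degree using Nat.strong_induction_on generalizing s t l m n with
  | _ d ih =>
    refine eq_zero_of_heis_comm _ (fun k w => ?_) (vacCoeff_jacDefect_one l m n _ _)
    refine (heis_commutatorFormula k).jacDefect_comm (fun i => heis_commutatorFormula i) evZero_heis
      (fun i l m n => ?_) (fun i l m n => ?_) l m n w
    · obtain h | ⟨c, s', h, hs⟩ := heis_natCast_monomial_degree i s
      · rw [h]
        exact LinearMap.map_zero₂ (jacDefectBilin heisenberg heisenberg.Y l m n) _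
      · rw [h, jacDefect_smul_left, ih _ (by omega) l m n s' t rfl, smul_zero]
    · obtain h | ⟨c, t', h, ht⟩ := heis_natCast_monomial_degree i t
      · rw [h]
        exact map_zero (jacDefectBilin heisenberg heisenberg.Y l m n _)
      · rw [h, jacDefect_smul_right, ih _ (by omega) l m n s t' rfl, smul_zero]

theorem jacDefect_heisenberg (l m n : ℤ) (u v : Fock) :
    jacDefect heisenberg heisenberg.Y l m n u v = 0 := by
  have h : jacDefectBilin heisenberg heisenberg.Y l m n = 0 := by
    refine (MvPolynomial.basisMonomials ℕ ℂ).ext fun s => (MvPolynomial.basisMonomials ℕ ℂ).ext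
      fun t => ?_
    rw [MvPolynomial.coe_basisMonomials]
    exact jacDefect_monomial l m n s t
  exact congrArg (fun f => f u v) h

theorem isModule_heisenberg : IsModule heisenberg heisenberg.Y :=
  (isModule_iff _ _).2 ⟨mode_vac, fun u v l m n => jacDefect_heisenberg l m n u v⟩

theorem isVertexAlgebra_heisenberg : IsVertexAlgebra heisenberg where
  adjoint := isModule_heisenberg
  creation_nonneg u n hn := (mode_apply_one u (by omega)).trans (if_neg (by omega))
  creation u := (mode_apply_one u le_rfl).trans (if_pos rfl)

/-! ### Laurent series -/

/-- The coefficient of `z ^ n`. -/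
def lcoeff (a : Laur) (n : ℤ) : ℂ := HahnSeries.coeff (Γ := ℤ) (R := ℂ) a n

theorem Laur.ext {a b : Laur} (h : ∀ n, lcoeff a n = lcoeff b n) : a = b :=
  HahnSeries.ext (Γ := ℤ) (R := ℂ) (funext h)

theorem lcoeff_zero (n : ℤ) : lcoeff 0 n = 0 := rfl

theorem lcoeff_add (a b : Laur) (n : ℤ) : lcoeff (a + b) n = lcoeff a n + lcoeff b n := rfl

theorem lcoeff_sub (a b : Laur) (n : ℤ) : lcoeff (a - b) n = lcoeff a n - lcoeff b n := rfl

theorem lcoeff_smul (c : ℂ) (a : Laur) (n : ℤ) : lcoeff (c • a) n = c * lcoeff a n := rfl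

theorem lcoeff_sum {ι : Type*} (s : Finset ι) (f : ι → Laur) (n : ℤ) :
    lcoeff (∑ i ∈ s, f i) n = ∑ i ∈ s, lcoeff (f i) n := by
  classical
  induction s using Finset.induction_on with
  | empty => simp [lcoeff_zero]
  | insert i s hi ih => rw [Finset.sum_insert hi, Finset.sum_insert hi, lcoeff_add, ih]

theorem lcoeff_zMonomial (s n : ℤ) : lcoeff (zMonomial s) n = if n = s then 1 else 0 := by
  refine (HahnSeries.coeff_single (Γ := ℤ) (R := ℂ)).trans ?_
  split_ifs <;> rfl

theorem lcoeff_one (n : ℤ) : lcoeff 1 n = if n = 0 then 1 else 0 := by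
  refine (HahnSeries.coeff_one (Γ := ℤ) (R := ℂ)).trans ?_
  split_ifs <;> rfl

theorem coeff_derivative_iterate (i : ℕ) (a : LaurentSeries ℂ) (n : ℤ) :
    ((LaurentSeries.derivative ℂ)^[i] a).coeff n
      = i.factorial * (binom (n + i) i * a.coeff (n + i)) := by
  rw [LaurentSeries.derivative_iterate, HahnSeries.coeff_nsmul, Pi.smul_apply,
    LaurentSeries.hasseDeriv_coeff, nsmul_eq_mul, zsmul_eq_mul]
  rfl

theorem lcoeff_ddz_pow (i : ℕ) (a : Laur) (n : ℤ) :
    lcoeff ((ddz ^ i) a) n = i.factorial * (binom (n + i) i * lcoeff a (n + i)) := by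
  rw [Module.End.pow_apply]
  exact coeff_derivative_iterate i a n

theorem lcoeff_divDeriv (i : ℕ) (a : Laur) (n : ℤ) :
    lcoeff (divDeriv i a) n = binom (n + i) i * lcoeff a (n + i) := by
  rw [divDeriv, LinearMap.smul_apply, lcoeff_smul, lcoeff_ddz_pow,
    inv_mul_cancel_left₀ (by exact_mod_cast i.factorial_ne_zero)]

theorem divDeriv_zero (a : Laur) : divDeriv 0 a = a := by
  refine Laur.ext fun n => ?_
  rw [lcoeff_divDeriv, binom_zero_right, one_mul, Nat.cast_zero, add_zero]

theorem divDeriv_one {i : ℕ} (hi : i ≠ 0) : divDeriv i 1 = 0 := by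
  refine Laur.ext fun n => ?_
  rw [lcoeff_divDeriv, lcoeff_one, lcoeff_zero]
  split_ifs with h
  · rw [h, binom_zero_left, if_neg hi, zero_mul]
  · rw [mul_zero]

theorem divDeriv_zMonomial (i : ℕ) (s : ℤ) :
    divDeriv i (zMonomial s) = binom s i • zMonomial (s - i) := by
  refine Laur.ext fun n => ?_
  rw [lcoeff_divDeriv, lcoeff_smul, lcoeff_zMonomial, lcoeff_zMonomial]
  by_cases h : n + i = s
  · rw [if_pos h, if_pos (by omega), h]
  · rw [if_neg h, if_neg (by omega), mul_zero, mul_zero]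

theorem divDeriv_divDeriv (i s : ℕ) (a : Laur) :
    divDeriv i (divDeriv s a) = (((s + i).choose s : ℕ) : ℂ) • divDeriv (s + i) a := by
  refine Laur.ext fun n => ?_
  rw [lcoeff_divDeriv, lcoeff_divDeriv, lcoeff_smul, lcoeff_divDeriv]
  have h := binom_mul_binom (n + (s + i : ℕ)) s i
  rw [show n + ((s + i : ℕ) : ℤ) - s = n + i by push_cast; ring] at h
  rw [show n + i + s = n + ((s + i : ℕ) : ℤ) by push_cast; ring]
  linear_combination (-lcoeff a (n + (s + i : ℕ))) * h

/-- All coefficients of `a` below `z ^ N` vanish. -/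
def VanishBelow (a : Laur) (N : ℤ) : Prop := ∀ i < N, lcoeff a i = 0

theorem exists_vanishBelow (a : Laur) : ∃ N, VanishBelow a N :=
  ⟨HahnSeries.order (Γ := ℤ) (R := ℂ) a, fun _ hi =>
    HahnSeries.coeff_eq_zero_of_lt_order (Γ := ℤ) (R := ℂ) hi⟩

theorem VanishBelow.divDeriv {a : Laur} {N : ℤ} (ha : VanishBelow a N) (i : ℕ) :
    VanishBelow (divDeriv i a) (N - i) := fun j hj => by
  rw [lcoeff_divDeriv, ha _ (by omega), mul_zero]

/-- The summation window depends only on order bounds and not on the supports, so sums for different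
products can be reindexed into each other. -/
theorem lcoeff_mul {a b : Laur} {A B : ℤ} (ha : VanishBelow a A) (hb : VanishBelow b B) (n : ℤ) :
    lcoeff (a * b) n = ∑ i ∈ Finset.Icc A (n - B), lcoeff a i * lcoeff b (n - i) := by
  rw [lcoeff]
  refine (HahnSeries.coeff_mul (Γ := ℤ) (R := ℂ) (x := a) (y := b) (a := n)).trans ?_
  refine Finset.sum_of_injOn (fun p => p.1) ?_ ?_ ?_ ?_
  · rintro ⟨p, q⟩ hp ⟨p', q'⟩ hp' h
    rw [Finset.mem_coe, Finset.mem_antidiagonal] at hp hp'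
    simp only [Prod.mk.injEq] at *
    omega
  · rintro ⟨p, q⟩ hp
    rw [Finset.mem_coe, Finset.mem_antidiagonal] at hp
    rw [Finset.mem_coe, Finset.mem_Icc]
    obtain ⟨h₁, h₂, h₃⟩ := hp
    have h₄ : A ≤ p := not_lt.1 fun h => h₁ (ha p h)
    have h₅ : B ≤ q := not_lt.1 fun h => h₂ (hb q h)
    simp only at *
    omega
  · intro i _ hi
    by_contra hne
    refine hi ⟨(i, n - i), ?_, rfl⟩
    rw [Finset.mem_coe, Finset.mem_antidiagonal]
    exact ⟨left_ne_zero_of_mul hne, right_ne_zero_of_mul hne, by simp⟩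
  · rintro ⟨p, q⟩ hp
    rw [Finset.mem_antidiagonal] at hp
    obtain ⟨-, -, rfl⟩ := hp
    simp only [add_sub_cancel_left]
    rfl

theorem VanishBelow.mul {a b : Laur} {A B : ℤ} (ha : VanishBelow a A) (hb : VanishBelow b B) :
    VanishBelow (a * b) (A + B) := fun i hi => by
  rw [lcoeff_mul ha hb, Finset.Icc_eq_empty (by omega), Finset.sum_empty]

/-- The Leibniz rule, coefficientwise: Vandermonde for n + k = i + (n + k - i). -/
theorem divDeriv_mul (k : ℕ) (a b : Laur) :
    divDeriv k (a * b)
      = ∑ p ∈ Finset.HasAntidiagonal.antidiagonal k, divDeriv p.1 a * divDeriv p.2 b := by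
  obtain ⟨A, ha⟩ := exists_vanishBelow a
  obtain ⟨B, hb⟩ := exists_vanishBelow b
  refine Laur.ext fun n => ?_
  rw [lcoeff_divDeriv, lcoeff_mul ha hb, lcoeff_sum, Finset.mul_sum]
  have h : ∀ p ∈ Finset.HasAntidiagonal.antidiagonal k, lcoeff (divDeriv p.1 a * divDeriv p.2 b) n
      = ∑ i ∈ Finset.Icc A (n + k - B), binom i p.1 * lcoeff a i *
        (binom (n + k - i) p.2 * lcoeff b (n + k - i)) := by
    intro p hp
    have hk : (k : ℤ) = p.1 + p.2 := by exact_mod_cast (Finset.HasAntidiagonal.mem_antidiagonal.1 hp).symm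
    rw [lcoeff_mul (ha.divDeriv p.1) (hb.divDeriv p.2)]
    refine Finset.sum_bij' (fun i _ => i + p.1) (fun i _ => i - p.1) ?_ ?_ ?_ ?_ ?_
    · intro i hi
      rw [Finset.mem_Icc] at *
      omega
    · intro i hi
      rw [Finset.mem_Icc] at *
      omega
    · intro i _
      ring
    · intro i _
      ring
    · intro i _
      rw [lcoeff_divDeriv, lcoeff_divDeriv, show n + k - (i + p.1) = n - i + p.2 by rw [hk]; ring]
  rw [Finset.sum_congr rfl h, Finset.sum_comm]
  refine Finset.sum_congr rfl fun i _ => ?_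
  rw [show n + k = i + (n + k - i) by ring, binom_add, Finset.sum_mul]
  refine Finset.sum_congr rfl fun p _ => ?_
  rw [show i + (n + k - i) - i = n + k - i by ring]
  ring

/-! ### Modes of the tensor product with `ℂ((z))` -/

section Tensor

variable {V W : Type*} [AddCommGroup V] [Module ℂ V] [AddCommGroup W] [Module ℂ W]
variable (A : VertexData V)

theorem mode_tensorLaur (x : Laur ⊗[ℂ] V) (n : ℤ) :
    mode (tensorLaur A).Y x n = tensorMode A n x := by
  rw [mode]
  exact ncoeff_vertexOfModes _ _ n

theorem tensorMode_apply (n : ℤ) (x y : Laur ⊗[ℂ] V) :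
    tensorMode A n x y = ∑ᶠ i, tensorTerm A n i x y := rfl

theorem evZero_tensorTerm (n : ℤ) (x y : Laur ⊗[ℂ] V) : EvZero fun i => tensorTerm A n i x y := by
  obtain ⟨N, hN⟩ := tensorTerm_truncation A x y
  filter_upwards [Filter.eventually_ge_atTop (N - n).toNat] with i hi
  exact hN n i (by omega)

theorem tensorMode_add_left (n : ℤ) (x x' : Laur ⊗[ℂ] V) :
    tensorMode A n (x + x') = tensorMode A n x + tensorMode A n x' := by
  simp only [← mode_tensorLaur, mode_add]

theorem smul_finsum_laur {f : ℕ → Laur ⊗[ℂ] V} (hf : EvZero f) (a : Laur) :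
    a • ∑ᶠ i, f i = ∑ᶠ i, a • f i :=
  hf.map_finsum (DistribSMul.toAddMonoidHom _ a)

theorem tensorTerm_smul_right (n : ℤ) (i : ℕ) (x y : Laur ⊗[ℂ] V) (b : Laur) :
    tensorTerm A n i x (b • y) = b • tensorTerm A n i x y := by
  induction x using TensorProduct.induction_on with
  | zero => simp
  | add x₁ x₂ h₁ h₂ => simp only [map_add, LinearMap.add_apply, h₁, h₂, smul_add]
  | tmul a u =>
    induction y using TensorProduct.induction_on with
    | zero => simp
    | add y₁ y₂ h₁ h₂ => simp only [map_add, smul_add, h₁, h₂]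
    | tmul c v =>
      rw [TensorProduct.smul_tmul', smul_eq_mul, tensorTerm_tmul, tensorTerm_tmul,
        TensorProduct.smul_tmul', smul_eq_mul, mul_left_comm]

theorem tensorMode_smul_right (n : ℤ) (x y : Laur ⊗[ℂ] V) (b : Laur) :
    tensorMode A n x (b • y) = b • tensorMode A n x y := by
  rw [tensorMode_apply, tensorMode_apply, smul_finsum_laur (evZero_tensorTerm A n x y)]
  exact finsum_congr fun i => tensorTerm_smul_right A n i x y b

theorem tensorTerm_smul_left (n : ℤ) (j : ℕ) (a : Laur) (x y : Laur ⊗[ℂ] V) :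
    tensorTerm A n j (a • x) y = ∑ p ∈ Finset.HasAntidiagonal.antidiagonal j,
      divDeriv p.1 a • tensorTerm A (n + p.1) p.2 x y := by
  induction x using TensorProduct.induction_on with
  | zero => simp
  | add x₁ x₂ h₁ h₂ =>
    simp only [map_add, LinearMap.add_apply, h₁, h₂, smul_add, Finset.sum_add_distrib]
  | tmul c u =>
    induction y using TensorProduct.induction_on with
    | zero => simp
    | add y₁ y₂ h₁ h₂ => simp only [map_add, smul_add, h₁, h₂, Finset.sum_add_distrib]
    | tmul b v =>
      rw [TensorProduct.smul_tmul', smul_eq_mul, tensorTerm_tmul, divDeriv_mul, Finset.sum_mul,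
        TensorProduct.sum_tmul]
      refine Finset.sum_congr rfl fun p hp => ?_
      rw [tensorTerm_tmul, TensorProduct.smul_tmul', smul_eq_mul, mul_assoc, add_assoc n,
        ← Finset.HasAntidiagonal.mem_antidiagonal.1 hp, Nat.cast_add]

/-- The coefficient form of multiplying by e^{x d/dz} a. It reduces statements about a ⊗ u to the
case 1 ⊗ u. -/
theorem tensorMode_smul_left (n : ℤ) (a : Laur) (x y : Laur ⊗[ℂ] V) :
    tensorMode A n (a • x) y = ∑ᶠ j : ℕ, divDeriv j a • tensorMode A (n + j) x y := by
  obtain ⟨N, hN⟩ := tensorTerm_truncation A x y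
  have h : ∀ j : ℕ, divDeriv j a • tensorMode A (n + j) x y
      = ∑ᶠ i, divDeriv j a • tensorTerm A (n + j) i x y := fun j => by
    rw [tensorMode_apply, smul_finsum_laur (evZero_tensorTerm A _ x y)]
  rw [finsum_congr h, finsum_triangle (n := (N - n).toNat) fun j i hji => by
    rw [hN _ _ (by omega), smul_zero]]
  exact finsum_congr fun j => tensorTerm_smul_left A n j a x y

theorem evZero_tensorMode (n : ℤ) (x y : Laur ⊗[ℂ] V) :
    EvZero fun j : ℕ => tensorMode A (n + j) x y := by
  obtain ⟨N, hN⟩ := tensorMode_truncation A x y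
  filter_upwards [Filter.eventually_ge_atTop (N - n).toNat] with i hi
  exact hN _ (by omega)

theorem tensorMode_one_tmul (n : ℤ) (u v : V) (b : Laur) :
    tensorMode A n (1 ⊗ₜ u) (b ⊗ₜ v) = b ⊗ₜ mode A.Y u n v := by
  rw [tensorMode_apply, finsum_eq_single _ 0]
  · rw [tensorTerm_tmul, divDeriv_zero, one_mul, Nat.cast_zero, add_zero]
  · intro i hi
    rw [tensorTerm_tmul, divDeriv_one hi, zero_mul, TensorProduct.zero_tmul]

theorem extendLaur_tmul (Δ : V →ₗ[ℂ] Laur ⊗[ℂ] V) (a : Laur) (v : V) :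
    extendLaur Δ (a ⊗ₜ v) = a • Δ v := by
  rw [extendLaur, LinearMap.liftBaseChange_tmul]

/-! ### The derivation `X_{h,f}` -/

theorem evZero_pseudoX (h : V) (f : Laur) (v : V) :
    EvZero fun n : ℕ => divDeriv n f ⊗ₜ[ℂ] mode A.Y h n v := by
  filter_upwards [evZero_mode_natCast A.Y h v] with n hn
  rw [hn, TensorProduct.tmul_zero]

theorem pseudoX_apply (h : V) (f : Laur) (v : V) :
    pseudoX A h f v = ∑ᶠ n : ℕ, divDeriv n f ⊗ₜ[ℂ] mode A.Y h n v := rfl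

variable {A}

/-- Commuting h_i past u_n produces choose(i, s) (h_s u)_{n+i-s}. Since choose(i, s) times the i-th
divided derivative of f is the (i-s)-th divided derivative of the s-th one, these terms sum to the
tensor mode of X u, with its factor e^{x d/dz}. -/
theorem pseudoX_mode {h : V} (hc : ∀ i : ℕ,
    CommutatorFormula A.Y (fun j : ℕ => mode A.Y h j) i (mode A.Y h i)) (f : Laur) (u v : V)
    (n : ℤ) : pseudoX A h f (mode A.Y u n v)
      = tensorMode A n (pseudoX A h f u) (1 ⊗ₜ v) + tensorMode A n (1 ⊗ₜ u) (pseudoX A h f v) := by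
  obtain ⟨N, hN⟩ := Filter.eventually_atTop.1 (evZero_mode_natCast A.Y h u)
  have hN' : ∀ s, N ≤ s → mode A.Y h s u = 0 := hN
  have h₁ : ∀ i : ℕ, divDeriv i f ⊗ₜ[ℂ] mode A.Y h i (mode A.Y u n v)
      = (∑ s ∈ Finset.range N, ((i.choose s : ℕ) : ℂ) •
          divDeriv i f ⊗ₜ[ℂ] mode A.Y (mode A.Y h s u) (n + i - s) v)
        + divDeriv i f ⊗ₜ[ℂ] mode A.Y u n (mode A.Y h i v) := by
    intro i
    have e := hc i u n v
    rw [finsum_eq_sum_range (n := N) fun s hs => by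
      rw [hN' s hs, mode_zero, LinearMap.zero_apply, smul_zero]] at e
    rw [sub_eq_iff_eq_add.1 e, TensorProduct.tmul_add, TensorProduct.tmul_sum]
    congr 1
    refine Finset.sum_congr rfl fun s _ => ?_
    rw [binom_natCast, TensorProduct.tmul_smul]
  have z₁ : ∀ s : ℕ, EvZero fun i : ℕ => ((i.choose s : ℕ) : ℂ) •
          divDeriv i f ⊗ₜ[ℂ] mode A.Y (mode A.Y h s u) (n + i - s) v := by
    intro s
    filter_upwards [evZero_mode_add A.Y (mode A.Y h s u) v (n - s)] with i hi
    rw [show n + i - s = n - s + i by ring, hi, TensorProduct.tmul_zero, smul_zero]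
  have z₂ : EvZero fun i : ℕ => divDeriv i f ⊗ₜ[ℂ] mode A.Y u n (mode A.Y h i v) := by
    filter_upwards [evZero_mode_natCast A.Y h v] with i hi
    rw [hi, map_zero, TensorProduct.tmul_zero]
  rw [pseudoX_apply, finsum_congr h₁, EvZero.finsum_add _ z₂,
    EvZero.finsum_sum_comm fun s _ => z₁ s]
  · congr 1
    · rw [pseudoX_apply, ← mode_tensorLaur, mode_finsum_apply _ (evZero_pseudoX A h f u),
        finsum_eq_sum_range (n := N) fun s hs => by
          rw [hN' s hs, TensorProduct.tmul_zero, mode_zero, LinearMap.zero_apply]]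
      refine Finset.sum_congr rfl fun s _ => ?_
      rw [finsum_shift (z₁ s) s, mode_tensorLaur, tensorMode_apply]
      · refine finsum_congr fun i => ?_
        rw [tensorTerm_tmul, mul_one, divDeriv_divDeriv, TensorProduct.smul_tmul',
          show n + ((s + i : ℕ) : ℤ) - s = n + i by push_cast; ring]
      · intro i hi
        rw [Nat.choose_eq_zero_of_lt hi, Nat.cast_zero, zero_smul]
    · rw [pseudoX_apply, (evZero_pseudoX A h f v).map_finsum (tensorMode A n (1 ⊗ₜ u))]
      exact finsum_congr fun i => (tensorMode_one_tmul A n u _ _).symm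
  · filter_upwards [(Filter.eventually_all_finset (Finset.range N)).2 fun s _ => z₁ s] with i hi
    exact Finset.sum_eq_zero hi

/-- The `ℂ((z))`-linear extension of `X_{h,f}` is a derivation of the tensor product. -/
theorem extendLaur_pseudoX_tensorMode {h : V} (hc : ∀ i : ℕ,
    CommutatorFormula A.Y (fun j : ℕ => mode A.Y h j) i (mode A.Y h i)) (f : Laur)
    (x y : Laur ⊗[ℂ] V) (n : ℤ) :
    extendLaur (pseudoX A h f) (tensorMode A n x y)
      = tensorMode A n (extendLaur (pseudoX A h f) x) y
        + tensorMode A n x (extendLaur (pseudoX A h f) y) := by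
  have zero_left : ∀ y, tensorMode A n 0 y = 0 := fun y => by
    rw [← mode_tensorLaur, mode_zero, LinearMap.zero_apply]
  induction x using TensorProduct.induction_on with
  | zero => simp [zero_left]
  | add x₁ x₂ h₁ h₂ =>
    simp only [tensorMode_add_left, map_add, LinearMap.add_apply, h₁, h₂]
    abel
  | tmul a u =>
    induction y using TensorProduct.induction_on with
    | zero => simp
    | add y₁ y₂ h₁ h₂ =>
      simp only [map_add, h₁, h₂]
      abel
    | tmul b v =>
      have ha : a ⊗ₜ[ℂ] u = a • ((1 : Laur) ⊗ₜ[ℂ] u) := by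
        rw [TensorProduct.smul_tmul', smul_eq_mul, mul_one]
      have hb : b ⊗ₜ[ℂ] v = b • ((1 : Laur) ⊗ₜ[ℂ] v) := by
        rw [TensorProduct.smul_tmul', smul_eq_mul, mul_one]
      rw [extendLaur_tmul, extendLaur_tmul, tensorMode_smul_left, hb]
      have e := evZero_tensorMode A n ((1 : Laur) ⊗ₜ[ℂ] u) (b • ((1 : Laur) ⊗ₜ[ℂ] v))
      rw [ha, tensorMode_smul_left, tensorMode_smul_left, (e.smul fun j => divDeriv j a).map_finsum,
        ← EvZero.finsum_add]
      · refine finsum_congr fun j => ?_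
        rw [map_smul, tensorMode_smul_right, tensorMode_one_tmul, map_smul, extendLaur_tmul,
          one_smul, pseudoX_mode hc, tensorMode_smul_right, tensorMode_smul_right, smul_add,
          smul_add]
      · exact (evZero_tensorMode A n _ _).smul _
      · exact (evZero_tensorMode A n _ _).smul _

end Tensor

/-! ### Exponentials of locally nilpotent operators -/

section Exponential

/-- The divided power `x ^ n / n!`. -/
def divPow {R : Type*} [Ring R] [Algebra ℂ R] (x : R) (n : ℕ) : R := ((n.factorial : ℂ)⁻¹) • x ^ n

theorem divPow_zero_right {R : Type*} [Ring R] [Algebra ℂ R] (x : R) : divPow x 0 = 1 := by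
  simp [divPow]

theorem divPow_zero_left {R : Type*} [Ring R] [Algebra ℂ R] {n : ℕ} (hn : n ≠ 0) :
    divPow (0 : R) n = 0 := by
  rw [divPow, zero_pow hn, smul_zero]

theorem divPow_add {R : Type*} [Ring R] [Algebra ℂ R] {x y : R} (h : Commute x y) (n : ℕ) :
    divPow (x + y) n
      = ∑ p ∈ Finset.HasAntidiagonal.antidiagonal n, divPow x p.1 * divPow y p.2 := by
  rw [divPow, h.add_pow', Finset.smul_sum]
  refine Finset.sum_congr rfl fun p hp => ?_
  have hn := Finset.HasAntidiagonal.mem_antidiagonal.1 hp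
  rw [divPow, divPow, smul_mul_smul_comm, ← Nat.cast_smul_eq_nsmul ℂ, smul_smul]
  congr 1
  have h₁ : (p.1.factorial : ℂ) ≠ 0 := by exact_mod_cast p.1.factorial_ne_zero
  have h₂ : (p.2.factorial : ℂ) ≠ 0 := by exact_mod_cast p.2.factorial_ne_zero
  have h₃ : (n.factorial : ℂ) ≠ 0 := by exact_mod_cast n.factorial_ne_zero
  have h₄ : (n.choose p.1 : ℂ) * p.1.factorial * p.2.factorial = n.factorial := by
    rw [← hn, Nat.choose_symm_add]
    exact_mod_cast Nat.add_choose_mul_factorial_mul_factorial p.1 p.2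
  field_simp
  linear_combination h₄

variable {M : Type*} [AddCommGroup M] [Module ℂ M]

theorem divPow_apply (T : Module.End ℂ M) (n : ℕ) (y : M) :
    divPow T n y = ((n.factorial : ℂ)⁻¹) • (T ^ n) y := rfl

theorem pow_apply_eq_zero {T : Module.End ℂ M} {N : ℕ} {y : M} (h : (T ^ N) y = 0) {n : ℕ}
    (hn : N ≤ n) : (T ^ n) y = 0 := by
  obtain ⟨j, rfl⟩ := Nat.exists_eq_add_of_le' hn
  rw [pow_add, Module.End.mul_apply, h, map_zero]

theorem divPow_apply_eq_zero {T : Module.End ℂ M} {N : ℕ} {y : M} (h : (T ^ N) y = 0) {n : ℕ}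
    (hn : N ≤ n) : divPow T n y = 0 := by
  rw [divPow_apply, pow_apply_eq_zero h hn, smul_zero]

theorem evZero_divPow {T : Module.End ℂ M} (hT : IsLocallyNilpotentEnd T) (y : M) :
    EvZero fun n => divPow T n y := by
  obtain ⟨N, hN⟩ := hT y
  filter_upwards [Filter.eventually_ge_atTop N] with n hn
  exact divPow_apply_eq_zero hN hn

theorem IsLocallyNilpotentEnd.neg {T : Module.End ℂ M} (hT : IsLocallyNilpotentEnd T) :
    IsLocallyNilpotentEnd (-T) := fun y => by
  obtain ⟨N, hN⟩ := hT y
  refine ⟨N, ?_⟩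
  rw [neg_pow, Module.End.mul_apply, hN, map_zero]

/-- The degree t part of exp(T) exp(-T) is the t-th divided power of T - T = 0. -/
theorem finsum_divPow_divPow_neg {T : Module.End ℂ M} (hT : IsLocallyNilpotentEnd T) (y : M) :
    ∑ᶠ j, divPow T j (∑ᶠ i, divPow (-T) i y) = y := by
  obtain ⟨N, hN⟩ := hT y
  have h : ∀ j, divPow T j (∑ᶠ i, divPow (-T) i y) = ∑ᶠ i, divPow T j (divPow (-T) i y) :=
    fun j => (evZero_divPow hT.neg y).map_finsum (divPow T j)
  rw [finsum_congr h, finsum_triangle (n := N)]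
  · have h₂ : ∀ t, ∑ p ∈ Finset.HasAntidiagonal.antidiagonal t, divPow T p.1 (divPow (-T) p.2 y)
        = divPow (0 : Module.End ℂ M) t y := by
      intro t
      rw [← add_neg_cancel T, divPow_add (Commute.neg_right (Commute.refl T)), LinearMap.sum_apply]
      rfl
    rw [finsum_congr h₂, finsum_eq_single _ 0 fun t ht => by
      rw [divPow_zero_left ht, LinearMap.zero_apply], divPow_zero_right, Module.End.one_apply]
  · intro j i hji
    rw [divPow_apply, divPow_apply, neg_pow, Module.End.mul_apply, map_smul,
      show (T ^ j) (((-1 : Module.End ℂ M) ^ i) ((T ^ i) y)) = ((-1 : Module.End ℂ M) ^ i)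
        ((T ^ (j + i)) y) by
          rw [pow_add, Module.End.mul_apply, ← Module.End.mul_apply, ← Module.End.mul_apply,
            ((Commute.neg_one_right (T ^ j)).pow_right i).eq]; rfl,
      pow_apply_eq_zero hN hji, map_zero, smul_zero, smul_zero]

theorem bijective_finsum_divPow {T : Module.End ℂ M} (hT : IsLocallyNilpotentEnd T) :
    Function.Bijective fun y => ∑ᶠ i, divPow T i y := by
  refine Function.bijective_iff_has_inverse.2 ⟨fun y => ∑ᶠ i, divPow (-T) i y, fun y => ?_,
    finsum_divPow_divPow_neg hT⟩
  have h := finsum_divPow_divPow_neg hT.neg y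
  rwa [neg_neg] at h

/-- A derivation of μ corresponds to T ⊗ 1 + 1 ⊗ T on the tensor square. The two summands commute,
so the binomial theorem applies there and is carried back along μ. -/
theorem divPow_bilin {T : Module.End ℂ M} (μ : M →ₗ[ℂ] M →ₗ[ℂ] M)
    (h : ∀ x y, T (μ x y) = μ (T x) y + μ x (T y)) (n : ℕ) (x y : M) :
    divPow T n (μ x y) = ∑ p ∈ Finset.HasAntidiagonal.antidiagonal n,
      μ (divPow T p.1 x) (divPow T p.2 y) := by
  set S : Module.End ℂ (M ⊗[ℂ] M) := T.rTensor M + T.lTensor M with hS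
  have hm : ∀ z, T (TensorProduct.lift μ z) = TensorProduct.lift μ (S z) := by
    intro z
    induction z using TensorProduct.induction_on with
    | zero => simp
    | add z₁ z₂ h₁ h₂ => simp only [map_add, h₁, h₂]
    | tmul x y => simp [hS, h]
  have hpow : ∀ (k : ℕ) z, (T ^ k) (TensorProduct.lift μ z) = TensorProduct.lift μ ((S ^ k) z) := by
    intro k
    induction k with
    | zero => exact fun z => rfl
    | succ k ih =>
      intro z
      rw [pow_succ, pow_succ, Module.End.mul_apply, Module.End.mul_apply, hm, ih]
  have hcomm : Commute (T.rTensor M : Module.End ℂ (M ⊗[ℂ] M)) (T.lTensor M) := by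
    refine (LinearMap.rTensor_comp_lTensor _ _ _).trans
      (LinearMap.lTensor_comp_rTensor _ _ _).symm
  have hd : divPow T n (TensorProduct.lift μ (x ⊗ₜ y))
      = TensorProduct.lift μ (divPow S n (x ⊗ₜ y)) := by
    rw [divPow_apply, divPow_apply, hpow, map_smul]
  rw [TensorProduct.lift.tmul] at hd
  rw [hd, hS, divPow_add hcomm, LinearMap.sum_apply, map_sum]
  refine Finset.sum_congr rfl fun p _ => ?_
  rw [Module.End.mul_apply, divPow_apply, divPow_apply, divPow_apply, divPow_apply,
    LinearMap.lTensor_pow, LinearMap.rTensor_pow, LinearMap.lTensor_tmul, map_smul,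
    map_smul, LinearMap.rTensor_tmul, map_smul, TensorProduct.lift.tmul, map_smul, map_smul,
    LinearMap.smul_apply, smul_comm]

theorem finsum_divPow_bilin {T : Module.End ℂ M} (hT : IsLocallyNilpotentEnd T)
    (μ : M →ₗ[ℂ] M →ₗ[ℂ] M) (h : ∀ x y, T (μ x y) = μ (T x) y + μ x (T y)) (x y : M) :
    ∑ᶠ n, divPow T n (μ x y) = μ (∑ᶠ n, divPow T n x) (∑ᶠ n, divPow T n y) := by
  obtain ⟨N, hN⟩ := hT x
  obtain ⟨N', hN'⟩ := hT y
  have h₁ : μ (∑ᶠ n, divPow T n x) (∑ᶠ n, divPow T n y)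
      = ∑ᶠ j, ∑ᶠ i, μ (divPow T j x) (divPow T i y) := by
    refine ((evZero_divPow hT x).map_finsum (μ.flip _)).trans (finsum_congr fun j => ?_)
    exact (evZero_divPow hT y).map_finsum (μ (divPow T j x))
  rw [h₁, finsum_triangle (n := N + N')]
  · exact finsum_congr fun n => divPow_bilin μ h n x y
  · intro j i hji
    rcases le_or_gt N j with hj | hj
    · rw [divPow_apply_eq_zero hN hj, map_zero, LinearMap.zero_apply]
    · rw [divPow_apply_eq_zero hN' (show N' ≤ i by omega), map_zero]

end Exponential

/-! ### Exponentials of `X_{h,f}` -/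

section PseudoExp

variable {V : Type*} [AddCommGroup V] [Module ℂ V]

/-- The `ℂ((z))`-linear extension of `X`, as a `ℂ`-linear endomorphism. -/
def extendEnd (X : V →ₗ[ℂ] Laur ⊗[ℂ] V) : Module.End ℂ (Laur ⊗[ℂ] V) :=
  (extendLaur X).restrictScalars ℂ

theorem extendEnd_pow_apply (X : V →ₗ[ℂ] Laur ⊗[ℂ] V) (n : ℕ) (y : Laur ⊗[ℂ] V) :
    (extendEnd X ^ n) y = (extendLaur X ^ n) y := by
  induction n generalizing y with
  | zero => rfl
  | succ n ih => rw [pow_succ, pow_succ, Module.End.mul_apply, Module.End.mul_apply, ih]; rfl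

theorem IsLocNilpotent.extendEnd {X : V →ₗ[ℂ] Laur ⊗[ℂ] V} (hX : IsLocNilpotent X) :
    IsLocallyNilpotentEnd (extendEnd X) := by
  intro y
  induction y using TensorProduct.induction_on with
  | zero => exact ⟨0, map_zero _⟩
  | add y₁ y₂ h₁ h₂ =>
    obtain ⟨N₁, h₁⟩ := h₁
    obtain ⟨N₂, h₂⟩ := h₂
    exact ⟨max N₁ N₂, by rw [map_add, pow_apply_eq_zero h₁ (le_max_left _ _),
      pow_apply_eq_zero h₂ (le_max_right _ _), add_zero]⟩
  | tmul a v =>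
    obtain ⟨N, hN⟩ := hX v
    refine ⟨N, ?_⟩
    rw [extendEnd_pow_apply, ← mul_one a, ← smul_eq_mul, ← TensorProduct.smul_tmul', map_smul, hN,
      smul_zero]

theorem pseudoExp_apply (X : V →ₗ[ℂ] Laur ⊗[ℂ] V) (hX : IsLocNilpotent X) (v : V) :
    pseudoExp X hX v = ∑ᶠ n, divPow (extendEnd X) n (1 ⊗ₜ v) := by
  refine finsum_congr fun n => ?_
  rw [divPow_apply, extendEnd_pow_apply]
  rfl

/-- The powers of the extension are ℂ((z))-linear, so extending the exponential is exponentiating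
the extension. -/
theorem extendLaur_pseudoExp (X : V →ₗ[ℂ] Laur ⊗[ℂ] V) (hX : IsLocNilpotent X)
    (y : Laur ⊗[ℂ] V) :
    extendLaur (pseudoExp X hX) y = ∑ᶠ n, divPow (extendEnd X) n y := by
  induction y using TensorProduct.induction_on with
  | zero => simp
  | add y₁ y₂ h₁ h₂ =>
    rw [map_add, h₁, h₂, ← (evZero_divPow hX.extendEnd y₁).finsum_add
      (evZero_divPow hX.extendEnd y₂)]
    exact finsum_congr fun n => (map_add _ _ _).symm
  | tmul a v =>
    rw [extendLaur_tmul, pseudoExp_apply, smul_finsum_laur (evZero_divPow hX.extendEnd _)]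
    refine finsum_congr fun n => ?_
    rw [divPow_apply, divPow_apply, extendEnd_pow_apply, extendEnd_pow_apply, smul_comm a,
      ← map_smul, TensorProduct.smul_tmul', smul_eq_mul, mul_one]

/-- `X_{h,f}` exponentiates to a pseudo-automorphism if it is locally nilpotent, the modes `h_i`
with `i ≥ 0` satisfy the commutator formula, and they annihilate the vacuum. -/
theorem isPseudoAutomorphism_pseudoExp {A : VertexData V} {h : V} (hc : ∀ i : ℕ,
    CommutatorFormula A.Y (fun j : ℕ => mode A.Y h j) i (mode A.Y h i))
    (hvac : ∀ i : ℕ, mode A.Y h i A.vac = 0) (f : Laur) (hX : IsLocNilpotent (pseudoX A h f)) :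
    IsPseudoAutomorphism A (pseudoExp (pseudoX A h f) hX) := by
  have hXvac : pseudoX A h f A.vac = 0 := by
    rw [pseudoX_apply]
    exact (finsum_congr fun n => by rw [hvac, TensorProduct.tmul_zero]).trans finsum_zero
  have vac : pseudoExp (pseudoX A h f) hX A.vac = 1 ⊗ₜ A.vac := by
    have hT : (extendEnd (pseudoX A h f) ^ 1) (1 ⊗ₜ A.vac) = 0 := by
      rw [extendEnd_pow_apply, pow_one, extendLaur_tmul, hXvac, smul_zero]
    rw [pseudoExp_apply, finsum_eq_single _ 0 fun n hn => divPow_apply_eq_zero hT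
      (Nat.one_le_iff_ne_zero.2 hn), divPow_zero_right, Module.End.one_apply]
  have mul : ∀ (x y : Laur ⊗[ℂ] V) (n : ℤ), extendLaur (pseudoExp (pseudoX A h f) hX)
      (tensorMode A n x y) = tensorMode A n (extendLaur (pseudoExp (pseudoX A h f) hX) x)
        (extendLaur (pseudoExp (pseudoX A h f) hX) y) := by
    intro x y n
    simp only [extendLaur_pseudoExp, ← mode_tensorLaur]
    refine finsum_divPow_bilin hX.extendEnd (modeBilin (tensorLaur A).Y n) (fun x y => ?_) x y
    change extendLaur _ (mode (tensorLaur A).Y x n y) = mode (tensorLaur A).Y _ n y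
      + mode (tensorLaur A).Y x n _
    simp only [mode_tensorLaur]
    exact extendLaur_pseudoX_tensorMode hc f x y n
  have one : ∀ v, extendLaur (pseudoExp (pseudoX A h f) hX) (1 ⊗ₜ v)
      = pseudoExp (pseudoX A h f) hX v := fun v => by rw [extendLaur_tmul, one_smul]
  refine ⟨⟨vac, fun u v n => ?_⟩, ⟨?_, ?_, fun x y n => ?_⟩⟩
  · rw [← one, ← tensorMode_one_tmul, mul, one, one]
  · have hb := bijective_finsum_divPow hX.extendEnd
    rwa [← funext (extendLaur_pseudoExp (pseudoX A h f) hX)] at hb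
  · exact (one _).trans vac
  · simp only [mode_tensorLaur]
    exact mul x y n

end PseudoExp

/-! ### The pseudo-automorphisms `exp X_{h,f}` of the Heisenberg vertex algebra -/

/-- Every h_n with n ≥ 0 kills a monomial or removes one variable, so degree at most d is exhausted
after d + 1 steps. The factor a is arbitrary because each step changes it. -/
theorem pseudoX_pow_monomial (f : Laur) (d : ℕ) (s : ℕ →₀ ℕ) (hs : s.degree ≤ d) (a : Laur) :
    (extendLaur (pseudoX heisenberg hvec f) ^ (d + 1))
      (a ⊗ₜ[ℂ] (MvPolynomial.monomial s (1 : ℂ) : Fock)) = 0 := by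
  induction d generalizing s a with
  | zero =>
    rw [zero_add, pow_one, extendLaur_tmul, pseudoX_apply]
    refine (congrArg _ ((finsum_congr fun n => ?_).trans finsum_zero)).trans (smul_zero a)
    rw [mode_hvec]
    obtain h | ⟨c, t, h, ht⟩ := heis_natCast_monomial_degree n s
    · rw [h, TensorProduct.tmul_zero]
    · omega
  | succ d ih =>
    rw [pow_succ, Module.End.mul_apply, extendLaur_tmul, map_smul, pseudoX_apply,
      (evZero_pseudoX heisenberg hvec f _).map_finsum]
    refine (congrArg _ ((finsum_congr fun n => ?_).trans finsum_zero)).trans (smul_zero a)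
    rw [mode_hvec]
    obtain h | ⟨c, t, h, ht⟩ := heis_natCast_monomial_degree n s
    · rw [h, TensorProduct.tmul_zero, map_zero]
    · rw [h, TensorProduct.tmul_smul, TensorProduct.smul_tmul', ih t (by omega)]

theorem isLocNilpotent_pseudoX (f : Laur) : IsLocNilpotent (pseudoX heisenberg hvec f) := by
  intro v
  induction v using MvPolynomial.induction_on' with
  | monomial s c =>
    refine ⟨s.degree + 1, ?_⟩
    rw [show (MvPolynomial.monomial s c : Fock) = c • MvPolynomial.monomial s 1 by
      rw [MvPolynomial.smul_monomial, smul_eq_mul, mul_one], TensorProduct.tmul_smul,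
      TensorProduct.smul_tmul', pseudoX_pow_monomial f _ s le_rfl]
  | add p q hp hq =>
    obtain ⟨N₁, h₁⟩ := hp
    obtain ⟨N₂, h₂⟩ := hq
    rw [← extendEnd_pow_apply] at h₁ h₂
    refine ⟨max N₁ N₂, ?_⟩
    rw [← extendEnd_pow_apply, TensorProduct.tmul_add, map_add,
      pow_apply_eq_zero h₁ (le_max_left _ _), pow_apply_eq_zero h₂ (le_max_right _ _), add_zero]

theorem isPseudoAutomorphism_heisenberg (f : Laur) (hX : IsLocNilpotent (pseudoX heisenberg hvec f)) :
    IsPseudoAutomorphism heisenberg (pseudoExp (pseudoX heisenberg hvec f) hX) := by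
  refine isPseudoAutomorphism_pseudoExp (fun i => ?_) (fun i => ?_) f hX
  · simp only [mode_hvec]
    exact heis_commutatorFormula i
  · rw [mode_hvec]
    exact heis_natCast_one i

/-! ### Extension of a module to the tensor product with `ℂ((z))` -/

section Extension

variable {V W : Type*} [AddCommGroup V] [Module ℂ V] [AddCommGroup W] [Module ℂ W]

/-- The extension of `Y_W` to `ℂ((z)) ⊗ V`, where `f(z) ⊗ v` acts as `f(x) Y_W(v, x)`. -/
def laurExt (YW : V →ₗ[ℂ] VertexOperator ℂ W) : Laur ⊗[ℂ] V →ₗ[ℂ] VertexOperator ℂ W :=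
  (LinearMap.liftBaseChange Laur YW).restrictScalars ℂ

theorem mode_twist (YW : V →ₗ[ℂ] VertexOperator ℂ W) (Δ : V →ₗ[ℂ] Laur ⊗[ℂ] V) (v : V) (n : ℤ) :
    mode (twist YW Δ) v n = mode (laurExt YW) (Δ v) n := rfl

theorem laurExt_tmul (YW : V →ₗ[ℂ] VertexOperator ℂ W) (a : Laur) (v : V) :
    laurExt YW (a ⊗ₜ v) = a • YW v :=
  LinearMap.liftBaseChange_tmul Laur YW a v

theorem mode_laurExt_tmul (YW : V →ₗ[ℂ] VertexOperator ℂ W) (a : Laur) (v : V) (m : ℤ) (w : W) :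
    mode (laurExt YW) (a ⊗ₜ v) m w
      = ((HahnModule.of ℂ).symm ((a : HahnSeries ℤ ℂ) • (YW v w : HahnModule ℤ ℂ W))).coeff
        (-m - 1) := by
  rw [mode, laurExt_tmul]
  rfl

theorem mode_eq_coeff (YW : V →ₗ[ℂ] VertexOperator ℂ W) (v : V) (m : ℤ) (w : W) :
    mode YW v m w = ((HahnModule.of ℂ).symm (YW v w)).coeff (-m - 1) := rfl

theorem mode_laurExt_zMonomial (YW : V →ₗ[ℂ] VertexOperator ℂ W) (s : ℤ) (v : V) (m : ℤ) :
    mode (laurExt YW) (zMonomial s ⊗ₜ v) m = mode YW v (m + s) := by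
  refine LinearMap.ext fun w => ?_
  rw [mode_laurExt_tmul, mode_eq_coeff]
  have h := HahnModule.coeff_single_smul_vadd (Γ := ℤ) (Γ' := ℤ) (R := ℂ) (r := 1)
    (x := YW v w) (a := -(m + s) - 1) (b := s)
  rw [one_smul, vadd_eq_add, show s + (-(m + s) - 1) = -m - 1 by ring] at h
  exact h

theorem mode_laurExt_eq_zero (YW : V →ₗ[ℂ] VertexOperator ℂ W) {v : V} {w : W} {P : ℤ}
    (hP : ∀ p, P ≤ p → mode YW v p w = 0) {a : Laur} {N : ℤ} (ha : VanishBelow a N) {m : ℤ}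
    (hm : P ≤ m + N) : mode (laurExt YW) (a ⊗ₜ v) m w = 0 := by
  rw [mode_laurExt_tmul]
  refine (HahnModule.coeff_smul (a : HahnSeries ℤ ℂ) (YW v w) _).trans ?_
  refine Finset.sum_eq_zero fun p hp => ?_
  rw [Finset.mem_vaddAntidiagonal] at hp
  obtain ⟨-, -, h⟩ := hp
  rw [vadd_eq_add] at h
  rcases lt_or_ge p.1 N with h₁ | h₁
  · rw [show HahnSeries.coeff (a : HahnSeries ℤ ℂ) p.1 = 0 from ha _ h₁, zero_smul]
  · have h₂ := hP (-p.2 - 1) (by omega)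
    rw [mode_eq_coeff, show -(-p.2 - 1) - 1 = p.2 by ring] at h₂
    rw [h₂, smul_zero]

theorem exists_decomposition (a : Laur) (N : ℤ) : ∃ (s : Finset ℤ) (c : ℤ → ℂ) (r : Laur),
    VanishBelow r N ∧ a = ∑ i ∈ s, c i • zMonomial i + r := by
  obtain ⟨A, hA⟩ := exists_vanishBelow a
  refine ⟨Finset.Ico A N, lcoeff a, a - ∑ i ∈ Finset.Ico A N, lcoeff a i • zMonomial i, ?_,
    by abel⟩
  intro i hi
  rw [lcoeff_sub, lcoeff_sum]
  simp only [lcoeff_smul, lcoeff_zMonomial, mul_ite, mul_one, mul_zero]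
  rw [Finset.sum_ite_eq]
  split_ifs with h
  · rw [sub_self]
  · rw [Finset.mem_Ico] at h
    rw [hA i (by omega), sub_zero]

/-- A linear map on `ℂ((z))` that vanishes on monomials and on series of large order is zero. -/
theorem eq_zero_of_zMonomial {M : Type*} [AddCommGroup M] [Module ℂ M] (T : Laur →ₗ[ℂ] M)
    (h : ∀ s, T (zMonomial s) = 0) (hN : ∃ N, ∀ r, VanishBelow r N → T r = 0) (a : Laur) :
    T a = 0 := by
  obtain ⟨N, hN⟩ := hN
  obtain ⟨s, c, r, hr, rfl⟩ := exists_decomposition a N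
  rw [map_add, hN r hr, map_sum, add_zero]
  exact Finset.sum_eq_zero fun i _ => by rw [map_smul, h, smul_zero]

theorem eventually_mode_laurExt (YW : V →ₗ[ℂ] VertexOperator ℂ W) (v : V) (m : ℤ) (w : W) :
    ∀ᶠ N in Filter.atTop, ∀ r, VanishBelow r N → ∀ i : ℕ,
      mode (laurExt YW) (r ⊗ₜ v) (m + i) w = 0 := by
  obtain ⟨P, hP⟩ := vertexOperator_truncation (YW v) w
  filter_upwards [Filter.eventually_ge_atTop (P - m)] with N hN r hr i
  exact mode_laurExt_eq_zero YW hP hr (by omega)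

/-- The inner mode vanishes for all but finitely many i, so one order bound on r serves for all i.
-/
theorem eventually_mode_mode_laurExt (YW : V →ₗ[ℂ] VertexOperator ℂ W) (v : V) (y : Laur ⊗[ℂ] V)
    (m n : ℤ) (w : W) :
    ∀ᶠ N in Filter.atTop, ∀ r, VanishBelow r N → ∀ i : ℕ,
      mode (laurExt YW) (r ⊗ₜ v) (m - i) (mode (laurExt YW) y (n + i) w) = 0 := by
  obtain ⟨I, hI⟩ : ∃ I, ∀ i : ℕ, I ≤ i → mode (laurExt YW) y (n + i) w = 0 :=
    Filter.eventually_atTop.1 (evZero_mode_add (laurExt YW) y w n)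
  filter_upwards [(Filter.eventually_all_finset (Finset.range I)).2 fun i _ =>
    eventually_mode_laurExt YW v (m - i) (mode (laurExt YW) y (n + i) w)] with N hN r hr i
  rcases le_or_gt I i with hi | hi
  · rw [hI i hi, map_zero]
  · have h := hN i (Finset.mem_range.2 hi) r hr 0
    rwa [Nat.cast_zero, add_zero] at h

theorem exists_mode_tensorMode_eq_zero (A : VertexData V) (YW : V →ₗ[ℂ] VertexOperator ℂ W)
    (u v : V) (l q : ℤ) (w : W) : ∃ K : ℤ, ∀ (a b : Laur) (M N : ℤ), VanishBelow a M →
      VanishBelow b N → K ≤ M + N → ∀ i : ℕ,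
        mode (laurExt YW) (tensorMode A (l + i) (a ⊗ₜ u) (b ⊗ₜ v)) (q - i) w = 0 := by
  obtain ⟨J, hJ⟩ := vertexOperator_truncation (A.Y u) v
  choose P hP using fun p : ℤ => vertexOperator_truncation (YW (mode A.Y u p v)) w
  obtain ⟨K, hK⟩ := ((Finset.Ico l J).image P).bddAbove
  -- The j-th derivative lowers the order by j and the mode index drops by i, but only l + i + j < J
  -- matters; the summand J - l absorbs both losses.
  refine ⟨K - q + max 0 (J - l), fun a b M N ha hb hMN i => ?_⟩
  rw [tensorMode_apply, mode_finsum_apply _ (evZero_tensorTerm A _ _ _)]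
  refine (finsum_congr fun j => ?_).trans finsum_zero
  rw [tensorTerm_tmul]
  rcases le_or_gt J (l + i + j) with h | h
  · rw [mode, mode, hJ _ h, TensorProduct.tmul_zero, map_zero]
    rfl
  · have hPK : P (l + i + j) ≤ K := hK (by
      rw [Finset.mem_coe]
      exact Finset.mem_image_of_mem _ (Finset.mem_Ico.2 ⟨by omega, h⟩))
    exact mode_laurExt_eq_zero YW (hP _) ((ha.divDeriv j).mul hb)
      (by have := le_max_right 0 (J - l); omega)

theorem zMonomial_mul (s t : ℤ) : zMonomial s * zMonomial t = zMonomial (s + t) := by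
  have h := HahnSeries.single_mul_single (Γ := ℤ) (R := ℂ) (a := s) (b := t) (r := 1) (s := 1)
  rw [mul_one] at h
  exact h

/-- Multiplying by z^s shifts mode indices by s. On the right-hand side the derivatives of z^s
contribute binom(s, j), and Vandermonde merges them with binom(m, i). -/
theorem jacDefect_zMonomial (A : VertexData V) (YW : V →ₗ[ℂ] VertexOperator ℂ W) (l m n s t : ℤ)
    (u v : V) : jacDefect (tensorLaur A) (laurExt YW) l m n (zMonomial s ⊗ₜ u) (zMonomial t ⊗ₜ v)
      = jacDefect A YW l (m + s) (n + t) u v := by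
  refine LinearMap.ext fun w => ?_
  rw [jacDefect_apply, jacDefect_apply]
  congr 1
  · refine finsum_congr fun i => ?_
    simp only [jacLeftTerm_apply, mode_laurExt_zMonomial]
    rw [show m + l - i + s = m + s + l - i by ring, show n + i + t = n + t + i by ring,
      show n + l - i + t = n + t + l - i by ring, show m + i + s = m + s + i by ring]
  · have e : EvZero fun i : ℕ => mode YW (mode A.Y u (l + i) v) (m + s + (n + t) - i) w := by
      filter_upwards [evZero_mode_add A.Y u v l] with i hi
      rw [hi, mode_zero, LinearMap.zero_apply]
    refine Eq.trans ?_ (finsum_binom_binom e m s)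
    refine finsum_congr fun i => ?_
    rw [jacRightTerm, LinearMap.smul_apply, mode_tensorLaur, tensorMode_apply,
      mode_finsum_apply _ (evZero_tensorTerm A _ _ _)]
    congr 1
    refine finsum_congr fun j => ?_
    rw [tensorTerm_tmul, divDeriv_zMonomial, smul_mul_assoc, zMonomial_mul,
      ← TensorProduct.smul_tmul', mode_smul, LinearMap.smul_apply, mode_laurExt_zMonomial,
      Nat.cast_add, add_assoc l, show m + n - i + (s - j + t) = m + s + (n + t) - (i + j) by ring]

/-- On a fixed w the defect is linear in each Laurent factor and vanishes when that factor has large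
order. So first b and then a may be replaced by a monomial. -/
theorem jacDefect_laurExt_tmul (A : VertexData V) (YW : V →ₗ[ℂ] VertexOperator ℂ W)
    (hW : IsModule A YW) (l m n : ℤ) (a b : Laur) (u v : V) (w : W) :
    jacDefect (tensorLaur A) (laurExt YW) l m n (a ⊗ₜ u) (b ⊗ₜ v) w = 0 := by
  have vanish : ∀ x y : Laur ⊗[ℂ] V, (∀ i, jacLeftTerm (laurExt YW) l m n x y i w = 0) →
      (∀ i, jacRightTerm (tensorLaur A) (laurExt YW) l m n x y i w = 0) →
      jacDefect (tensorLaur A) (laurExt YW) l m n x y w = 0 := by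
    intro x y h₁ h₂
    rw [jacDefect_apply, finsum_congr h₁, finsum_congr h₂, finsum_zero, sub_zero]
  obtain ⟨K, hK⟩ := exists_mode_tensorMode_eq_zero A YW u v l (m + n) w
  refine eq_zero_of_zMonomial (LinearMap.applyₗ w ∘ₗ
    (jacDefectBilin (tensorLaur A) (laurExt YW) l m n (a ⊗ₜ u)) ∘ₗ
      (TensorProduct.mk ℂ Laur V).flip v) (fun t => ?_) ?_ b
  · change jacDefect (tensorLaur A) (laurExt YW) l m n (a ⊗ₜ u) (zMonomial t ⊗ₜ v) w = 0
    refine eq_zero_of_zMonomial (LinearMap.applyₗ w ∘ₗ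
      ((jacDefectBilin (tensorLaur A) (laurExt YW) l m n).flip (zMonomial t ⊗ₜ v)) ∘ₗ
        (TensorProduct.mk ℂ Laur V).flip u) (fun s => ?_) ?_ a
    · change jacDefect (tensorLaur A) (laurExt YW) l m n (zMonomial s ⊗ₜ u) (zMonomial t ⊗ₜ v) w = 0
      rw [jacDefect_zMonomial, ((isModule_iff A YW).1 hW).2, LinearMap.zero_apply]
    · obtain ⟨B, hB⟩ := exists_vanishBelow (zMonomial t)
      obtain ⟨N, h₁, h₂, h₃⟩ := ((eventually_mode_mode_laurExt YW u (zMonomial t ⊗ₜ v) (m + l) n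
        w).and ((eventually_mode_laurExt YW u m w).and
          (Filter.eventually_ge_atTop (K - B)))).exists
      refine ⟨N, fun r hr => vanish _ _ (fun i => ?_) fun i => ?_⟩
      · change jacLeftTerm _ l m n (r ⊗ₜ u) (zMonomial t ⊗ₜ v) i w = 0
        rw [jacLeftTerm_apply, h₁ r hr i, h₂ r hr i, map_zero, smul_zero, sub_zero, smul_zero]
      · change jacRightTerm _ _ l m n (r ⊗ₜ u) (zMonomial t ⊗ₜ v) i w = 0
        rw [jacRightTerm, LinearMap.smul_apply, mode_tensorLaur, hK _ _ N B hr hB (by omega),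
          smul_zero]
  · obtain ⟨B, hB⟩ := exists_vanishBelow a
    obtain ⟨N, h₁, h₂, h₃⟩ := ((eventually_mode_mode_laurExt YW v (a ⊗ₜ u) (n + l) m
      w).and ((eventually_mode_laurExt YW v n w).and
        (Filter.eventually_ge_atTop (K - B)))).exists
    refine ⟨N, fun r hr => vanish _ _ (fun i => ?_) fun i => ?_⟩
    · change jacLeftTerm _ l m n (a ⊗ₜ u) (r ⊗ₜ v) i w = 0
      rw [jacLeftTerm_apply, h₁ r hr i, h₂ r hr i, map_zero, smul_zero, sub_zero, smul_zero]
    · change jacRightTerm _ _ l m n (a ⊗ₜ u) (r ⊗ₜ v) i w = 0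
      rw [jacRightTerm, LinearMap.smul_apply, mode_tensorLaur, hK _ _ B N hB hr (by omega),
        smul_zero]

theorem jacDefect_laurExt (A : VertexData V) (YW : V →ₗ[ℂ] VertexOperator ℂ W)
    (hW : IsModule A YW) (l m n : ℤ) (x y : Laur ⊗[ℂ] V) :
    jacDefect (tensorLaur A) (laurExt YW) l m n x y = 0 := by
  have h : jacDefectBilin (tensorLaur A) (laurExt YW) l m n = 0 := by
    refine TensorProduct.ext' fun a u => TensorProduct.ext' fun b v => LinearMap.ext fun w => ?_
    exact jacDefect_laurExt_tmul A YW hW l m n a b u v w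
  exact congrArg (fun f => f x y) h

theorem mode_laurExt_one_tmul (YW : V →ₗ[ℂ] VertexOperator ℂ W) (v : V) (n : ℤ) :
    mode (laurExt YW) (1 ⊗ₜ v) n = mode YW v n := by
  rw [mode, laurExt_tmul, one_smul]

/-- The twist of a module by a pseudo-endomorphism is a module. -/
theorem IsModule.twist {A : VertexData V} {YW : V →ₗ[ℂ] VertexOperator ℂ W}
    (hW : IsModule A YW) {Δ : V →ₗ[ℂ] Laur ⊗[ℂ] V} (hΔ : IsPseudoEndomorphism A Δ) :
    IsModule A (twist YW Δ) := by
  refine (isModule_iff _ _).2 ⟨fun n => ?_, fun u v l m n => ?_⟩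
  · rw [mode_twist, hΔ.map_vac, mode_laurExt_one_tmul, hW.vac_mode]
  · rw [← jacDefect_laurExt A YW hW l m n (Δ u) (Δ v)]
    refine LinearMap.ext fun w => ?_
    rw [jacDefect_apply, jacDefect_apply]
    congr 1
    refine finsum_congr fun i => ?_
    rw [jacRightTerm, jacRightTerm, mode_twist, hΔ.map_mode, mode_tensorLaur]

end Extension

/-! ### Nilpotency of the nonnegative modes -/

/-- The span of the monomials of weight less than `K`, where `h_{-n-1}` has weight `n + 1`. -/
def weightLT (K : ℕ) : Submodule ℂ Fock :=
  Submodule.span ℂ {p | ∃ s : ℕ →₀ ℕ, Finsupp.weight (fun n => n + 1) s < K ∧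
    p = MvPolynomial.monomial s 1}

theorem weightLT_mono {K L : ℕ} (h : K ≤ L) : weightLT K ≤ weightLT L := by
  refine Submodule.span_mono ?_
  rintro p ⟨s, hs, rfl⟩
  exact ⟨s, hs.trans_le h, rfl⟩

theorem weightLT_zero : weightLT 0 = ⊥ := by
  refine (Submodule.span_eq_bot).2 ?_
  rintro p ⟨s, hs, -⟩
  exact absurd hs (Nat.not_lt_zero _)

theorem exists_mem_weightLT (w : Fock) : ∃ K, w ∈ weightLT K := by
  induction w using MvPolynomial.induction_on' with
  | monomial s c =>
    refine ⟨Finsupp.weight (fun n => n + 1) s + 1, ?_⟩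
    rw [show (MvPolynomial.monomial s c : Fock) = c • MvPolynomial.monomial s 1 by
      rw [MvPolynomial.smul_monomial, smul_eq_mul, mul_one]]
    exact Submodule.smul_mem _ _ (Submodule.subset_span ⟨s, Nat.lt_succ_self _, rfl⟩)
  | add p q hp hq =>
    obtain ⟨K, hK⟩ := hp
    obtain ⟨L, hL⟩ := hq
    exact ⟨max K L, Submodule.add_mem _ (weightLT_mono (le_max_left _ _) hK)
      (weightLT_mono (le_max_right _ _) hL)⟩

/-- Annihilation lowers the weight by n. Truncation of K - n does no harm, because `weightLT 0` is
zero. -/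
theorem heis_mem_weightLT {K : ℕ} {w : Fock} (hw : w ∈ weightLT K) (n : ℕ) :
    heis n w ∈ weightLT (K - n) := by
  cases n with
  | zero => exact Submodule.zero_mem _
  | succ n =>
    induction hw using Submodule.span_induction with
    | mem p hp =>
      obtain ⟨s, hs, rfl⟩ := hp
      obtain h | ⟨c, t, h, rfl⟩ := heis_natCast_monomial (n + 1) s
      · rw [h]
        exact Submodule.zero_mem _
      · rw [h]
        refine Submodule.smul_mem _ _ (Submodule.subset_span ⟨t, ?_, rfl⟩)
        rw [map_add, Finsupp.weight_single, Nat.add_sub_cancel, one_smul] at hs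
        omega
    | zero => rw [map_zero]; exact Submodule.zero_mem _
    | add p q _ _ hp hq => rw [map_add]; exact Submodule.add_mem _ hp hq
    | smul c p _ hp => rw [map_smul]; exact Submodule.smul_mem _ _ hp

theorem prod_heis_mem_weightLT {K : ℕ} {w : Fock} (hw : w ∈ weightLT K) (l : List ℕ) :
    (l.map fun n : ℕ => heis n).prod w ∈ weightLT (K - l.sum) := by
  induction l with
  | nil => exact hw
  | cons a l ih =>
    rw [List.map_cons, List.prod_cons, Module.End.mul_apply, List.sum_cons,
      show K - (a + l.sum) = K - l.sum - a by omega]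
    exact heis_mem_weightLT ih a

theorem exists_prod_heis_eq_zero (w : Fock) : ∃ K : ℕ, 0 < K ∧ ∀ l : List ℕ, K ≤ l.sum →
    (l.map fun n : ℕ => heis n).prod w = 0 := by
  obtain ⟨K, hK⟩ := exists_mem_weightLT w
  refine ⟨K + 1, Nat.succ_pos K, fun l hl => ?_⟩
  have h := prod_heis_mem_weightLT hK l
  rw [Nat.sub_eq_zero_of_le (by omega), weightLT_zero] at h
  exact (Submodule.mem_bot ℂ).1 h

theorem isLocallyNilpotentEnd_heis {k : ℕ} (hk : 1 ≤ k) : IsLocallyNilpotentEnd (heis k) := by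
  intro w
  obtain ⟨K, -, hK⟩ := exists_prod_heis_eq_zero w
  refine ⟨K, ?_⟩
  have h := hK (List.replicate K k) (by
    rw [List.sum_replicate, smul_eq_mul]
    exact Nat.le_mul_of_pos_right K hk)
  rwa [List.map_replicate, List.prod_replicate] at h

/-! ### Translates of locally nilpotent operators -/

/-- The span of the T^i w is finite-dimensional and T-stable, hence stable under T - c. -/
theorem isLocallyFiniteEnd_sub_smul {M : Type*} [AddCommGroup M] [Module ℂ M]
    {T : Module.End ℂ M} (hT : IsLocallyNilpotentEnd T) (c : ℂ) :
    IsLocallyFiniteEnd (T - c • (1 : Module.End ℂ M)) := by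
  intro w
  obtain ⟨N, hN⟩ := hT w
  refine ⟨Submodule.span ℂ ((fun i => (T ^ i) w) '' Set.Iic N),
    Submodule.subset_span ⟨0, Nat.zero_le _, rfl⟩,
    FiniteDimensional.span_of_finite ℂ ((Set.finite_Iic N).image _), fun x hx => ?_⟩
  have hTx : T x ∈ Submodule.span ℂ ((fun i => (T ^ i) w) '' Set.Iic N) := by
    induction hx using Submodule.span_induction with
    | mem y hy =>
      obtain ⟨i, hi, rfl⟩ := hy
      have hs : T ((T ^ i) w) = (T ^ (i + 1)) w := by rw [pow_succ', Module.End.mul_apply]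
      simp only [hs]
      rcases le_or_gt N i with h | h
      · rw [pow_apply_eq_zero hN (Nat.le_succ_of_le h)]
        exact Submodule.zero_mem _
      · exact Submodule.subset_span ⟨i + 1, h, rfl⟩
    | zero => rw [map_zero]; exact Submodule.zero_mem _
    | add p q _ _ hp hq => rw [map_add]; exact Submodule.add_mem _ hp hq
    | smul c p _ hp => rw [map_smul]; exact Submodule.smul_mem _ _ hp
  exact Submodule.sub_mem _ hTx (Submodule.smul_mem _ c hx)

theorem pow_apply_of_eq_smul {M : Type*} [AddCommGroup M] [Module ℂ M] {T : Module.End ℂ M}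
    {c : ℂ} {w : M} (h : T w = c • w) (N : ℕ) : (T ^ N) w = c ^ N • w := by
  induction N with
  | zero => simp
  | succ N ih => rw [pow_succ, Module.End.mul_apply, h, map_smul, ih, smul_smul, pow_succ']

theorem eq_zero_of_eq_smul {M : Type*} [AddCommGroup M] [Module ℂ M] {T : Module.End ℂ M}
    (hT : IsLocallyNilpotentEnd T) {c : ℂ} (hc : c ≠ 0) {w : M} (h : T w = c • w) : w = 0 := by
  obtain ⟨N, hN⟩ := hT w
  rw [pow_apply_of_eq_smul h] at hN
  exact (smul_eq_zero.1 hN).resolve_left (pow_ne_zero N hc)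

/-! ### The pseudo-automorphisms `exp X_{h,z^{-k}}` -/

theorem pseudoX_zMonomial_apply (s : ℤ) (w : Fock) :
    pseudoX heisenberg hvec (zMonomial s) w
      = ∑ᶠ n : ℕ, binom s (n + 1) •
          (zMonomial (s - (n + 1)) ⊗ₜ[ℂ] mode heisenberg.Y hvec (n + 1) w) := by
  rw [pseudoX_apply, finsum_shift (evZero_pseudoX heisenberg hvec _ w) 1]
  · refine finsum_congr fun n => ?_
    rw [divDeriv_zMonomial, ← TensorProduct.smul_tmul', add_comm 1 n, Nat.cast_succ]
  · intro i hi
    rw [Nat.lt_one_iff.1 hi, mode_hvec]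
    exact TensorProduct.tmul_zero _ _

theorem pseudoX_zMonomial_hvec (s : ℤ) :
    pseudoX heisenberg hvec (zMonomial s) hvec = (s : ℂ) • (zMonomial (s - 1) ⊗ₜ[ℂ] (1 : Fock)) := by
  have h : ∀ n : ℕ, mode heisenberg.Y hvec (n + 1) hvec = if n = 0 then 1 else 0 := by
    intro n
    rw [mode_hvec, hvec, ← mul_one (MvPolynomial.X 0)]
    have := heis_succ_X_mul n 0 1
    rw [heis_natCast_one, mul_zero, zero_add, Nat.cast_zero, zero_add, one_smul] at this
    exact_mod_cast this
  rw [pseudoX_zMonomial_apply, finsum_eq_single _ 0 fun n hn => by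
    rw [h, if_neg hn, TensorProduct.tmul_zero, smul_zero], h, if_pos rfl, zero_add,
    binom_one_right, Nat.cast_zero, zero_add]

/-- X maps h to a ℂ((z))-multiple of the vacuum, which X kills, so the exponential stops after the
linear term. -/
theorem pseudoExp_zMonomial_hvec (s : ℤ)
    (hX : IsLocNilpotent (pseudoX heisenberg hvec (zMonomial s))) :
    pseudoExp (pseudoX heisenberg hvec (zMonomial s)) hX hvec
      = 1 ⊗ₜ[ℂ] hvec + (s : ℂ) • (zMonomial (s - 1) ⊗ₜ[ℂ] (1 : Fock)) := by
  have h₁ : extendEnd (pseudoX heisenberg hvec (zMonomial s)) (1 ⊗ₜ hvec)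
      = (s : ℂ) • (zMonomial (s - 1) ⊗ₜ[ℂ] (1 : Fock)) := by
    rw [← pseudoX_zMonomial_hvec]
    exact (extendLaur_tmul _ _ _).trans (one_smul _ _)
  have h₂ : extendEnd (pseudoX heisenberg hvec (zMonomial s))
      (zMonomial (s - 1) ⊗ₜ[ℂ] (1 : Fock)) = 0 := by
    refine (extendLaur_tmul _ _ _).trans ?_
    rw [pseudoX_apply]
    refine (congrArg _ ((finsum_congr fun n => ?_).trans finsum_zero)).trans (smul_zero _)
    rw [mode_hvec, heis_natCast_one, TensorProduct.tmul_zero]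
  have h₃ : (extendEnd (pseudoX heisenberg hvec (zMonomial s)) ^ 2) (1 ⊗ₜ hvec) = 0 := by
    rw [pow_two, Module.End.mul_apply, h₁, map_smul, h₂, smul_zero]
  rw [pseudoExp_apply, finsum_eq_sum_range fun n hn => divPow_apply_eq_zero h₃ hn,
    Finset.sum_range_succ, Finset.sum_range_one, divPow_zero_right, Module.End.one_apply,
    divPow_apply, pow_one, h₁, Nat.factorial_one, Nat.cast_one, inv_one, one_smul]

theorem neg_natCast_smul {M : Type*} [AddCommGroup M] [Module ℂ M] (k : ℕ) (x : M) :
    ((-k : ℤ) : ℂ) • x = -((k : ℂ) • x) := by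
  rw [Int.cast_neg, Int.cast_natCast, neg_smul]

/-- The element z^{-k-1} ⊗ 1 acts as x^{-k-1} times the identity, whose only nonzero mode has index
n with n - k - 1 = -1. -/
theorem mode_twist_hvec {W : Type*} [AddCommGroup W] [Module ℂ W]
    {YW : Fock →ₗ[ℂ] VertexOperator ℂ W} (hW : IsModule heisenberg YW) (k : ℕ)
    {Φ : Fock →ₗ[ℂ] Laur ⊗[ℂ] Fock} (hΦ : Φ hvec = 1 ⊗ₜ[ℂ] hvec -
      (k : ℂ) • (zMonomial (-k - 1) ⊗ₜ[ℂ] heisenberg.vac)) (n : ℤ) :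
    mode (twist YW Φ) hvec n
      = mode YW hvec n - if n = k then (k : ℂ) • (1 : Module.End ℂ W) else 0 := by
  rw [mode_twist, hΦ]
  refine (map_sub (modeBilin (laurExt YW) n) _ _).trans (congrArg₂ _
    (mode_laurExt_one_tmul YW hvec n) ((mode_smul _ _ _ n).trans ?_))
  rw [mode_laurExt_zMonomial, hW.vac_mode]
  by_cases h : n = k
  · rw [if_pos h, if_pos (by omega)]
  · rw [if_neg h, if_neg (by omega), smul_zero]

end TwistedHeisenberg
end

theorem mainTheorem11 :
    -- `M(1)` is a vertex algebra, and the modes of `h` represent the Heisenberg algebra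
    IsVertexAlgebra heisenberg ∧
    (∀ n : ℤ, mode heisenberg.Y hvec n = heis n) ∧
    (∀ m n : ℤ,
      mode heisenberg.Y hvec m * mode heisenberg.Y hvec n
          - mode heisenberg.Y hvec n * mode heisenberg.Y hvec m
        = if m + n = 0 then (m : ℂ) • (1 : Module.End ℂ Fock) else 0) ∧
    mode heisenberg.Y hvec 0 = 0 ∧
    -- products of nonnegative modes of `h` with large index sum annihilate a given vector
    (∀ w : Fock, ∃ K : ℕ, 0 < K ∧ ∀ l : List ℕ, K ≤ l.sum →
      (l.map fun n : ℕ => mode heisenberg.Y hvec n).prod w = 0) ∧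
    -- `exp X_{h,f}` exists as a map `M(1) → M(1) ⊗ ℂ((z))` for every `f`
    ∃ hX : ∀ f : Laur, IsLocNilpotent (pseudoX heisenberg hvec f),
      (∀ f : Laur, IsPseudoAutomorphism heisenberg (pseudoExp (pseudoX heisenberg hvec f) (hX f))) ∧
      ∀ k : ℕ, 1 ≤ k → ∀ Φ : Fock →ₗ[ℂ] Laur ⊗[ℂ] Fock,
        Φ = pseudoExp (pseudoX heisenberg hvec (zMonomial (-k))) (hX (zMonomial (-k))) →
        (∀ w : Fock, pseudoX heisenberg hvec (zMonomial (-k)) w =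
          ∑ᶠ n : ℕ, ((Ring.choose (-k : ℤ) (n + 1) : ℤ) : ℂ) •
            (zMonomial (-(n + 1) - k) ⊗ₜ[ℂ] mode heisenberg.Y hvec (n + 1) w)) ∧
        IsPseudoAutomorphism heisenberg Φ ∧
        pseudoX heisenberg hvec (zMonomial (-k)) hvec
          = -((k : ℂ) • (zMonomial (-k - 1) ⊗ₜ[ℂ] heisenberg.vac)) ∧
        Φ hvec = 1 ⊗ₜ[ℂ] hvec - (k : ℂ) • (zMonomial (-k - 1) ⊗ₜ[ℂ] heisenberg.vac) ∧
        -- the twist of an arbitrary module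
        (∀ (W : Type*) [AddCommGroup W] [Module ℂ W] (YW : Fock →ₗ[ℂ] VertexOperator ℂ W),
          IsModule heisenberg YW →
            IsModule heisenberg (twist YW Φ) ∧
            ∀ n : ℤ, mode (twist YW Φ) hvec n
              = mode YW hvec n - if n = k then (k : ℂ) • (1 : Module.End ℂ W) else 0) ∧
        -- the twist of the adjoint module
        IsModule heisenberg (twist heisenberg.Y Φ) ∧
        IsLocallyNilpotentEnd (mode heisenberg.Y hvec k) ∧
        mode (twist heisenberg.Y Φ) hvec k
          = mode heisenberg.Y hvec k - (k : ℂ) • (1 : Module.End ℂ Fock) ∧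
        IsLocallyFiniteEnd (mode (twist heisenberg.Y Φ) hvec k) ∧
        ¬ IsNilpotent (mode (twist heisenberg.Y Φ) hvec k) ∧
        ¬ IsLocallyNilpotentEnd (mode (twist heisenberg.Y Φ) hvec k) ∧
        ¬ IsHighestWeightModule (twist heisenberg.Y Φ) := by
  have hcomm : ∀ m n : ℤ,
      mode heisenberg.Y hvec m * mode heisenberg.Y hvec n
          - mode heisenberg.Y hvec n * mode heisenberg.Y hvec m
        = if m + n = 0 then (m : ℂ) • (1 : Module.End ℂ Fock) else 0 := by
    intro m n
    refine LinearMap.ext fun w => ?_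
    rw [mode_hvec, mode_hvec]
    refine (heis_commutator m n w).trans ?_
    split_ifs <;> rfl
  refine ⟨isVertexAlgebra_heisenberg, mode_hvec, hcomm, mode_hvec 0, fun w => ?_,
    isLocNilpotent_pseudoX, fun f => isPseudoAutomorphism_heisenberg f _, ?_⟩
  · simp only [mode_hvec]
    exact exists_prod_heis_eq_zero w
  intro k hk Φ hΦ
  have hk0 : (k : ℂ) ≠ 0 := by exact_mod_cast Nat.one_le_iff_ne_zero.1 hk
  have hauto : IsPseudoAutomorphism heisenberg Φ := hΦ ▸ isPseudoAutomorphism_heisenberg _ _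
  have hneg : ((-k : ℤ) : ℂ) • (zMonomial (-k - 1) ⊗ₜ[ℂ] (1 : Fock))
      = -((k : ℂ) • (zMonomial (-k - 1) ⊗ₜ[ℂ] (1 : Fock))) :=
    neg_natCast_smul (M := Laur ⊗[ℂ] Fock) k _
  have hval : Φ hvec = 1 ⊗ₜ[ℂ] hvec -
      (k : ℂ) • (zMonomial (-k - 1) ⊗ₜ[ℂ] heisenberg.vac) := by
    rw [hΦ, pseudoExp_zMonomial_hvec]
    exact (congrArg (1 ⊗ₜ[ℂ] hvec + ·) hneg).trans
      (sub_eq_add_neg (G := Laur ⊗[ℂ] Fock) _ _).symm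
  have htwist := isModule_heisenberg.twist hauto.isPseudoEndomorphism
  have hmode : mode (twist heisenberg.Y Φ) hvec k = heis k - (k : ℂ) • (1 : Module.End ℂ Fock) := by
    rw [mode_twist_hvec isModule_heisenberg k hval, if_pos rfl, mode_hvec]
  have hnil := isLocallyNilpotentEnd_heis hk
  have hnot : ¬ IsLocallyNilpotentEnd (mode (twist heisenberg.Y Φ) hvec k) := by
    intro h
    -- The vacuum is killed by h_k, hence is an eigenvector of h_k - k with eigenvalue -k ≠ 0.
    refine one_ne_zero (eq_zero_of_eq_smul h (neg_ne_zero.2 hk0) (w := (1 : Fock)) ?_)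
    rw [hmode, LinearMap.sub_apply, heis_natCast_one, zero_sub, neg_smul]
    rfl
  refine ⟨fun w => ?_, hauto, ?_, hval, fun W _ _ YW hW =>
    ⟨hW.twist hauto.isPseudoEndomorphism, mode_twist_hvec hW k hval⟩, htwist, ?_, ?_, ?_, ?_, hnot,
    ?_⟩
  · rw [pseudoX_zMonomial_apply]
    refine finsum_congr fun n => ?_
    rw [show (-k - (n + 1) : ℤ) = -(n + 1) - k by ring]
    rfl
  · exact (pseudoX_zMonomial_hvec _).trans hneg
  · rwa [mode_hvec]
  · rw [hmode, mode_hvec]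
  · rw [hmode]
    exact isLocallyFiniteEnd_sub_smul hnil k
  · rintro ⟨N, hN⟩
    exact hnot fun w => ⟨N, by rw [hN, LinearMap.zero_apply]⟩
  -- A highest weight vector of the twisted module would satisfy h_k w = k w, against local
  -- nilpotency of h_k; neither the h_0-eigenvalue nor generation enters.
  · rintro ⟨c, w, hw, -, hn, -⟩
    refine hw (eq_zero_of_eq_smul hnil hk0 ?_)
    have h := hn k (by exact_mod_cast hk)
    rw [hmode] at h
    exact sub_eq_zero.1 h
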